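/- **Setting.** An MDP has a finite vertex set $V$, partitioned into control vertices, each with a nonempty set of successors, and random vertices $u$, each with a probability distribution $\delta(u)$ on $V$ (its successors are the $w$ with $\delta(u)(w)>0$). Let $\delta_{\min}$ be the minimum positive transition probability, and $\delta_{\min}=\frac12$ if all transitions have probability $1$. An instance $I=\langle M,v,T,B,p\rangle$ consists of an MDP $M$, a vertex $v$, a set $T$ of target vertices, all of them sinks (the only successor is the vertex itself), and $B,p\in[0,1]$. A token starts at $v$; the reachability player has budget $B$, the safety player $1-B$. At a control vertex both players simultaneously bid at most their budgets; the higher bidder (the reachability player in a tie) pays his bid to the other player and moves the token to a successor; at a random vertex $u$ the token moves according to $\delta(u)$. Policies map the own budget and the history to a bid and a successor. $\Pi_{\mathsf R}(B,p,v)$ is the set of reachability policies that reach $T$ with probability at least $p$ against every safety policy, and $\Pi_{\mathsf S}(B,p,v)$ the set of safety policies against which $T$ is reached with probability at most $p$ under every reachability policy. The threshold $Th_v$ is the set of $(B,p)\in[0,1]^2$ such that $\Pi_{\mathsf R}(B',p',v)\neq\emptyset$ for all $B'>B$, $p'<p$, and $\Pi_{\mathsf S}(B',p',v)\ne\emptyset$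 for all $B'<B$, $p'>p$ (with $B',p'\in[0,1]$). **Value iteration.** If $v\in T$, let $\mathrm{rval}^0_v=[0,1]^2$ and $\mathrm{sval}^0_v=[0,1]\times\{1\}\cup\{0\}\times[0,1]$; otherwise let $\mathrm{rval}^0_v=[0,1]\times\{0\}\cup\{1\}\times[0,1]$ and $\mathrm{sval}^0_v=[0,1]^2$. For sets $S_w$ let $\mathcal T_v((S_w)_w)$ be, for random $v$, the set of all $(B,\sum_w\delta(v)(w)p_w)$ with $(B,p_w)\in S_w$ for all successors $w$, and, for control $v$, the set of all $(\frac{B_++B_-}2,p)$ with $(B_-,p)\in S_w$ for some successor $w$ and $(B_+,p)\in S_w$ for all successors $w$. Let $\mathrm{rval}^{i+1}_v=\mathcal T_v((\mathrm{rval}^i_w)_w)$, $\mathrm{sval}^{i+1}_v=\mathcal T_v((\mathrm{sval}^i_w)_w)$, $\mathrm{rval}^*_v=\overline{\bigcup_i\mathrm{rval}^i_v}$ and $\mathrm{sval}^*_v=\bigcap_i\mathrm{sval}^i_v$. The distance $\epsilon$ of $(B,p)$ from the threshold is its $L_\infty$-distance to $\mathrm{sval}^*_v$ if $(B,p)\in\mathrm{rval}^*_v$,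 and to $\mathrm{rval}^*_v$ otherwise. For $\alpha>0$ let $\Delta_\alpha(S)$ be the union of the closed cells of the grid of mesh $\alpha$ on $[0,1]^2$ that meet $S$, and let $|\mathrm{sval}|^0_v=\Delta_\alpha(\mathrm{sval}^0_v)$, $|\mathrm{sval}|^{i+1}_v=\Delta_\alpha(\mathcal T_v((|\mathrm{sval}|^i_w)_w))$, $|\mathrm{rval}|^i_v=([0,1]^2\setminus|\mathrm{sval}|^i_v)\cup\mathrm{rval}^0_v$. **AlgApprox** (with constants $c,d>0$). For $h=1,2,3,\dots$: let $\bar\epsilon=2^{-h}$, $n=\lceil\log_2(1/\bar\epsilon)\,(c+d\,\delta_{\min}^{-2|V|})\rceil$ and $\alpha=\bar\epsilon/n$. If $(B,p)\in|\mathrm{rval}|^n_v$, return "$\mathsf R$". Otherwise, if the $L_\infty$-distance of $(B,p)$ from $|\mathrm{rval}|^n_v$ is at least $2\bar\epsilon$, return "$\mathsf S$". **Theorem.** Time is measured on a random access machine, either with uniform cost (every instruction costs one) or with logarithmic (bit) cost; machines get instances with rational data. 1. For each $j\in\{\mathsf R,\mathsf S\}$, the problem of deciding whether $\Pi_j(B,p,v)\neq\emptyset$,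 restricted to instances with $(B,p)\notin Th_v$, is decidable in exponential time, where the precision $1/\epsilon$ counts as a parameter of the input: there are a polynomial $q$ and a $k$ such that it is decided with bit cost at most $2^{q(\ell)}(1/\epsilon)^k$, where $\ell$ is the length of the input in bits. In particular, for every polynomial $r$ its restriction to instances with $\epsilon\geq2^{-r(\ell)}$ is in EXPTIME. 2. There are universal constants $c,d>0$ such that AlgApprox is sound and complete on all instances with $(B,p)\notin Th_v$: for such an instance $\epsilon>0$; AlgApprox terminates after at most $\lceil\log_2(1/\epsilon)\rceil+1$ rounds; for each $j$ it returns $j$ if and only if $\Pi_j(B,p,v)\neq\emptyset$; and $(B,p)$ lies in the interior relative to $[0,1]^2$ of $\mathrm{rval}^*_v$ if it returns $\mathsf R$, and of $\mathrm{sval}^*_v$ if it returns $\mathsf S$. Moreover, with these constants, AlgApprox can be implemented (the machine outputs the answer and the number of the final round) with uniform cost $$O\Bigl(\frac{|V|^2}{\epsilon}\,\max\{1,\log_2(1/\epsilon)\}^3\,\delta_{\min}^{-4|V|}\Bigr),$$ and at the same time with bit cost at most $2^{q(\ell)}(1/\epsilon)^k$ for some polynomial $q$ and some $k$. -/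

import Mathlib

open Set MeasureTheory ProbabilityTheory
open scoped Topology ENNReal

noncomputable section

namespace BiddingMDP

/-! ### Markov decision processes -/

/-- A finite MDP.  `ctrl` is the set of control vertices, its complement the set of random
vertices.  `E` is only meaningful on control vertices and `δ` only on random ones. Successors are
arbitrary vertices, so that sinks (self-loops) exist; MDPs in which control and random vertices
alternate are a special case. -/
structure MDP (V : Type*) [Fintype V] where
  ctrl : Set V
  E : V → Set V
  E_nonempty : ∀ v ∈ ctrl, (E v).Nonempty
  δ : V → V → ℝ
  δ_nonneg : ∀ v ∉ ctrl, ∀ w, 0 ≤ δ v w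
  δ_sum : ∀ v ∉ ctrl, ∑ w, δ v w = 1

variable {V : Type*} [Fintype V]

open Classical in
/-- The successors of a vertex. -/
def MDP.succ (M : MDP V) (v : V) : Set V :=
  if v ∈ M.ctrl then M.E v else {w | 0 < M.δ v w}

/-- A sink is a vertex whose only successor is itself. -/
def MDP.IsSink (M : MDP V) (v : V) : Prop := M.succ v = {v}

open Classical in
/-- The minimum transition probability, with the convention that it is `1/2` if every transition
has probability one.  (If some transition probability lies strictly between `0` and `1`, then the
minimum is at most `1/2`, so adjoining `1/2` changes the minimum only in the conventional case.) -/
def MDP.δmin (M : MDP V) : ℝ :=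
  (insert (1 / 2 : ℝ)
    ((Finset.univ.filter fun e : V × V => e.1 ∉ M.ctrl ∧ 0 < M.δ e.1 e.2).image
      fun e => M.δ e.1 e.2)).min' (Finset.insert_nonempty _ _)

/-! ### Histories, policies, and the induced distribution on infinite paths -/

/-- Histories `v⁰ … vⁿ`. -/
abbrev Hist (V : Type*) (n : ℕ) : Type _ := Finset.Iic n → V

/-- The last vertex of a history. -/
def Hist.last {V : Type*} {n : ℕ} (ρ : Hist V n) : V := ρ ⟨n, Finset.mem_Iic.2 le_rfl⟩

/-- The history with its last vertex removed. -/
def Hist.init {V : Type*} {n : ℕ} (ρ : Hist V (n + 1)) : Hist V n :=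
  fun i => ρ ⟨i.1, Finset.mem_Iic.2 ((Finset.mem_Iic.1 i.2).trans n.le_succ)⟩

/-- A policy of either player: it maps the history and the player's own available budget to a bid
that does not exceed the budget and to a successor of the current control vertex. -/
structure Policy (M : MDP V) where
  bid : (n : ℕ) → Hist V n → ℝ → ℝ
  move : (n : ℕ) → Hist V n → ℝ → V
  bid_mem : ∀ n (ρ : Hist V n), ∀ b ∈ Icc (0 : ℝ) 1, ρ.last ∈ M.ctrl → bid n ρ b ∈ Icc 0 b
  move_mem : ∀ n (ρ : Hist V n), ∀ b ∈ Icc (0 : ℝ) 1, ρ.last ∈ M.ctrl →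
    move n ρ b ∈ M.succ ρ.last

section Play

variable {M : MDP V} (σ τ : Policy M) (B : ℝ)

open Classical in
/-- The budget of the reachability player after the given history, when the reachability player
starts with `B` and follows `σ`, and the safety player follows `τ`.  The winner of a bidding pays
his bid to the other player; ties go to the reachability player. -/
def budget : (n : ℕ) → Hist V n → ℝ
  | 0, _ => B
  | n + 1, ρ =>
    let b := budget n ρ.init
    if ρ.init.last ∈ M.ctrl then
      if τ.bid n ρ.init (1 - b) ≤ σ.bid n ρ.init b then b - σ.bid n ρ.init b
      else b + τ.bid n ρ.init (1 - b)
    else b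

open Classical in
/-- The scheduler induced by the two policies: the winner of the bidding moves the token. -/
def scheduler (n : ℕ) (ρ : Hist V n) : V :=
  let b := budget σ τ B n ρ
  if τ.bid n ρ (1 - b) ≤ σ.bid n ρ b then σ.move n ρ b else τ.move n ρ (1 - b)

variable [MeasurableSpace V] [DiscreteMeasurableSpace V]

open Classical in
/-- The distribution of the next vertex after a history. -/
def nextDist (n : ℕ) (ρ : Hist V n) : Measure V :=
  if ρ.last ∈ M.ctrl then Measure.dirac (scheduler σ τ B n ρ)
  else ∑ w, ENNReal.ofReal (M.δ ρ.last w) • Measure.dirac w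

/-- The next-vertex distributions as transition kernels. -/
def stepKernel (n : ℕ) : Kernel (Hist V n) V where
  toFun := nextDist σ τ B n
  measurable' := Measurable.of_discrete

instance (n : ℕ) : IsMarkovKernel (stepKernel σ τ B n) := by
  refine ⟨fun ρ => ⟨?_⟩⟩
  change nextDist σ τ B n ρ univ = 1
  unfold nextDist
  split_ifs with h
  · simp
  · simp only [Measure.coe_finsetSum, Finset.sum_apply, Measure.smul_apply, measure_univ,
      smul_eq_mul, mul_one]
    rw [← ENNReal.ofReal_sum_of_nonneg fun w _ => M.δ_nonneg _ h w, M.δ_sum _ h,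
      ENNReal.ofReal_one]

/-- The distribution over infinite paths from the initial configuration `⟨v, B⟩`. -/
def pathMeasure (v : V) : Measure (ℕ → V) :=
  Kernel.traj (X := fun _ => V) (fun n => stepKernel σ τ B n) 0 (fun _ => v)

/-- The probability of eventually visiting `T`. -/
def reachProb (T : Set V) (v : V) : ℝ :=
  (pathMeasure σ τ B v).real {x | ∃ i, x i ∈ T}

end Play

/-- The two players. -/
inductive Player
  | reach
  | safe
  deriving DecidableEq

/-- The winning policies of each player for the reachability specification, initial configuration
`⟨v, B⟩` and required probability `p`. -/
def winPol (M : MDP V) (T : Set V) [MeasurableSpace V] [DiscreteMeasurableSpace V]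
    (B p : ℝ) (v : V) : Player → Set (Policy M)
  | .reach => {σ | ∀ τ : Policy M, p ≤ reachProb σ τ B T v}
  | .safe => {τ | ∀ σ : Policy M, reachProb σ τ B T v ≤ p}

/-- The unit square, whose points are pairs (budget, probability). -/
def unitSquare : Set (ℝ × ℝ) := Icc 0 1 ×ˢ Icc 0 1

/-- The threshold of a vertex. -/
def threshold (M : MDP V) (T : Set V) [MeasurableSpace V] [DiscreteMeasurableSpace V] (v : V) :
    Set (ℝ × ℝ) :=
  {x | x ∈ unitSquare ∧
    (∀ y ∈ unitSquare, x.1 < y.1 → y.2 < x.2 → (winPol M T y.1 y.2 v .reach).Nonempty) ∧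
    (∀ y ∈ unitSquare, y.1 < x.1 → x.2 < y.2 → (winPol M T y.1 y.2 v .safe).Nonempty)}

/-! ### Value iteration -/

open Classical in
/-- The value iteration operator. -/
def bellman (M : MDP V) (v : V) (val : V → Set (ℝ × ℝ)) : Set (ℝ × ℝ) :=
  if v ∈ M.ctrl then
    {x | x.2 ∈ Icc (0 : ℝ) 1 ∧ ∃ Bplus Bminus : ℝ, x.1 = (Bplus + Bminus) / 2 ∧
      (∃ w ∈ M.succ v, (Bminus, x.2) ∈ val w) ∧ (∀ w ∈ M.succ v, (Bplus, x.2) ∈ val w)}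
  else
    {x | x.1 ∈ Icc (0 : ℝ) 1 ∧ ∃ q : V → ℝ, (∀ w ∈ M.succ v, (x.1, q w) ∈ val w) ∧
      x.2 = ∑ w with w ∈ M.succ v, M.δ v w * q w}

open Classical in
/-- Initial reachability values. -/
def rval0 (T : Set V) (v : V) : Set (ℝ × ℝ) :=
  if v ∈ T then unitSquare else (Icc 0 1 ×ˢ {0}) ∪ ({1} ×ˢ Icc 0 1)

open Classical in
/-- Initial safety values. -/
def sval0 (T : Set V) (v : V) : Set (ℝ × ℝ) :=
  if v ∈ T then (Icc 0 1 ×ˢ {1}) ∪ ({0} ×ˢ Icc 0 1) else unitSquare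

/-- Bounded-horizon reachability values. -/
def rval (M : MDP V) (T : Set V) : ℕ → V → Set (ℝ × ℝ)
  | 0, v => rval0 T v
  | i + 1, v => bellman M v (rval M T i)

/-- Bounded-horizon safety values. -/
def sval (M : MDP V) (T : Set V) : ℕ → V → Set (ℝ × ℝ)
  | 0, v => sval0 T v
  | i + 1, v => bellman M v (sval M T i)

/-- Limit reachability values. -/
def rvalStar (M : MDP V) (T : Set V) (v : V) : Set (ℝ × ℝ) := closure (⋃ i, rval M T i v)

/-- Limit safety values. -/
def svalStar (M : MDP V) (T : Set V) (v : V) : Set (ℝ × ℝ) := ⋂ i, sval M T i v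

open Classical in
/-- The distance of a point from the threshold of `v`, in the `L∞` metric (which is the metric of
the product `ℝ × ℝ`): the distance of a point of either limit value to the other limit value. -/
def thresholdDist (M : MDP V) (T : Set V) (v : V) (x : ℝ × ℝ) : ℝ :=
  if x ∈ rvalStar M T v then Metric.infDist x (svalStar M T v)
  else Metric.infDist x (rvalStar M T v)

/-! ### Abstract value iteration on a grid -/

/-- The grid cell with lower left corner `(iα, jα)`. -/
def gridCell (α : ℝ) (i j : ℕ) : Set (ℝ × ℝ) :=
  Icc (i * α) ((i + 1) * α) ×ˢ Icc (j * α) ((j + 1) * α)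

/-- Over-approximation of a set by the grid cells of the unit square that meet it. -/
def gridHull (α : ℝ) (S : Set (ℝ × ℝ)) : Set (ℝ × ℝ) :=
  ⋃ (i : ℕ) (j : ℕ) (_ : (i : ℝ) < 1 / α ∧ (j : ℝ) < 1 / α ∧ (gridCell α i j ∩ S).Nonempty),
    gridCell α i j

/-- Abstract safety values. -/
def absSval (M : MDP V) (T : Set V) (α : ℝ) : ℕ → V → Set (ℝ × ℝ)
  | 0, v => gridHull α (sval0 T v)
  | i + 1, v => gridHull α (bellman M v (absSval M T α i))

/-- Abstract reachability values. -/
def absRval (M : MDP V) (T : Set V) (α : ℝ) (i : ℕ) (v : V) : Set (ℝ × ℝ) :=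
  (unitSquare \ absSval M T α i v) ∪ rval0 T v

/-! ### Problem instances and the algorithm -/

/-- A problem instance; the targets are sinks. -/
structure Instance (V : Type*) [Fintype V] where
  M : MDP V
  T : Set V
  sinks : ∀ v ∈ T, M.IsSink v
  v : V
  B : ℝ
  p : ℝ
  B_mem : B ∈ Icc (0 : ℝ) 1
  p_mem : p ∈ Icc (0 : ℝ) 1

namespace Instance

variable (I : Instance V)

/-- Player `j` has a winning policy. -/
def Wins [MeasurableSpace V] [DiscreteMeasurableSpace V] (j : Player) : Prop :=
  (winPol I.M I.T I.B I.p I.v j).Nonempty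

/-- The pair `(B, p)` does not lie on the threshold of the initial vertex. -/
def OffThreshold [MeasurableSpace V] [DiscreteMeasurableSpace V] : Prop :=
  (I.B, I.p) ∉ threshold I.M I.T I.v

/-- The distance of `(B, p)` from the threshold of the initial vertex. -/
def dist : ℝ := thresholdDist I.M I.T I.v (I.B, I.p)

/-- The precision `2⁻ʰ` of round `h`. -/
def eps (h : ℕ) : ℝ := 2⁻¹ ^ h

/-- The number of iterations of abstract value iteration in round `h`. -/
def iters (c d : ℝ) (h : ℕ) : ℕ :=
  ⌈Real.logb 2 (1 / eps h) * (c + d * (1 / I.M.δmin) ^ (2 * Fintype.card V))⌉₊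

/-- The abstract reachability value of the initial vertex in round `h`. -/
def roundRval (c d : ℝ) (h : ℕ) : Set (ℝ × ℝ) :=
  absRval I.M I.T (eps h / I.iters c d h) (I.iters c d h) I.v

open Classical in
/-- The answer given in round `h`, if any: `some .reach` stands for "`(B, p)` is in the interior of
the limit reachability value", `some .safe` for the same with the limit safety value. -/
def round (c d : ℝ) (h : ℕ) : Option Player :=
  if (I.B, I.p) ∈ I.roundRval c d h then some .reach
  else if 2 * eps h ≤ Metric.infDist (I.B, I.p) (I.roundRval c d h) then some .safe
  else none

/-- The algorithm, which runs the rounds `h = 1, 2, 3, …` until one of them gives an answer,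
terminates in round `h` with answer `j`. -/
def AlgApproxReturns (c d : ℝ) (h : ℕ) (j : Player) : Prop :=
  1 ≤ h ∧ I.round c d h = some j ∧ ∀ h', 1 ≤ h' → h' < h → I.round c d h' = none

end Instance

/-! ### Random access machines -/

/-- Arithmetic instructions (`sub` truncates at `0`, `div` rounds down, `x / 0 = 0`). -/
inductive ArithOp
  | add
  | sub
  | mul
  | div

/-- The value of an arithmetic instruction. -/
def ArithOp.eval : ArithOp → ℕ → ℕ → ℕ
  | .add, a, b => a + b
  | .sub, a, b => a - b
  | .mul, a, b => a * b
  | .div, a, b => a / b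

/-- A machine state: the registers (a program uses finitely many) and the addressable memory. -/
structure RAM where
  reg : ℕ → ℕ
  mem : ℕ → ℕ

/-- Programs of the random access machine. -/
inductive Prog
  /-- `reg r := k` -/
  | const (r k : ℕ)
  /-- `reg r := reg a op reg b` -/
  | arith (o : ArithOp) (r a b : ℕ)
  /-- `reg r := mem (reg a)` -/
  | load (r a : ℕ)
  /-- `mem (reg a) := reg r` -/
  | store (a r : ℕ)
  | seq (P Q : Prog)
  /-- `if reg r ≠ 0 then P else Q` -/
  | ite (r : ℕ) (P Q : Prog)
  /-- `while reg r ≠ 0 do P` -/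
  | loop (r : ℕ) (P : Prog)

/-- Write to a register. -/
def RAM.setReg (s : RAM) (r x : ℕ) : RAM := ⟨Function.update s.reg r x, s.mem⟩

/-- Write to a memory cell. -/
def RAM.setMem (s : RAM) (a x : ℕ) : RAM := ⟨s.reg, Function.update s.mem a x⟩

/-- `Exec P s s' t b`: started in `s`, the program `P` halts in `s'`, with uniform cost `t` (every
instruction and every test costs one) and logarithmic cost `b` (every instruction and every test
costs one plus the number of bits of all numbers and addresses it handles). -/
inductive Exec : Prog → RAM → RAM → ℕ → ℕ → Prop
  | const (r k : ℕ) (s : RAM) :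
      Exec (.const r k) s (s.setReg r k) 1 (1 + k.size)
  | arith (o : ArithOp) (r a b : ℕ) (s : RAM) :
      Exec (.arith o r a b) s (s.setReg r (o.eval (s.reg a) (s.reg b))) 1
        (1 + (s.reg a).size + (s.reg b).size + (o.eval (s.reg a) (s.reg b)).size)
  | load (r a : ℕ) (s : RAM) :
      Exec (.load r a) s (s.setReg r (s.mem (s.reg a))) 1
        (1 + (s.reg a).size + (s.mem (s.reg a)).size)
  | store (a r : ℕ) (s : RAM) :
      Exec (.store a r) s (s.setMem (s.reg a) (s.reg r)) 1
        (1 + (s.reg a).size + (s.reg r).size)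
  | seq {P Q : Prog} {s₁ s₂ s₃ : RAM} {t t' b b' : ℕ} :
      Exec P s₁ s₂ t b → Exec Q s₂ s₃ t' b' → Exec (.seq P Q) s₁ s₃ (t + t') (b + b')
  | iteTrue {r : ℕ} {P Q : Prog} {s s' : RAM} {t b : ℕ} :
      s.reg r ≠ 0 → Exec P s s' t b → Exec (.ite r P Q) s s' (1 + t) (1 + (s.reg r).size + b)
  | iteFalse {r : ℕ} {P Q : Prog} {s s' : RAM} {t b : ℕ} :
      s.reg r = 0 → Exec Q s s' t b → Exec (.ite r P Q) s s' (1 + t) (1 + (s.reg r).size + b)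
  | loopDone {r : ℕ} {P : Prog} {s : RAM} :
      s.reg r = 0 → Exec (.loop r P) s s 1 (1 + (s.reg r).size)
  | loopStep {r : ℕ} {P : Prog} {s₁ s₂ s₃ : RAM} {t t' b b' : ℕ} :
      s₁.reg r ≠ 0 → Exec P s₁ s₂ t b → Exec (.loop r P) s₂ s₃ t' b' →
      Exec (.loop r P) s₁ s₃ (1 + t + t') (1 + (s₁.reg r).size + b + b')

/-- The initial state: the input stands in memory from cell `0` on, all else is `0`. -/
def RAM.start (input : List ℕ) : RAM := ⟨fun _ => 0, fun i => input.getD i 0⟩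

/-- The length of an input in bits, with one separator per number. -/
def bitLength (input : List ℕ) : ℕ := (input.map fun x => x.size + 1).sum

open Classical in
/-- The problem "is `x ∈ A`?" for inputs `x ∈ D` (a promise) is decided by a random access machine
whose logarithmic cost on `x` is at most `bound x`.  The answer is left in register `0`. -/
def DecidableInTime {ι : Type*} (encode : ι → List ℕ) (D A : Set ι) (bound : ι → ℝ) : Prop :=
  ∃ P : Prog, ∀ x ∈ D, ∃ (s : RAM) (t b : ℕ), Exec P (RAM.start (encode x)) s t b ∧
    s.reg 0 = (if x ∈ A then 1 else 0) ∧ (b : ℝ) ≤ bound x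

/-- The promise problem `(D, A)` is in EXPTIME. -/
def InEXPTIME {ι : Type*} (encode : ι → List ℕ) (D A : Set ι) : Prop :=
  ∃ q : Polynomial ℕ, DecidableInTime encode D A fun x => 2 ^ q.eval (bitLength (encode x))

/-! ### Problem instances as inputs of machines -/

/-- Problem instances with rational data on the vertices `0, …, N - 1`. -/
structure RatInstance where
  N : ℕ
  ctrl : Fin N → Bool
  edge : Fin N → Fin N → Bool
  δ : Fin N → Fin N → ℚ≥0
  tgt : Fin N → Bool
  v : Fin N
  B : ℚ≥0
  p : ℚ≥0
  edge_nonempty : ∀ u, ctrl u = true → ∃ w, edge u w = true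
  δ_sum : ∀ u, ctrl u = false → ∑ w, δ u w = 1
  sinks : ∀ u, tgt u = true →
    ∀ w, (if ctrl u then edge u w = true else 0 < δ u w) ↔ w = u
  B_le : B ≤ 1
  p_le : p ≤ 1

namespace RatInstance

variable (I : RatInstance)

/-- The MDP of a rational instance. -/
def toMDP : MDP (Fin I.N) where
  ctrl := {u | I.ctrl u = true}
  E u := {w | I.edge u w = true}
  E_nonempty := I.edge_nonempty
  δ u w := I.δ u w
  δ_nonneg _ _ _ := NNRat.cast_nonneg _
  δ_sum u hu := by
    have := I.δ_sum u (by simpa using hu)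
    exact_mod_cast this

/-- The problem instance given by rational data. -/
def toInstance : Instance (Fin I.N) where
  M := I.toMDP
  T := {u | I.tgt u = true}
  sinks u hu := by
    ext w
    have := I.sinks u hu w
    rw [mem_singleton_iff, ← this]
    by_cases hc : I.ctrl u = true <;> simp [MDP.succ, toMDP, hc]
  v := I.v
  B := I.B
  p := I.p
  B_mem := ⟨NNRat.cast_nonneg _, by exact_mod_cast I.B_le⟩
  p_mem := ⟨NNRat.cast_nonneg _, by exact_mod_cast I.p_le⟩

/-- The encoding of an instance: numbers are given by their numerators and denominators in lowest
terms, edges and probabilities by full tables. -/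
def encode : List ℕ :=
  [I.N, I.v, I.B.num, I.B.den, I.p.num, I.p.den] ++
    (List.finRange I.N).flatMap (fun u => [(I.ctrl u).toNat, (I.tgt u).toNat]) ++
    (List.finRange I.N).flatMap fun u => (List.finRange I.N).flatMap fun w =>
      [(I.edge u w).toNat, (I.δ u w).num, (I.δ u w).den]

end RatInstance

/-- How a machine reports the winner. -/
def Player.code : Player → ℕ
  | .reach => 1
  | .safe => 0

end BiddingMDP

end

namespace BiddingMDP

/-! ### Monotone regions of the unit square -/

/-! Every value is a closed region of the unit square, monotone in budget and probability, and the
point reflection of the square exchanges the two players. Two invariants of the operator carry the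
qualitative part: the reachability and the safety value of one horizon cover the square
(`bellman_cover`), and they overlap in boundaries only (`thin_bellman`). Each limit value is
contained in its own image under the operator. This is half of a fixed point equation, and for the
safety player it supplies a stationary policy. A player keeps a small surplus of budget in reserve
and bids half the difference of the two budgets in the Bellman equation. The best probability that
is still guaranteed is then a submartingale, respectively a supermartingale, along the play
(`reach_wins_of_rval`, `safe_wins_of_svalStar`). Hence a point off the threshold lies strictly on
one side of the boundary, has positive distance from it, and exactly one player wins
(`sides_of_notMem_threshold`, `ReachSide.wins`, `SafeSide.wins`).

The heart is the rate of convergence. The gap between the limit value and the value of horizon `t`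
is measured by hyperbolas `ab = D`, where `a` is the extra budget and `b` the sacrificed
probability. Control vertices average budgets at a fixed probability, random vertices average
probabilities at a fixed budget, and both average `D` linearly. From an extreme point of a limit
value one can pass to a successor with an extreme point that is weakly further up and to the left.
By extremality no vertex recurs before a target, or a vertex that cannot reach a target, is met, and
there the gap is zero. So `|V|` iterations multiply `D` by at most `1 - δmin ^ |V|`
(`hypGap_corner`), and the prescribed number `n` of iterations brings the gap down to a quarter of
the precision (`gap_of_iters`). The grid adds an error of at most `(n + 1)α` (`absSval_error`). The
total stays below twice the precision, so no round answers wrongly, and a round answers as soon as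
twice its precision is at most the distance (`Instance.algApprox_correct`).

For the running time, abstract values are staircases of grid cells, stored by a lower boundary and a
right boundary. Random vertices update the former, control vertices the latter, and conjugation of
staircases recovers the other one in linear time (`RatInstance.absSval_isCells`). The algorithm is
written in a small language of bounded loops, verified there, and compiled to the machine. A round
with `K` cells per side and `n` iterations costs `O(|V|² K n)`. Since all second factors of
multiplications stay below a fixed bound, numbers gain boundedly many bits per step, so the uniform
cost also controls the bit cost (`Run.exec`). -/

/-- Regions of the unit square that are closed under increasing the budget and decreasing the
probability, and contain the bottom and the right edge. -/
structure IsUp (X : Set (ℝ × ℝ)) : Prop where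
  sub : X ⊆ unitSquare
  mono : ∀ {B p B' p'}, (B, p) ∈ X → B ≤ B' → B' ≤ 1 → p' ≤ p → 0 ≤ p' → (B', p') ∈ X
  bot : ∀ {B}, B ∈ Icc (0 : ℝ) 1 → (B, (0 : ℝ)) ∈ X
  right : ∀ {p}, p ∈ Icc (0 : ℝ) 1 → ((1 : ℝ), p) ∈ X

/-- Regions of the unit square that are closed under decreasing the budget and increasing the
probability, and contain the top and the left edge. -/
structure IsDn (X : Set (ℝ × ℝ)) : Prop where
  sub : X ⊆ unitSquare
  mono : ∀ {B p B' p'}, (B, p) ∈ X → B' ≤ B → 0 ≤ B' → p ≤ p' → p' ≤ 1 → (B', p') ∈ X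
  top : ∀ {B}, B ∈ Icc (0 : ℝ) 1 → (B, (1 : ℝ)) ∈ X
  left : ∀ {p}, p ∈ Icc (0 : ℝ) 1 → ((0 : ℝ), p) ∈ X

/-- The point reflection of the unit square. -/
def reflect (x : ℝ × ℝ) : ℝ × ℝ := (1 - x.1, 1 - x.2)

lemma mem_unitSquare {B p : ℝ} : (B, p) ∈ unitSquare ↔ (0 ≤ B ∧ B ≤ 1) ∧ 0 ≤ p ∧ p ≤ 1 := Iff.rfl

lemma continuous_reflect : Continuous reflect := by unfold reflect; fun_prop

lemma reflect_mem_unitSquare {x : ℝ × ℝ} : reflect x ∈ unitSquare ↔ x ∈ unitSquare := by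
  obtain ⟨B, p⟩ := x
  simp only [reflect, mem_unitSquare]
  constructor <;> rintro ⟨⟨_, _⟩, _, _⟩ <;> refine ⟨⟨?_, ?_⟩, ?_, ?_⟩ <;> linarith

/-- The point reflection swaps the two kinds of regions, so facts about safety values can be deduced
from those about reachability values. -/
lemma IsUp.isDn {X : Set (ℝ × ℝ)} (h : IsUp (reflect ⁻¹' X)) : IsDn X where
  sub x hx := by
    rw [← reflect_mem_unitSquare]
    apply h.sub
    simpa [reflect] using hx
  mono {B p B' p'} hx h1 h2 h3 h4 := by
    have : ((1 - B' : ℝ), (1 - p' : ℝ)) ∈ reflect ⁻¹' X :=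
      h.mono (B := 1 - B) (p := 1 - p) (by simpa [reflect] using hx) (by linarith) (by linarith)
        (by linarith) (by linarith)
    simpa [reflect] using this
  top {B} hB := by
    have := h.bot (B := 1 - B) ⟨by linarith [hB.2], by linarith [hB.1]⟩
    simpa [reflect] using this
  left {p} hp := by
    have := h.right (p := 1 - p) ⟨by linarith [hp.2], by linarith [hp.1]⟩
    simpa [reflect] using this

/-! ### The value iteration operator on monotone regions. -/

section Bellman

variable {V : Type*} [Fintype V] {M : MDP V}

lemma MDP.succ_ctrl {v : V} (hv : v ∈ M.ctrl) : M.succ v = M.E v := by simp [MDP.succ, hv]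

lemma MDP.mem_succ_rand {v w : V} (hv : v ∉ M.ctrl) : w ∈ M.succ v ↔ 0 < M.δ v w := by
  simp [MDP.succ, hv]

lemma MDP.succ_nonempty (M : MDP V) (v : V) : (M.succ v).Nonempty := by
  by_cases hv : v ∈ M.ctrl
  · rw [M.succ_ctrl hv]; exact M.E_nonempty v hv
  · by_contra h
    have h0 : ∀ w, M.δ v w = 0 := fun w => by
      by_contra hw
      exact h ⟨w, (M.mem_succ_rand hv).2 (lt_of_le_of_ne (M.δ_nonneg v hv w) (Ne.symm hw))⟩
    have := M.δ_sum v hv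
    simp [h0] at this

lemma MDP.eq_zero_of_notMem {v w : V} (hv : v ∉ M.ctrl) (hw : w ∉ M.succ v) : M.δ v w = 0 :=
  le_antisymm (not_lt.1 fun h => hw ((M.mem_succ_rand hv).2 h)) (M.δ_nonneg v hv w)

open Classical in
lemma MDP.sum_succ {v : V} (hv : v ∉ M.ctrl) (f : V → ℝ) :
    ∑ w with w ∈ M.succ v, M.δ v w * f w = ∑ w, M.δ v w * f w := by
  refine Finset.sum_subset (Finset.filter_subset _ _) fun w _ hw => ?_
  rw [M.eq_zero_of_notMem hv (by simpa using hw), zero_mul]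

lemma mem_bellman_ctrl {v : V} (hv : v ∈ M.ctrl) {X : V → Set (ℝ × ℝ)} {x : ℝ × ℝ} :
    x ∈ bellman M v X ↔ x.2 ∈ Icc (0 : ℝ) 1 ∧ ∃ Bplus Bminus : ℝ, x.1 = (Bplus + Bminus) / 2 ∧
      (∃ w ∈ M.succ v, (Bminus, x.2) ∈ X w) ∧ (∀ w ∈ M.succ v, (Bplus, x.2) ∈ X w) := by
  simp only [bellman, if_pos hv]; rfl

lemma mem_bellman_rand {v : V} (hv : v ∉ M.ctrl) {X : V → Set (ℝ × ℝ)} {x : ℝ × ℝ} :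
    x ∈ bellman M v X ↔ x.1 ∈ Icc (0 : ℝ) 1 ∧ ∃ q : V → ℝ, (∀ w ∈ M.succ v, (x.1, q w) ∈ X w) ∧
      x.2 = ∑ w, M.δ v w * q w := by
  simp only [bellman, if_neg hv, mem_ofPred_eq, M.sum_succ hv]

lemma bellman_mono {v : V} {X Y : V → Set (ℝ × ℝ)} (h : ∀ w, X w ⊆ Y w) :
    bellman M v X ⊆ bellman M v Y := by
  intro x hx
  by_cases hv : v ∈ M.ctrl
  · rw [mem_bellman_ctrl hv] at hx ⊢
    obtain ⟨h1, b, b', h2, ⟨w, hw, h3⟩, h4⟩ := hx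
    exact ⟨h1, b, b', h2, ⟨w, hw, h w h3⟩, fun w hw => h w (h4 w hw)⟩
  · rw [mem_bellman_rand hv] at hx ⊢
    obtain ⟨h1, q, h2, h3⟩ := hx
    exact ⟨h1, q, fun w hw => h w (h2 w hw), h3⟩

lemma weighted_le {v : V} (hv : v ∉ M.ctrl) {f g : V → ℝ} (h : ∀ w ∈ M.succ v, f w ≤ g w) :
    ∑ w, M.δ v w * f w ≤ ∑ w, M.δ v w * g w := by
  rw [← M.sum_succ hv, ← M.sum_succ hv]
  exact Finset.sum_le_sum fun w hw =>
    mul_le_mul_of_nonneg_left (h w (by simpa using hw)) (M.δ_nonneg v hv w)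

lemma weighted_const {v : V} (hv : v ∉ M.ctrl) (c : ℝ) : ∑ w, M.δ v w * c = c := by
  rw [← Finset.sum_mul, M.δ_sum v hv, one_mul]

lemma bellman_sub {v : V} {X : V → Set (ℝ × ℝ)} (h : ∀ w, X w ⊆ unitSquare) :
    bellman M v X ⊆ unitSquare := by
  rintro ⟨B, p⟩ hx
  by_cases hv : v ∈ M.ctrl
  · rw [mem_bellman_ctrl hv] at hx
    obtain ⟨h1, b, b', h2, ⟨w, hw, h3⟩, h4⟩ := hx
    have h5 := h w h3
    have h6 := h w (h4 w hw)
    simp only [mem_unitSquare] at h5 h6 h2 ⊢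
    exact ⟨⟨by linarith, by linarith⟩, h1⟩
  · rw [mem_bellman_rand hv] at hx
    obtain ⟨h1, q, h2, h3⟩ := hx
    refine ⟨h1, ?_, ?_⟩
    · have := weighted_le hv (f := fun _ => 0) (g := q) fun w hw => (h w (h2 w hw)).2.1
      simp only [weighted_const hv] at this; exact this.trans_eq h3.symm
    · have := weighted_le hv (f := q) (g := fun _ => 1) fun w hw => (h w (h2 w hw)).2.2
      simp only [weighted_const hv] at this; exact h3.trans_le this


lemma weighted_sink {v : V} (hv : v ∉ M.ctrl) (hs : M.IsSink v) (q : V → ℝ) :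
    ∑ w, M.δ v w * q w = q v := by
  have hs : M.succ v = {v} := hs
  rw [← weighted_const hv (q v)]
  apply le_antisymm <;> apply weighted_le hv <;> · intro w hw; rw [hs] at hw; rw [hw]

lemma subset_bellman_sink {v : V} (hs : M.IsSink v) {X : V → Set (ℝ × ℝ)}
    (h : X v ⊆ unitSquare) : X v ⊆ bellman M v X := by
  have hs' : M.succ v = {v} := hs
  rintro ⟨B, p⟩ hx
  by_cases hc : v ∈ M.ctrl
  · rw [mem_bellman_ctrl hc, hs']
    simp only [mem_singleton_iff, exists_eq_left, forall_eq]
    exact ⟨(h hx).2, B, B, by ring, hx, hx⟩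
  · rw [mem_bellman_rand hc, hs']
    simp only [mem_singleton_iff, forall_eq]
    exact ⟨(h hx).1, fun _ => p, hx, (weighted_const hc p).symm⟩

/-- With a single successor the control rule averages two budgets of the same region. The average is
at most the larger one, so downward closure absorbs it. -/
lemma bellman_sink_subset {v : V} (hs : M.IsSink v) {X : V → Set (ℝ × ℝ)} (h : IsDn (X v)) :
    bellman M v X ⊆ X v := by
  have hs' : M.succ v = {v} := hs
  rintro ⟨B, p⟩ hx
  by_cases hc : v ∈ M.ctrl
  · rw [mem_bellman_ctrl hc, hs'] at hx
    simp only [mem_singleton_iff, exists_eq_left, forall_eq] at hx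
    obtain ⟨hp, b, b', rfl, h1, h2⟩ := hx
    have h3 := h.sub h1
    have h4 := h.sub h2
    simp only [mem_unitSquare] at h3 h4
    rcases le_total b b' with h5 | h5
    · exact h.mono h1 (by linarith) (by linarith) le_rfl hp.2
    · exact h.mono h2 (by linarith) (by linarith) le_rfl hp.2
  · rw [mem_bellman_rand hc, hs'] at hx
    simp only [mem_singleton_iff, forall_eq, weighted_sink hc hs] at hx
    obtain ⟨_, q, h1, h2⟩ := hx
    rwa [h2]

lemma isUp_bellman {v : V} {X : V → Set (ℝ × ℝ)} (h : ∀ w, IsUp (X w)) :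
    IsUp (bellman M v X) := by
  have hsub := bellman_sub (M := M) (v := v) fun w => (h w).sub
  obtain ⟨w₀, hw₀⟩ := M.succ_nonempty v
  refine ⟨hsub, ?_, ?_, ?_⟩
  · intro B p B' p' hx h1 h2 h3 h4
    have hB := hsub hx
    simp only [mem_unitSquare] at hB
    by_cases hv : v ∈ M.ctrl
    · rw [mem_bellman_ctrl hv] at hx ⊢
      obtain ⟨-, b, b', h5, ⟨w, hw, h6⟩, h7⟩ := hx
      dsimp only at h5 h6 h7 ⊢
      have hb := (h w).sub (h7 w hw)
      have hb' := (h w).sub h6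
      simp only [mem_unitSquare] at hb hb'
      refine ⟨⟨h4, by linarith⟩, ?_⟩
      rcases eq_or_lt_of_le hB.1.2 with h8 | h8
      · exact ⟨b, b', by linarith, ⟨w, hw, (h w).mono h6 le_rfl hb'.1.2 h3 h4⟩,
          fun w hw => (h w).mono (h7 w hw) le_rfl hb.1.2 h3 h4⟩
      -- Both budgets move by the same fraction `θ` of their distance to `1`: they stay at most `1`,
      -- and their midpoint moves from `B` to `B'`.
      · set θ := (B' - B) / (1 - B) with hθ
        have h9 : 0 < 1 - B := by linarith
        have hθ0 : 0 ≤ θ := div_nonneg (by linarith) h9.le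
        have hθ1 : θ ≤ 1 := (div_le_one h9).2 (by linarith)
        have hθB : θ * (1 - B) = B' - B := div_mul_cancel₀ _ h9.ne'
        have ha : ∀ c, c ≤ 1 → c ≤ c + θ * (1 - c) ∧ c + θ * (1 - c) ≤ 1 := fun c hc =>
          ⟨by nlinarith, by nlinarith⟩
        refine ⟨b + θ * (1 - b), b' + θ * (1 - b'), ?_, ⟨w, hw, (h w).mono h6 (ha _ hb'.1.2).1
          (ha _ hb'.1.2).2 h3 h4⟩, fun w hw => (h w).mono (h7 w hw) (ha _ hb.1.2).1
          (ha _ hb.1.2).2 h3 h4⟩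
        rw [h5] at hθB
        linarith
    · rw [mem_bellman_rand hv] at hx ⊢
      obtain ⟨h5, q, h6, h7⟩ := hx
      dsimp only at h5 h6 h7 ⊢
      refine ⟨⟨by linarith, h2⟩, ?_⟩
      rcases eq_or_lt_of_le hB.2.1 with h8 | h8
      · refine ⟨q, fun w hw => (h w).mono (h6 w hw) h1 h2 le_rfl ((h w).sub (h6 w hw)).2.1, ?_⟩
        linarith
      -- Scaling all successor probabilities by `p' / p` scales their mean from `p` to `p'`.
      · have hθ0 : 0 ≤ p' / p := by positivity
        have hθ1 : p' / p ≤ 1 := (div_le_one h8).2 h3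
        refine ⟨fun w => p' / p * q w, fun w hw => ?_, ?_⟩
        · have := ((h w).sub (h6 w hw)).2.1
          exact (h w).mono (h6 w hw) h1 h2 (mul_le_of_le_one_left this hθ1) (mul_nonneg hθ0 this)
        · simp only [mul_left_comm _ (p' / p), ← Finset.mul_sum, ← h7]
          field_simp
  · intro B hB
    by_cases hv : v ∈ M.ctrl
    · rw [mem_bellman_ctrl hv]
      exact ⟨⟨le_rfl, zero_le_one⟩, B, B, by simp, ⟨w₀, hw₀, (h _).bot hB⟩, fun w _ => (h w).bot hB⟩
    · rw [mem_bellman_rand hv]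
      exact ⟨hB, fun _ => 0, fun w _ => (h w).bot hB, by simp⟩
  · intro p hp
    by_cases hv : v ∈ M.ctrl
    · rw [mem_bellman_ctrl hv]
      exact ⟨hp, 1, 1, by simp, ⟨w₀, hw₀, (h _).right hp⟩, fun w _ => (h w).right hp⟩
    · rw [mem_bellman_rand hv]
      exact ⟨⟨zero_le_one, le_rfl⟩, fun _ => p, fun w _ => (h w).right hp,
        (weighted_const hv p).symm⟩

/-- Midpoints and weighted means commute with the affine map `x ↦ 1 - x`, and the operator has the
same form for both players. -/
lemma bellman_reflect (v : V) (X : V → Set (ℝ × ℝ)) :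
    bellman M v (fun w => reflect ⁻¹' X w) = reflect ⁻¹' bellman M v X := by
  ext ⟨B, p⟩
  by_cases hv : v ∈ M.ctrl
  · simp only [mem_preimage, mem_bellman_ctrl hv, reflect, mem_Icc]
    constructor
    · rintro ⟨h1, b, b', h2, ⟨w, hw, h3⟩, h4⟩
      exact ⟨⟨by linarith, by linarith⟩, 1 - b, 1 - b', by linarith, ⟨w, hw, h3⟩, h4⟩
    · rintro ⟨h1, b, b', h2, ⟨w, hw, h3⟩, h4⟩
      exact ⟨⟨by linarith, by linarith⟩, 1 - b, 1 - b', by linarith, ⟨w, hw, by simpa using h3⟩,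
        by simpa using h4⟩
  · have key : ∀ q : V → ℝ, ∑ w, M.δ v w * (1 - q w) = 1 - ∑ w, M.δ v w * q w := fun q => by
      simp only [mul_sub, Finset.sum_sub_distrib, mul_one, M.δ_sum v hv]
    simp only [mem_preimage, mem_bellman_rand hv, reflect, mem_Icc]
    constructor
    · rintro ⟨h1, q, h2, h3⟩
      exact ⟨⟨by linarith, by linarith⟩, fun w => 1 - q w, h2, by rw [key, ← h3]⟩
    · rintro ⟨h1, q, h2, h3⟩
      exact ⟨⟨by linarith, by linarith⟩, fun w => 1 - q w, by simpa using h2,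
        by rw [key, ← h3]; ring⟩

lemma reflect_reflect (X : Set (ℝ × ℝ)) : reflect ⁻¹' (reflect ⁻¹' X) = X := by
  ext; simp [reflect]

lemma IsDn.isUp {X : Set (ℝ × ℝ)} (h : IsDn X) : IsUp (reflect ⁻¹' X) where
  sub x hx := by
    rw [← reflect_mem_unitSquare]
    exact h.sub hx
  mono {B p B' p'} hx h1 h2 h3 h4 := h.mono hx (by linarith) (by linarith) (by linarith)
    (by linarith)
  bot {B} hB := by
    have := h.top (B := 1 - B) ⟨by linarith [hB.2], by linarith [hB.1]⟩
    simpa [reflect] using this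
  right {p} hp := by
    have := h.left (p := 1 - p) ⟨by linarith [hp.2], by linarith [hp.1]⟩
    simpa [reflect] using this

lemma isDn_bellman {v : V} {X : V → Set (ℝ × ℝ)} (h : ∀ w, IsDn (X w)) :
    IsDn (bellman M v X) := by
  apply IsUp.isDn
  rw [← bellman_reflect]
  exact isUp_bellman fun w => (h w).isUp

lemma isCompact_unitSquare : IsCompact unitSquare := isCompact_Icc.prod isCompact_Icc

/-- The image is a continuous image of a compact set of witnesses, or a finite union of such images,
one for each choice of the distinguished successor. -/
lemma isClosed_bellman {v : V} {X : V → Set (ℝ × ℝ)} (hX : ∀ w, IsClosed (X w))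
    (h : ∀ w, X w ⊆ unitSquare) : IsClosed (bellman M v X) := by
  by_cases hv : v ∈ M.ctrl
  · have : bellman M v X = ⋃ w₀ ∈ M.succ v, (fun y : (ℝ × ℝ) × ℝ => ((y.1.1 + y.1.2) / 2, y.2)) ''
        (((Icc 0 1 ×ˢ Icc 0 1) ×ˢ Icc 0 1) ∩ {y | (y.1.2, y.2) ∈ X w₀} ∩
          ⋂ w ∈ M.succ v, {y | (y.1.1, y.2) ∈ X w}) := by
      ext ⟨B, p⟩
      simp only [mem_bellman_ctrl hv, mem_iUnion, mem_image, mem_inter_iff, mem_iInter,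
        mem_ofPred_eq, Prod.exists, Prod.mk.injEq, exists_prop]
      constructor
      · rintro ⟨hp, b, b', rfl, ⟨w₀, hw₀, h1⟩, h2⟩
        exact ⟨w₀, hw₀, b, b', p, ⟨⟨⟨⟨(h _ (h2 _ hw₀)).1, (h _ h1).1⟩, hp⟩, h1⟩, h2⟩, rfl, rfl⟩
      · rintro ⟨w₀, hw₀, b, b', p, ⟨⟨⟨_, hp⟩, h1⟩, h2⟩, rfl, rfl⟩
        exact ⟨hp, b, b', rfl, ⟨w₀, hw₀, h1⟩, h2⟩
    rw [this]
    refine (toFinite _).isClosed_biUnion fun w₀ _ => IsCompact.isClosed (IsCompact.image ?_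
      (by fun_prop))
    refine (((isCompact_Icc.prod isCompact_Icc).prod isCompact_Icc).inter_right
      ((hX w₀).preimage (by fun_prop))).inter_right (isClosed_biInter fun w _ =>
      (hX w).preimage (by fun_prop))
  · have : bellman M v X = (fun y : ℝ × (V → ℝ) => (y.1, ∑ w, M.δ v w * y.2 w)) ''
        ((Icc 0 1 ×ˢ Set.pi univ fun _ => Icc 0 1) ∩
          ⋂ w ∈ M.succ v, {y | (y.1, y.2 w) ∈ X w}) := by
      classical
      ext ⟨B, p⟩
      simp only [mem_bellman_rand hv, mem_image, mem_inter_iff, mem_iInter,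
        mem_ofPred_eq, Prod.exists, Prod.mk.injEq]
      constructor
      · rintro ⟨hB, q, h1, rfl⟩
        -- Off the successors `q` is unconstrained; setting it to zero there puts it into the
        -- compact cube without changing the sum.
        refine ⟨B, fun w => if w ∈ M.succ v then q w else 0, ⟨⟨hB, fun w _ => ?_⟩, fun w hw => ?_⟩,
          rfl, ?_⟩
        · dsimp only
          split_ifs with hw
          · exact (h w (h1 w hw)).2
          · simp
        · simpa [hw] using h1 w hw
        · apply le_antisymm <;> apply weighted_le hv <;> · intro w hw; simp [hw]
      · rintro ⟨B, q, ⟨⟨hB, _⟩, h1⟩, rfl, rfl⟩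
        exact ⟨hB, q, h1, rfl⟩
    rw [this]
    refine IsCompact.isClosed (IsCompact.image ?_ (by fun_prop))
    exact (isCompact_Icc.prod (isCompact_univ_pi fun _ => isCompact_Icc)).inter_right
      (isClosed_biInter fun w _ => (hX w).preimage (by fun_prop))

/-- The operator is continuous along decreasing sequences of closed regions. -/
lemma mem_bellman_iInter {v : V} {X : ℕ → V → Set (ℝ × ℝ)} (hX : ∀ i w, IsClosed (X i w))
    (h : ∀ i w, X i w ⊆ unitSquare) (hanti : ∀ i w, X (i + 1) w ⊆ X i w) {x : ℝ × ℝ}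
    (hx : ∀ i, x ∈ bellman M v (X i)) : x ∈ bellman M v fun w => ⋂ i, X i w := by
  have hanti' : ∀ w, Antitone fun i => X i w := fun w => antitone_nat_of_succ_le fun i => hanti i w
  by_cases hv : v ∈ M.ctrl
  · simp only [mem_bellman_ctrl hv] at hx ⊢
    refine ⟨(hx 0).1, ?_⟩
    let F : V → ℕ → Set (ℝ × ℝ) := fun w₀ i => (Icc 0 1 ×ˢ Icc 0 1) ∩
      {y | x.1 = (y.1 + y.2) / 2 ∧ (y.2, x.2) ∈ X i w₀ ∧ ∀ w ∈ M.succ v, (y.1, x.2) ∈ X i w}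
    have hF : ∀ w, Antitone (F w) := fun w₀ i j hij y hy =>
      ⟨hy.1, hy.2.1, hanti' _ hij hy.2.2.1, fun w hw => hanti' _ hij (hy.2.2.2 w hw)⟩
    have hcl : ∀ w i, IsClosed {y : ℝ × ℝ | x.1 = (y.1 + y.2) / 2 ∧ (y.2, x.2) ∈ X i w ∧
        ∀ w ∈ M.succ v, (y.1, x.2) ∈ X i w} := fun w i => by
      refine IsClosed.inter (isClosed_eq continuous_const (by fun_prop)) (IsClosed.inter
        ((hX i w).preimage (by fun_prop)) ?_)
      have : IsClosed (⋂ w ∈ M.succ v, {y : ℝ × ℝ | (y.1, x.2) ∈ X i w}) :=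
        isClosed_biInter fun w _ => (hX i w).preimage (by fun_prop)
      have heq : {y : ℝ × ℝ | ∀ w ∈ M.succ v, (y.1, x.2) ∈ X i w} =
          ⋂ w ∈ M.succ v, {y : ℝ × ℝ | (y.1, x.2) ∈ X i w} := by
        ext y
        rw [mem_iInter₂]
        rfl
      rw [← heq] at this
      exact this
    have hcp : ∀ w i, IsCompact (F w i) := fun w i =>
      (isCompact_Icc.prod isCompact_Icc).inter_right (hcl w i)
    -- The distinguished successor may change with `i`. If every candidate failed at some index, all
    -- would fail at the maximum of these indices, because the witness sets decrease.
    have hne : ∃ w₀ ∈ M.succ v, ∀ i, (F w₀ i).Nonempty := by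
      by_contra hcon
      push Not at hcon
      choose! f hf using hcon
      set m := Finset.univ.sup f
      obtain ⟨-, b, b', h1, ⟨w₀, hw₀, h2⟩, h3⟩ := hx m
      have h4 : (b, b') ∈ F w₀ m :=
        ⟨⟨(h _ _ (h3 _ hw₀)).1, (h _ _ h2).1⟩, h1, h2, h3⟩
      have h5 := hF w₀ (Finset.le_sup (f := f) (Finset.mem_univ w₀)) h4
      rw [hf w₀ hw₀] at h5
      exact h5
    obtain ⟨w₀, hw₀, hne⟩ := hne
    obtain ⟨y, hy⟩ := IsCompact.nonempty_iInter_of_sequence_nonempty_isCompact_isClosed (F w₀)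
      (fun i => hF w₀ i.le_succ) hne (hcp w₀ 0) fun i => (hcp w₀ i).isClosed
    rw [mem_iInter] at hy
    exact ⟨y.1, y.2, (hy 0).2.1, ⟨w₀, hw₀, mem_iInter.2 fun i => (hy i).2.2.1⟩,
      fun w hw => mem_iInter.2 fun i => (hy i).2.2.2 w hw⟩
  · simp only [mem_bellman_rand hv] at hx ⊢
    refine ⟨(hx 0).1, ?_⟩
    classical
    let F : ℕ → Set (V → ℝ) := fun i => (Set.pi univ fun _ => Icc 0 1) ∩
      ((⋂ w ∈ M.succ v, {q | (x.1, q w) ∈ X i w}) ∩ {q | x.2 = ∑ w, M.δ v w * q w})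
    have hF : Antitone F := fun i j hij q hq => ⟨hq.1,
      mem_iInter₂.2 fun w hw => hanti' w hij (show (x.1, q w) ∈ X j w from
        mem_iInter₂.1 hq.2.1 w hw), hq.2.2⟩
    have hcp : ∀ i, IsCompact (F i) := fun i =>
      (isCompact_univ_pi fun _ => isCompact_Icc).inter_right (IsClosed.inter
        (isClosed_biInter fun w _ => (hX i w).preimage (by fun_prop))
        (isClosed_eq continuous_const (by fun_prop)))
    have hne : ∀ i, (F i).Nonempty := by
      intro i
      obtain ⟨-, q, h1, h2⟩ := hx i
      refine ⟨fun w => if w ∈ M.succ v then q w else 0, fun w _ => ?_, mem_iInter₂.2 fun w hw => ?_,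
        ?_⟩
      · dsimp only
        split_ifs with hw
        · exact (h i w (h1 w hw)).2
        · simp
      · simpa [hw] using h1 w hw
      · rw [mem_ofPred_eq, h2]
        apply le_antisymm <;> apply weighted_le hv <;> · intro w hw; simp [hw]
    obtain ⟨q, hq⟩ := IsCompact.nonempty_iInter_of_sequence_nonempty_isCompact_isClosed F
      (fun i => hF i.le_succ) hne (hcp 0) fun i => (hcp i).isClosed
    rw [mem_iInter] at hq
    exact ⟨q, fun w hw => mem_iInter.2 fun i => mem_iInter₂.1 (hq i).2.1 w hw, (hq 0).2.2⟩

/-- A horizontal segment is connected and covered by two closed sets, one containing its right end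
and one its left end. -/
lemma exists_boundary_budget {X Y : Set (ℝ × ℝ)} (hX : IsUp X) (hY : IsDn Y) (cX : IsClosed X)
    (cY : IsClosed Y) (h : unitSquare ⊆ X ∪ Y) {p : ℝ} (hp : p ∈ Icc (0 : ℝ) 1) :
    ∃ b, (b, p) ∈ X ∧ (b, p) ∈ Y := by
  have := isPreconnected_closed_iff.1 (isPreconnected_Icc (a := (0 : ℝ)) (b := 1))
    ((fun b => (b, p)) ⁻¹' X) ((fun b => (b, p)) ⁻¹' Y) (cX.preimage (by fun_prop))
    (cY.preimage (by fun_prop)) (fun b hb => h ⟨hb, hp⟩) ⟨1, by simp, hX.right hp⟩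
    ⟨0, by simp, hY.left hp⟩
  obtain ⟨b, -, h1, h2⟩ := this
  exact ⟨b, h1, h2⟩

lemma exists_boundary_prob {X Y : Set (ℝ × ℝ)} (hX : IsUp X) (hY : IsDn Y) (cX : IsClosed X)
    (cY : IsClosed Y) (h : unitSquare ⊆ X ∪ Y) {b : ℝ} (hb : b ∈ Icc (0 : ℝ) 1) :
    ∃ p, (b, p) ∈ X ∧ (b, p) ∈ Y := by
  have := isPreconnected_closed_iff.1 (isPreconnected_Icc (a := (0 : ℝ)) (b := 1))
    ((fun p => (b, p)) ⁻¹' X) ((fun p => (b, p)) ⁻¹' Y) (cX.preimage (by fun_prop))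
    (cY.preimage (by fun_prop)) (fun p hp => h ⟨hb, hp⟩) ⟨0, by simp, hX.bot hb⟩
    ⟨1, by simp, hY.top hb⟩
  obtain ⟨b, -, h1, h2⟩ := this
  exact ⟨b, h1, h2⟩

/-- Choose a point common to both regions at every successor. At a control vertex the mean of the
largest and the smallest such budget lies in both images: the first image uses the maximum for all
successors, the second uses the minimum. At a random vertex the weighted mean does the same.
Monotonicity then decides every other point on the line. -/
lemma bellman_cover {v : V} {X Y : V → Set (ℝ × ℝ)} (hX : ∀ w, IsUp (X w)) (hY : ∀ w, IsDn (Y w))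
    (cX : ∀ w, IsClosed (X w)) (cY : ∀ w, IsClosed (Y w))
    (h : ∀ w, unitSquare ⊆ X w ∪ Y w) : unitSquare ⊆ bellman M v X ∪ bellman M v Y := by
  rintro ⟨B, p⟩ ⟨hB, hp⟩
  dsimp only at hB hp
  by_cases hv : v ∈ M.ctrl
  · choose α h1 h2 using fun w => exists_boundary_budget (hX w) (hY w) (cX w) (cY w) (h w) hp
    obtain ⟨w₁, hw₁, hmax⟩ := Set.exists_max_image (M.succ v) α (toFinite _) (M.succ_nonempty v)
    obtain ⟨w₀, hw₀, hmin⟩ := Set.exists_min_image (M.succ v) α (toFinite _) (M.succ_nonempty v)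
    rcases le_total ((α w₁ + α w₀) / 2) B with h3 | h3
    · left
      refine (isUp_bellman hX).mono (B := (α w₁ + α w₀) / 2) (p := p) ?_ h3 hB.2 le_rfl hp.1
      rw [mem_bellman_ctrl hv]
      exact ⟨hp, _, _, rfl, ⟨w₀, hw₀, h1 _⟩, fun w hw => (hX w).mono (h1 w) (hmax w hw)
        ((hX w₁).sub (h1 _)).1.2 le_rfl hp.1⟩
    · right
      refine (isDn_bellman hY).mono (B := (α w₁ + α w₀) / 2) (p := p) ?_ h3 hB.1 le_rfl hp.2
      rw [mem_bellman_ctrl hv]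
      exact ⟨hp, α w₀, α w₁, by rw [add_comm], ⟨w₁, hw₁, h2 _⟩, fun w hw =>
        (hY w).mono (h2 w) (hmin w hw) ((hX w₀).sub (h1 _)).1.1 le_rfl hp.2⟩
  · choose q h1 h2 using fun w => exists_boundary_prob (hX w) (hY w) (cX w) (cY w) (h w) hB
    rcases le_total p (∑ w, M.δ v w * q w) with h3 | h3
    · left
      refine (isUp_bellman hX).mono (B := B) ?_ le_rfl hB.2 h3 hp.1
      rw [mem_bellman_rand hv]
      exact ⟨hB, q, fun w _ => h1 w, rfl⟩
    · right
      refine (isDn_bellman hY).mono (B := B) ?_ le_rfl hB.1 h3 hp.2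
      rw [mem_bellman_rand hv]
      exact ⟨hB, q, fun w _ => h2 w, rfl⟩

/-- The regions `X` and `Y` overlap in their boundaries only. -/
def Thin (X Y : Set (ℝ × ℝ)) : Prop :=
  ∀ ⦃B p B' p' : ℝ⦄, (B, p) ∈ X → (B', p') ∈ Y → B < B' → p' < p → False

/-- The successor singled out by one side is also among those quantified universally by the other
side. Comparing crosswise bounds both summands of the midpoint. -/
lemma thin_bellman {v : V} {X Y : V → Set (ℝ × ℝ)} (h : ∀ w, Thin (X w) (Y w)) :
    Thin (bellman M v X) (bellman M v Y) := by
  intro B p B' p' hx hy h1 h2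
  by_cases hv : v ∈ M.ctrl
  · rw [mem_bellman_ctrl hv] at hx hy
    obtain ⟨-, b, c, h3, ⟨w, hw, h4⟩, h5⟩ := hx
    obtain ⟨-, b', c', h3', ⟨w', hw', h4'⟩, h5'⟩ := hy
    have h6 : c' ≤ b := not_lt.1 fun h6 => h w' (h5 w' hw') h4' h6 h2
    have h7 : b' ≤ c := not_lt.1 fun h7 => h w h4 (h5' w hw) h7 h2
    dsimp only at h3 h3'
    linarith
  · rw [mem_bellman_rand hv] at hx hy
    obtain ⟨-, q, h3, h4⟩ := hx
    obtain ⟨-, q', h3', h4'⟩ := hy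
    dsimp only at h3 h3' h4 h4'
    have := weighted_le hv (f := q) (g := q') fun w hw => not_lt.1 fun h5 =>
      h w (h3 w hw) (h3' w hw) h1 h5
    linarith

end Bellman

/-! ### Bounded-horizon values -/

section Values

variable {V : Type*} [Fintype V] {M : MDP V} {T : Set V}

set_option linter.unusedSectionVars false

lemma isUp_unitSquare : IsUp unitSquare where
  sub := Subset.rfl
  mono {B p B' p'} hx h1 h2 h3 h4 := by
    simp only [mem_unitSquare] at hx ⊢
    exact ⟨⟨by linarith, h2⟩, h4, by linarith⟩
  bot hB := ⟨hB, by simp⟩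
  right hp := ⟨by simp, hp⟩

lemma mem_rval0 {v : V} {B p : ℝ} :
    (B, p) ∈ rval0 T v ↔ (B, p) ∈ unitSquare ∧ (v ∈ T ∨ p = 0 ∨ B = 1) := by
  by_cases hv : v ∈ T
  · simp [rval0, hv]
  · simp only [rval0, hv, if_false, mem_union, mem_prod, mem_singleton_iff, mem_unitSquare, mem_Icc,
      false_or]
    constructor
    · rintro (⟨h, rfl⟩ | ⟨rfl, h⟩)
      · simpa using h
      · simpa using h
    · rintro ⟨h, rfl | rfl⟩
      · exact Or.inl ⟨h.1, rfl⟩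
      · exact Or.inr ⟨rfl, h.2⟩

lemma mem_sval0 {v : V} {B p : ℝ} :
    (B, p) ∈ sval0 T v ↔ (B, p) ∈ unitSquare ∧ (v ∉ T ∨ p = 1 ∨ B = 0) := by
  by_cases hv : v ∈ T
  · simp only [sval0, hv, if_true, mem_union, mem_prod, mem_singleton_iff, mem_unitSquare, mem_Icc,
      not_true, false_or]
    constructor
    · rintro (⟨h, rfl⟩ | ⟨rfl, h⟩)
      · simpa using h
      · simpa using h
    · rintro ⟨h, rfl | rfl⟩
      · exact Or.inl ⟨h.1, rfl⟩
      · exact Or.inr ⟨rfl, h.2⟩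
  · simp [sval0, hv]

lemma sval0_eq (v : V) : sval0 T v = reflect ⁻¹' rval0 Tᶜ v := by
  ext ⟨B, p⟩
  have h1 : 1 - p = 0 ↔ p = 1 := by constructor <;> intro h <;> linarith
  have h2 : 1 - B = 1 ↔ B = 0 := by constructor <;> intro h <;> linarith
  have h3 := reflect_mem_unitSquare (x := (B, p))
  simp only [reflect] at h3
  simp only [mem_preimage, reflect, mem_sval0, mem_rval0, h1, h2, h3, mem_compl_iff]

/-- The complement of `T` need not consist of sinks, so only facts that do not depend on the sink
condition are transferred in this way. -/
lemma sval_eq (i : ℕ) (v : V) : sval M T i v = reflect ⁻¹' rval M Tᶜ i v := by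
  induction i generalizing v with
  | zero => exact sval0_eq v
  | succ i ih =>
    change bellman M v (sval M T i) = reflect ⁻¹' bellman M v (rval M Tᶜ i)
    rw [← bellman_reflect]
    congr 1
    funext w
    exact ih w

lemma isUp_rval0 (v : V) : IsUp (rval0 T v) where
  sub _ hx := (mem_rval0.1 hx).1
  mono {B p B' p'} hx h1 h2 h3 h4 := by
    rw [mem_rval0] at hx ⊢
    refine ⟨isUp_unitSquare.mono hx.1 h1 h2 h3 h4, ?_⟩
    rcases hx.2 with h | h | h
    · exact Or.inl h
    · exact Or.inr (Or.inl (by linarith))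
    · exact Or.inr (Or.inr (by linarith))
  bot hB := mem_rval0.2 ⟨isUp_unitSquare.bot hB, by simp⟩
  right hp := mem_rval0.2 ⟨isUp_unitSquare.right hp, by simp⟩

lemma isClosed_rval0 (v : V) : IsClosed (rval0 T v) := by
  unfold rval0
  split_ifs
  · exact isClosed_Icc.prod isClosed_Icc
  · exact (isClosed_Icc.prod isClosed_singleton).union (isClosed_singleton.prod isClosed_Icc)

lemma isUp_rval (i : ℕ) (v : V) : IsUp (rval M T i v) := by
  induction i generalizing v with
  | zero => exact isUp_rval0 v
  | succ i ih => exact isUp_bellman ih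

lemma isDn_sval (i : ℕ) (v : V) : IsDn (sval M T i v) := by
  refine IsUp.isDn ?_
  rw [sval_eq, reflect_reflect]
  exact isUp_rval i v

lemma isClosed_rval (i : ℕ) (v : V) : IsClosed (rval M T i v) := by
  induction i generalizing v with
  | zero => exact isClosed_rval0 v
  | succ i ih => exact isClosed_bellman ih fun w => (isUp_rval i w).sub

lemma isClosed_sval (i : ℕ) (v : V) : IsClosed (sval M T i v) := by
  rw [sval_eq]
  exact (isClosed_rval i v).preimage continuous_reflect

lemma cover_rval_sval (i : ℕ) (v : V) : unitSquare ⊆ rval M T i v ∪ sval M T i v := by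
  induction i generalizing v with
  | zero =>
    rintro ⟨B, p⟩ hx
    by_cases hv : v ∈ T
    · exact Or.inl (mem_rval0.2 ⟨hx, Or.inl hv⟩)
    · exact Or.inr (mem_sval0.2 ⟨hx, Or.inl hv⟩)
  | succ i ih =>
    exact bellman_cover (isUp_rval i) (isDn_sval i) (isClosed_rval i) (isClosed_sval i) ih

lemma thin_rval_sval (i : ℕ) (v : V) : Thin (rval M T i v) (sval M T i v) := by
  induction i generalizing v with
  | zero =>
    intro B p B' p' hx hy h1 h2
    have h3 := mem_rval0.1 hx
    have h4 := mem_sval0.1 hy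
    simp only [mem_unitSquare] at h3 h4
    rcases h3.2 with h | h | h
    · rcases h4.2 with h' | h' | h'
      · exact h' h
      · linarith
      · linarith
    · linarith
    · linarith
  | succ i ih => exact thin_bellman ih

/-- Elsewhere the initial value consists of the two edges contained in every upper region; only at
targets, where it is the whole square, does the sink condition enter. -/
lemma rval_succ_superset (hT : ∀ v ∈ T, M.IsSink v) (i : ℕ) (v : V) :
    rval M T i v ⊆ rval M T (i + 1) v := by
  induction i generalizing v with
  | zero =>
    by_cases hv : v ∈ T
    · exact subset_bellman_sink (hT v hv) (isUp_rval 0 v).sub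
    · rintro ⟨B, p⟩ hx
      have h1 := mem_rval0.1 hx
      rcases h1.2 with h | rfl | rfl
      · exact absurd h hv
      · exact (isUp_rval 1 v).bot h1.1.1
      · exact (isUp_rval 1 v).right h1.1.2
  | succ i ih => exact bellman_mono ih

lemma monotone_rval (hT : ∀ v ∈ T, M.IsSink v) (v : V) : Monotone fun i => rval M T i v :=
  monotone_nat_of_le_succ fun i => rval_succ_superset hT i v

lemma sval_succ_subset (hT : ∀ v ∈ T, M.IsSink v) (i : ℕ) (v : V) :
    sval M T (i + 1) v ⊆ sval M T i v := by
  induction i generalizing v with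
  | zero =>
    by_cases hv : v ∈ T
    · exact bellman_sink_subset (hT v hv) (isDn_sval 0 v)
    · rintro ⟨B, p⟩ hx
      exact mem_sval0.2 ⟨(isDn_sval 1 v).sub hx, Or.inl hv⟩
  | succ i ih => exact bellman_mono ih

lemma isDn_svalStar (v : V) : IsDn (svalStar M T v) where
  sub _ hx := (isDn_sval 0 v).sub (mem_iInter.1 hx 0)
  mono hx h1 h2 h3 h4 := mem_iInter.2 fun i => (isDn_sval i v).mono (mem_iInter.1 hx i) h1 h2 h3 h4
  top hB := mem_iInter.2 fun i => (isDn_sval i v).top hB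
  left hp := mem_iInter.2 fun i => (isDn_sval i v).left hp

lemma isUp_iUnion_rval (v : V) : IsUp (⋃ i, rval M T i v) where
  sub := iUnion_subset fun i => (isUp_rval i v).sub
  mono hx h1 h2 h3 h4 := by
    obtain ⟨i, hi⟩ := mem_iUnion.1 hx
    exact mem_iUnion.2 ⟨i, (isUp_rval i v).mono hi h1 h2 h3 h4⟩
  bot hB := mem_iUnion.2 ⟨0, (isUp_rval 0 v).bot hB⟩
  right hp := mem_iUnion.2 ⟨0, (isUp_rval 0 v).right hp⟩

lemma IsUp.closure {X : Set (ℝ × ℝ)} (h : IsUp X) : IsUp (closure X) where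
  sub := closure_minimal h.sub isCompact_unitSquare.isClosed
  mono {B p B' p'} hx h1 h2 h3 h4 := by
    -- This continuous map preserves `X`, hence its closure, and sends `(B, p)` to `(B', p')`.
    have h5 : MapsTo (fun y : ℝ × ℝ => (max y.1 B', min y.2 p')) X X := fun y hy =>
      have h6 := h.sub hy
      h.mono hy (le_max_left _ _) (max_le h6.1.2 h2) (min_le_left _ _) (le_min h6.2.1 h4)
    have := h5.closure (by fun_prop) hx
    simpa [h1, h3] using this
  bot hB := subset_closure (h.bot hB)
  right hp := subset_closure (h.right hp)

lemma isUp_rvalStar (v : V) : IsUp (rvalStar M T v) := (isUp_iUnion_rval v).closure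

lemma rval_subset_rvalStar (i : ℕ) (v : V) : rval M T i v ⊆ rvalStar M T v :=
  (subset_iUnion (fun i => rval M T i v) i).trans subset_closure

lemma mem_rvalStar_of_notMem_svalStar {v : V} {x : ℝ × ℝ} (hx : x ∈ unitSquare)
    (h : x ∉ svalStar M T v) : x ∈ rvalStar M T v := by
  simp only [svalStar, mem_iInter, not_forall] at h
  obtain ⟨i, hi⟩ := h
  exact rval_subset_rvalStar i v ((cover_rval_sval i v hx).resolve_right hi)

/-- The right-hand side is closed and contains every bounded-horizon value. The rate of convergence
needs only this half of the fixed point equation. -/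
lemma rvalStar_subset_bellman (hT : ∀ v ∈ T, M.IsSink v) (v : V) :
    rvalStar M T v ⊆ bellman M v (rvalStar M T) := by
  refine closure_minimal (iUnion_subset fun i => ?_)
    (isClosed_bellman (fun w => isClosed_closure) fun w => (isUp_rvalStar w).sub)
  exact (rval_succ_superset hT i v).trans (bellman_mono (rval_subset_rvalStar i))

lemma svalStar_subset_bellman (hT : ∀ v ∈ T, M.IsSink v) (v : V) :
    svalStar M T v ⊆ bellman M v (svalStar M T) := fun _ hx =>
  mem_bellman_iInter isClosed_sval (fun i w => (isDn_sval i w).sub) (sval_succ_subset hT)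
    fun i => mem_iInter.1 hx (i + 1)

end Values

/-! ### Rate of convergence of value iteration -/

section Rate

variable {V : Type*} [Fintype V] {M : MDP V} {T : Set V}

lemma MDP.δmin_le_half (M : MDP V) : M.δmin ≤ 1 / 2 :=
  Finset.min'_le _ _ (Finset.mem_insert_self _ _)

lemma MDP.δmin_le {v w : V} (hv : v ∉ M.ctrl) (hw : 0 < M.δ v w) : M.δmin ≤ M.δ v w := by
  classical
  refine Finset.min'_le _ _ (Finset.mem_insert_of_mem ?_)
  simp only [Finset.mem_image, Finset.mem_filter, Finset.mem_univ, true_and]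
  exact ⟨(v, w), ⟨hv, hw⟩, rfl⟩

lemma MDP.δmin_pos (M : MDP V) : 0 < M.δmin := by
  classical
  unfold MDP.δmin
  rw [Finset.lt_min'_iff]
  intro y hy
  simp only [Finset.mem_insert, Finset.mem_image, Finset.mem_filter, Finset.mem_univ,
    true_and] at hy
  rcases hy with rfl | ⟨e, he, rfl⟩
  · norm_num
  · exact he.2

/-- Moving the point `x` by `a` to the right and by `b` down, for any `a`, `b` above the hyperbola
`ab = D`, leads into the value of horizon `t`. -/
def HypGap (M : MDP V) (T : Set V) (t : ℕ) (v : V) (x : ℝ × ℝ) (D : ℝ) : Prop :=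
  ∀ a b : ℝ, 0 < a → 0 < b → D < a * b → (min (x.1 + a) 1, max (x.2 - b) 0) ∈ rval M T t v

lemma HypGap.mono_right {t : ℕ} {v : V} {x : ℝ × ℝ} {D D' : ℝ} (h : HypGap M T t v x D)
    (hD : D ≤ D') : HypGap M T t v x D' := fun a b ha hb hab => h a b ha hb (hD.trans_lt hab)

lemma HypGap.mono_horizon (hT : ∀ v ∈ T, M.IsSink v) {t t' : ℕ} {v : V} {x : ℝ × ℝ} {D : ℝ}
    (h : HypGap M T t v x D) (ht : t ≤ t') : HypGap M T t' v x D := fun a b ha hb hab =>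
  monotone_rval hT v ht (h a b ha hb hab)

lemma HypGap.mono_point {t : ℕ} {v : V} {x y : ℝ × ℝ} {D : ℝ} (h : HypGap M T t v x D)
    (h1 : x.1 ≤ y.1) (h2 : y.2 ≤ x.2) : HypGap M T t v y D := fun a b ha hb hab =>
  (isUp_rval t v).mono (h a b ha hb hab) (min_le_min_right _ (by linarith)) (min_le_right _ _)
    (max_le_max_right _ (by linarith)) (le_max_right _ _)

/-- If `ab > 1` then `a ≥ 1` or `b ≥ 1`, and the clipped point lands on the right or on the bottom
edge. -/
lemma hypGap_one {v : V} {x : ℝ × ℝ} (hx : x ∈ unitSquare) : HypGap M T 0 v x 1 := by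
  intro a b ha hb hab
  obtain ⟨⟨h1, h2⟩, h3, h4⟩ := hx
  refine mem_rval0.2 ⟨⟨⟨?_, min_le_right _ _⟩, le_max_right _ _, max_le (by linarith) zero_le_one⟩,
    Or.inr ?_⟩
  · exact le_min (by linarith) zero_le_one
  · by_cases h : 1 ≤ a
    · right; rw [min_eq_right]; linarith
    · left; rw [max_eq_right]; nlinarith

lemma hypGap_zero_of_mem {t : ℕ} {v : V} {x : ℝ × ℝ} (hx : x ∈ rval M T t v) :
    HypGap M T t v x 0 := by
  intro a b ha hb _
  obtain ⟨⟨h1, h2⟩, h3, h4⟩ := (isUp_rval t v).sub hx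
  exact (isUp_rval t v).mono hx (le_min (by linarith) h2) (min_le_right _ _)
    (max_le (by linarith) h3) (le_max_right _ _)

/-- For a fixed sacrifice `e` of probability the successors need slightly more than `D / e` and `D₀
/ e` of extra budget. The control rule averages these needs, so the products are averaged as well.
-/
lemma hypGap_ctrl {t : ℕ} {v w₀ : V} (hv : v ∈ M.ctrl) (hw₀ : w₀ ∈ M.succ v) {B b c p D D₀ : ℝ}
    (hB : B = (b + c) / 2) (hp : p ∈ Icc (0 : ℝ) 1)
    (hD : 0 ≤ D) (hD₀ : 0 ≤ D₀) (h₀ : HypGap M T t w₀ (c, p) D₀)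
    (h : ∀ w ∈ M.succ v, HypGap M T t w (b, p) D) :
    HypGap M T (t + 1) v (B, p) ((D + D₀) / 2) := by
  intro a e ha he hae
  -- The budget left after paying the mean requirement; adding it at both successors makes both
  -- strict inequalities hold.
  set s := a - (D + D₀) / 2 / e with hs
  have hs0 : 0 < s := by rw [hs, sub_pos, div_lt_iff₀ he]; exact hae
  have key : ∀ D, 0 ≤ D → 0 < D / e + s ∧ D < (D / e + s) * e := fun D hD => by
    have : 0 ≤ D / e := by positivity
    refine ⟨by linarith, ?_⟩
    rw [add_mul, div_mul_cancel₀ _ he.ne']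
    nlinarith
  have h1 := h₀ _ e (key D₀ hD₀).1 he (key D₀ hD₀).2
  have h2 := fun w hw => h w hw _ e (key D hD).1 he (key D hD).2
  dsimp only at h1 h2 ⊢
  have hp0 : max (p - e) 0 ∈ Icc (0 : ℝ) 1 := ⟨le_max_right _ _, max_le (by linarith [hp.2]) (by simp)⟩
  refine (isUp_rval (t + 1) v).mono (B := (min (b + (D / e + s)) 1 + min (c + (D₀ / e + s)) 1) / 2)
    (p := max (p - e) 0) ((mem_bellman_ctrl hv).2 ⟨hp0, _, _, rfl, ⟨w₀, hw₀, h1⟩, h2⟩) ?_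
    (min_le_right _ _) le_rfl hp0.1
  have e1 : a = (D / e + D₀ / e) / 2 + s := by rw [hs]; ring
  refine le_min ?_ ?_
  · have h3 := min_le_left (b + (D / e + s)) 1
    have h4 := min_le_left (c + (D₀ / e + s)) 1
    linarith
  · have h3 := min_le_right (b + (D / e + s)) 1
    have h4 := min_le_right (c + (D₀ / e + s)) 1
    linarith

/-- The dual computation: for a fixed extra budget `a` the needed sacrifices `D w / a` are averaged
with the transition probabilities. Measuring gaps by products is what makes both kinds of vertices
linear in `D`. -/
lemma hypGap_rand {t : ℕ} {v : V} (hv : v ∉ M.ctrl) {B p : ℝ} {q D : V → ℝ}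
    (hB : B ∈ Icc (0 : ℝ) 1) (hp : p = ∑ w, M.δ v w * q w) (hD : ∀ w, 0 ≤ D w)
    (h : ∀ w ∈ M.succ v, HypGap M T t w (B, q w) (D w)) :
    HypGap M T (t + 1) v (B, p) (∑ w, M.δ v w * D w) := by
  intro a e ha he hae
  set S := ∑ w, M.δ v w * D w
  set s := e - S / a with hs
  have hs0 : 0 < s := by rw [hs, sub_pos, div_lt_iff₀ ha]; linarith
  have h1 : ∀ w ∈ M.succ v, _ := fun w hw => h w hw a (D w / a + s) ha
    (by have := hD w; positivity) (by rw [mul_add, mul_div_cancel₀ _ ha.ne']; nlinarith)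
  dsimp only at h1 ⊢
  have h2 : min (B + a) 1 ∈ Icc (0 : ℝ) 1 := ⟨le_min (by linarith [hB.1]) (by simp), min_le_right _ _⟩
  refine (isUp_rval (t + 1) v).mono (B := min (B + a) 1)
    (p := ∑ w, M.δ v w * max (q w - (D w / a + s)) 0) ((mem_bellman_rand hv).2
    ⟨h2, _, h1, rfl⟩) le_rfl h2.2 (max_le ?_ ?_) (le_max_right _ _)
  · have h3 := weighted_le hv (f := fun w => q w - (D w / a + s))
      (g := fun w => max (q w - (D w / a + s)) 0) fun w _ => le_max_left _ _
    refine le_trans (le_of_eq ?_) h3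
    simp only [mul_sub, mul_add, Finset.sum_sub_distrib, Finset.sum_add_distrib, weighted_const hv,
      ← mul_div_assoc, ← Finset.sum_div, ← hp]
    rw [hs]; ring
  · exact Finset.sum_nonneg fun w _ => mul_nonneg (M.δ_nonneg v hv w) (le_max_right _ _)

/-- The vertices from which `T` can be reached in at most `k` steps. -/
def reachIn (M : MDP V) (T : Set V) : ℕ → Set V
  | 0 => T
  | k + 1 => {v | v ∈ reachIn M T k ∨ ∃ w ∈ M.succ v, w ∈ reachIn M T k}

/-- The vertices from which `T` cannot be reached. -/
def unreach (M : MDP V) (T : Set V) : Set V := {v | ∀ k, v ∉ reachIn M T k}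

/-- The least number of steps in which `T` can be reached. -/
noncomputable def stepsTo (M : MDP V) (T : Set V) (v : V) : ℕ := sInf {k | v ∈ reachIn M T k}

lemma exists_closer {v : V} (h1 : v ∉ T) (h2 : v ∉ unreach M T) :
    ∃ w ∈ M.succ v, stepsTo M T w < stepsTo M T v := by
  have hne : {k | v ∈ reachIn M T k}.Nonempty := by
    simpa [unreach, Set.Nonempty] using h2
  have hmem : v ∈ reachIn M T (stepsTo M T v) := Nat.sInf_mem hne
  cases hk : stepsTo M T v with
  | zero => rw [hk] at hmem; exact absurd hmem h1
  | succ k =>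
    rw [hk] at hmem
    rcases hmem with h | ⟨w, hw, h⟩
    · have : stepsTo M T v ≤ k := Nat.sInf_le h
      omega
    · exact ⟨w, hw, Nat.lt_succ_of_le (Nat.sInf_le h)⟩

lemma unreach_succ {v w : V} (hv : v ∈ unreach M T) (hw : w ∈ M.succ v) : w ∈ unreach M T :=
  fun k hk => hv (k + 1) (Or.inr ⟨w, hw, hk⟩)

/-- Such vertices have only such vertices as successors, and the operator preserves the two-edge
region. Their value is final at horizon zero, just as at targets. -/
lemma rval_subset_of_unreach (i : ℕ) {v : V} (hv : v ∈ unreach M T) :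
    rval M T i v ⊆ rval0 T v := by
  have hdis : ∀ {v B p}, v ∈ unreach M T → (B, p) ∈ rval0 T v → p = 0 ∨ B = 1 := fun hv hx =>
    (mem_rval0.1 hx).2.resolve_left (hv 0)
  induction i generalizing v with
  | zero => exact Subset.rfl
  | succ i ih =>
    rintro ⟨B, p⟩ hx
    refine mem_rval0.2 ⟨(isUp_rval _ v).sub hx, Or.inr ?_⟩
    by_cases hc : v ∈ M.ctrl
    · obtain ⟨-, b, c, h1, ⟨w, hw, h2⟩, h3⟩ := (mem_bellman_ctrl hc).1 hx
      have hu := unreach_succ hv hw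
      rcases hdis hu (ih hu (h3 w hw)) with h4 | h4
      · exact Or.inl h4
      · rcases hdis hu (ih hu h2) with h5 | h5
        · exact Or.inl h5
        · right; dsimp only at h1; rw [h1, h4, h5]; norm_num
    · obtain ⟨-, q, h2, h3⟩ := (mem_bellman_rand hc).1 hx
      dsimp only at h2 h3
      by_cases hB : B = 1
      · exact Or.inr hB
      · left
        rw [h3]
        have := weighted_le hc (f := q) (g := fun _ => 0) fun w hw =>
          ((hdis (unreach_succ hv hw) (ih (unreach_succ hv hw) (h2 w hw))).resolve_right hB).le
        have h4 := weighted_le hc (g := q) (f := fun _ => 0) fun w hw =>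
          ((isUp_rval _ w).sub (h2 w hw)).2.1
        rw [weighted_const hc] at this h4
        exact le_antisymm this h4

lemma rval_target (hT : ∀ v ∈ T, M.IsSink v) {v : V} (hv : v ∈ T) (t : ℕ) :
    unitSquare ⊆ rval M T t v := fun _ hx =>
  monotone_rval hT v (Nat.zero_le t) (mem_rval0.2 ⟨hx, Or.inl hv⟩)

/-- At both kinds of terminal vertices the limit value is already attained at horizon zero. -/
lemma hypGap_terminal (hT : ∀ v ∈ T, M.IsSink v) {v : V} (hv : v ∈ T ∨ v ∈ unreach M T)
    {x : ℝ × ℝ} (hx : x ∈ rvalStar M T v) (t : ℕ) : HypGap M T t v x 0 := by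
  apply hypGap_zero_of_mem
  rcases hv with hv | hv
  · exact rval_target hT hv t ((isUp_rvalStar v).sub hx)
  · refine monotone_rval hT v (Nat.zero_le t) ?_
    exact closure_minimal (iUnion_subset fun i => rval_subset_of_unreach i hv)
      (isClosed_rval0 v) hx

/-- The extreme points of a region: no other point has at most the same budget and at least the same
probability. -/
def IsCorner (X : Set (ℝ × ℝ)) (x : ℝ × ℝ) : Prop :=
  x ∈ X ∧ ∀ y ∈ X, y.1 ≤ x.1 → x.2 ≤ y.2 → y = x

/-- A maximizer of probability minus budget over the part of `X` up and to the left of `x` is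
extreme. -/
lemma exists_corner {X : Set (ℝ × ℝ)} (hX : IsCompact X) {x : ℝ × ℝ} (hx : x ∈ X) :
    ∃ y, IsCorner X y ∧ y.1 ≤ x.1 ∧ x.2 ≤ y.2 := by
  have hc : IsCompact (X ∩ {y | y.1 ≤ x.1 ∧ x.2 ≤ y.2}) := hX.inter_right
    (IsClosed.inter (isClosed_le continuous_fst continuous_const)
      (isClosed_le continuous_const continuous_snd))
  obtain ⟨y, hy, hmax⟩ := hc.exists_isMaxOn ⟨x, hx, le_rfl, le_rfl⟩
    (f := fun y : ℝ × ℝ => y.2 - y.1) (by fun_prop)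
  refine ⟨y, ⟨hy.1, fun z hz h1 h2 => ?_⟩, hy.2.1, hy.2.2⟩
  have h3 := hmax ⟨hz, h1.trans hy.2.1, hy.2.2.trans h2⟩
  dsimp only [mem_ofPred_eq] at h3
  exact Prod.ext (by linarith) (by linarith)

lemma isCompact_rvalStar (v : V) : IsCompact (rvalStar M T v) :=
  isCompact_unitSquare.of_isClosed_subset isClosed_closure (isUp_rvalStar v).sub

/-- From a corner at a vertex that is not terminal there is a successor with a corner further up and
to the left, or with the same corner but closer to `T`, whose gap enters into the gap of the
vertex. -/
lemma exists_next (hT : ∀ v ∈ T, M.IsSink v) {v : V} {x : ℝ × ℝ}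
    (hx : IsCorner (rvalStar M T v) x) (hv : ¬(v ∈ T ∨ v ∈ unreach M T)) :
    ∃ w y, IsCorner (rvalStar M T w) y ∧ y.1 ≤ x.1 ∧ x.2 ≤ y.2 ∧
      (y = x → stepsTo M T w < stepsTo M T v) ∧
      ∀ t D D', 0 ≤ D' → D' ≤ D → (∀ u, ∀ z ∈ rvalStar M T u, HypGap M T t u z D) →
        HypGap M T t w y D' → HypGap M T (t + 1) v x ((1 - M.δmin) * D + M.δmin * D') := by
  push Not at hv
  obtain ⟨u, hu, hlt⟩ := exists_closer hv.1 hv.2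
  obtain ⟨B, p⟩ := x
  have hb := rvalStar_subset_bellman hT v hx.1
  by_cases hc : v ∈ M.ctrl
  · obtain ⟨hp, b, c, hB, ⟨w, hw, h1⟩, h2⟩ := (mem_bellman_ctrl hc).1 hb
    dsimp only at hp hB h1 h2
    have fin : ∀ w ∈ M.succ v, ∀ b c, B = (b + c) / 2 → (∀ w ∈ M.succ v, (b, p) ∈ rvalStar M T w) →
        ∀ y : ℝ × ℝ, y.1 ≤ c → p ≤ y.2 → ∀ t D D', 0 ≤ D' → D' ≤ D →
        (∀ u, ∀ z ∈ rvalStar M T u, HypGap M T t u z D) →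
        HypGap M T t w y D' →
        HypGap M T (t + 1) v (B, p) ((1 - M.δmin) * D + M.δmin * D') := by
      intro w hw b c hB h2 y hy1 hy2 t D D' h0 hDD hall hy
      refine (hypGap_ctrl hc hw hB hp (h0.trans hDD) h0 (hy.mono_point hy1 hy2)
        fun w hw => hall w _ (h2 w hw)).mono_right ?_
      -- The distinguished successor has weight one half, which is at least `δmin`, and `D' ≤ D`.
      nlinarith [M.δmin_le_half]
    -- If `c < B`, the new corner is strictly further left. Otherwise the midpoint equation gives `b
    -- ≤ B`, so `(B, p)` itself lies in the limit value of every successor, and one closer to `T`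
    -- can be taken.
    by_cases hcB : c < B
    · obtain ⟨y, hy, hy1, hy2⟩ := exists_corner (isCompact_rvalStar w) h1
      refine ⟨w, y, hy, hy1.trans hcB.le, hy2, fun h => ?_, fin w hw b c hB h2 y hy1 hy2⟩
      rw [h] at hy1
      exact absurd hy1 (not_le.2 hcB)
    · have hB1 := ((isUp_rvalStar v).sub hx.1).1.2
      have h3 : ∀ w ∈ M.succ v, (B, p) ∈ rvalStar M T w := fun w hw =>
        (isUp_rvalStar w).mono (h2 w hw) (by linarith) hB1 le_rfl hp.1
      obtain ⟨y, hy, hy1, hy2⟩ := exists_corner (isCompact_rvalStar u) (h3 u hu)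
      exact ⟨u, y, hy, hy1, hy2, fun _ => hlt, fin u hu B B (by ring) h3 y hy1 hy2⟩
  · obtain ⟨hB, q, h1, h2⟩ := (mem_bellman_rand hc).1 hb
    dsimp only at hB h1 h2
    have fin : ∀ w ∈ M.succ v, ∀ y : ℝ × ℝ, y.1 ≤ B → q w ≤ y.2 → ∀ t D D', 0 ≤ D' → D' ≤ D →
        (∀ u, ∀ z ∈ rvalStar M T u, HypGap M T t u z D) →
        HypGap M T t w y D' →
        HypGap M T (t + 1) v (B, p) ((1 - M.δmin) * D + M.δmin * D') := by
      classical
      intro w hw y hy1 hy2 t D D' h0 hDD hall hy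
      refine (hypGap_rand hc hB h2 (D := fun u => if u = w then D' else D) (fun u => ?_)
        fun u hu => ?_).mono_right ?_
      · split_ifs <;> linarith
      · split_ifs with h
        · subst h; exact hy.mono_point hy1 hy2
        · exact hall u _ (h1 u hu)
      · have e1 : ∀ u, M.δ v u * (if u = w then D' else D) =
            M.δ v u * D + if u = w then M.δ v w * (D' - D) else 0 := fun u => by
          split_ifs with h
          · rw [h]; ring
          · ring
        simp only [e1, Finset.sum_add_distrib, weighted_const hc, Finset.sum_ite_eq',
          Finset.mem_univ, if_true]
        nlinarith [M.δmin_le hc ((M.mem_succ_rand hc).1 hw)]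
    -- If some successor probability exceeds the mean, the new corner is strictly higher. Otherwise
    -- none exceeds it, so all equal `p`, in particular at the successor closer to `T`.
    by_cases hq : ∃ w ∈ M.succ v, p < q w
    · obtain ⟨w, hw, hpw⟩ := hq
      obtain ⟨y, hy, hy1, hy2⟩ := exists_corner (isCompact_rvalStar w) (h1 w hw)
      refine ⟨w, y, hy, hy1, hpw.le.trans hy2, fun h => ?_, fin w hw y hy1 hy2⟩
      rw [h] at hy2
      exact absurd hy2 (not_le.2 hpw)
    · push Not at hq
      have hqu : q u = p := by
        refine le_antisymm (hq u hu) (not_lt.1 fun hlt => ?_)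
        have : ∑ w, M.δ v w * q w < ∑ w, M.δ v w * p := by
          refine Finset.sum_lt_sum (fun w _ => ?_) ⟨u, Finset.mem_univ u,
            mul_lt_mul_of_pos_left hlt ((M.mem_succ_rand hc).1 hu)⟩
          by_cases hw : w ∈ M.succ v
          · exact mul_le_mul_of_nonneg_left (hq w hw) (M.δ_nonneg v hc w)
          · simp [M.eq_zero_of_notMem hc hw]
        rw [weighted_const hc] at this
        linarith
      obtain ⟨y, hy, hy1, hy2⟩ := exists_corner (isCompact_rvalStar u) (h1 u hu)
      exact ⟨u, y, hy, hy1, hqu.symm.le.trans hy2, fun _ => hlt, fin u hu y hy1 hy2⟩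

/-- A chain of corners given by `exists_next` meets a terminal vertex within `|V|` steps. Going back
along the chain, the zero gap at its end enters with weight at least `δmin ^ |V|`, all else with gap
at most `D`. -/
lemma hypGap_corner (hT : ∀ v ∈ T, M.IsSink v) {t : ℕ} {D : ℝ} (hD : 0 ≤ D)
    (hall : ∀ u, ∀ z ∈ rvalStar M T u, HypGap M T t u z D) {v : V} {x : ℝ × ℝ}
    (hx : IsCorner (rvalStar M T v) x) :
    HypGap M T (t + Fintype.card V) v x ((1 - M.δmin ^ Fintype.card V) * D) := by
  classical
  set S := {s : V × ℝ × ℝ // IsCorner (rvalStar M T s.1) s.2}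
  let P : S → S → Prop := fun s s' => s'.1.2.1 ≤ s.1.2.1 ∧ s.1.2.2 ≤ s'.1.2.2 ∧
      (s'.1.2 = s.1.2 → stepsTo M T s'.1.1 < stepsTo M T s.1.1) ∧
      ∀ t D D', 0 ≤ D' → D' ≤ D → (∀ u, ∀ z ∈ rvalStar M T u, HypGap M T t u z D) →
        HypGap M T t s'.1.1 s'.1.2 D' →
        HypGap M T (t + 1) s.1.1 s.1.2 ((1 - M.δmin) * D + M.δmin * D')
  have hnext : ∀ s : S, ∃ s' : S, ¬(s.1.1 ∈ T ∨ s.1.1 ∈ unreach M T) → P s s' := fun s => by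
    by_cases h : s.1.1 ∈ T ∨ s.1.1 ∈ unreach M T
    · exact ⟨s, fun h' => absurd h h'⟩
    · obtain ⟨w, y, hy, h1⟩ := exists_next hT s.2 h
      exact ⟨⟨(w, y), hy⟩, fun _ => h1⟩
  choose next hP using hnext
  let s : ℕ → S := fun k => next^[k] ⟨(v, x), hx⟩
  have hs : ∀ k, s (k + 1) = next (s k) := fun k => Function.iterate_succ_apply' _ _ _
  have hterm : ∃ k ≤ Fintype.card V, (s k).1.1 ∈ T ∨ (s k).1.1 ∈ unreach M T := by
    by_contra hcon
    push Not at hcon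
    have hstep : ∀ k ≤ Fintype.card V, P (s k) (s (k + 1)) := fun k hk => by
      rw [hs]; exact hP _ (not_or.2 (hcon k hk))
    have hmono : ∀ i j, i ≤ j → j ≤ Fintype.card V → (s j).1.2.1 ≤ (s i).1.2.1 ∧
        (s i).1.2.2 ≤ (s j).1.2.2 := by
      intro i j hij
      induction j, hij using Nat.le_induction with
      | base => exact fun _ => ⟨le_rfl, le_rfl⟩
      | succ j hij ih =>
        intro hj
        have h1 := ih (by omega)
        have h2 := hstep j (by omega)
        exact ⟨h2.1.trans h1.1, h1.2.trans h2.2.1⟩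
    obtain ⟨i, j, hij, heq⟩ : ∃ i j : Fin (Fintype.card V + 1), i < j ∧ (s i).1.1 = (s j).1.1 := by
      obtain ⟨i, j, hne, h⟩ := Fintype.exists_ne_map_eq_of_card_lt
        (fun i : Fin (Fintype.card V + 1) => (s i).1.1) (by simp)
      rcases lt_or_gt_of_ne hne with h' | h'
      · exact ⟨i, j, h', h⟩
      · exact ⟨j, i, h', h.symm⟩
    have hij' : (i : ℕ) < j := hij
    have hj := Nat.lt_succ_iff.1 j.2
    have hm := hmono i j hij'.le hj
    -- At a repeated vertex the later corner lies weakly up and to the left of the earlier one in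
    -- the same region, so extremality makes them equal.
    have hxx : (s j).1.2 = (s i).1.2 := by
      refine (s i).2.2 _ ?_ hm.1 hm.2
      rw [heq]
      exact (s j).2.1
    -- By monotonicity all corners in between coincide too, so `stepsTo` decreases strictly at each
    -- step. This is impossible around a cycle.
    have hsteps : ∀ k, (i : ℕ) < k → k ≤ j →
        stepsTo M T (s k).1.1 < stepsTo M T (s i).1.1 := by
      have hsame : ∀ k, (i : ℕ) ≤ k → k ≤ j → (s k).1.2 = (s i).1.2 := fun k h1 h2 => by
        have h3 := hmono i k h1 (h2.trans hj)
        have h4 := hmono k j h2 hj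
        rw [hxx] at h4
        exact Prod.ext (le_antisymm h3.1 h4.1) (le_antisymm h4.2 h3.2)
      intro k hik
      induction k, hik using Nat.le_induction with
      | base =>
        intro h
        exact (hstep i (by omega)).2.2.1 (hsame _ (by omega) h)
      | succ k hik ih =>
        intro h
        refine lt_trans ((hstep k (by omega)).2.2.1 ?_) (ih (by omega))
        rw [hsame _ (by omega) h, hsame k (by omega) (by omega)]
    have := hsteps j hij' le_rfl
    rw [heq] at this
    exact lt_irrefl _ this
  have hfind := Nat.find_spec hterm
  set k := Nat.find hterm
  have hlt : ∀ i < k, P (s i) (s (i + 1)) := fun i hi => by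
    rw [hs]
    exact hP _ fun h => Nat.find_min hterm hi ⟨by omega, h⟩
  have hδ0 := M.δmin_pos
  have hδ1 : M.δmin ≤ 1 := M.δmin_le_half.trans (by norm_num)
  -- Backward induction from the terminal vertex: each step back costs one iteration and one factor
  -- `δmin`.
  have hind : ∀ j ≤ k, HypGap M T (t + j) (s (k - j)).1.1 (s (k - j)).1.2
      ((1 - M.δmin ^ j) * D) := by
    intro j
    induction j with
    | zero =>
      intro _
      simpa using hypGap_terminal hT hfind.2 (s k).2.1 t
    | succ j ih =>
      intro hj
      have h1 := (hlt (k - (j + 1)) (by omega)).2.2.2 (t + j) D ((1 - M.δmin ^ j) * D)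
        (mul_nonneg (sub_nonneg.2 (pow_le_one₀ hδ0.le hδ1)) hD)
        (mul_le_of_le_one_left hD (by linarith [pow_pos hδ0 j]))
        (fun u z hz => (hall u z hz).mono_horizon hT (by omega))
        (by have := ih (by omega); rwa [show k - j = k - (j + 1) + 1 by omega] at this)
      have e : (1 - M.δmin ^ (j + 1)) * D =
          (1 - M.δmin) * D + M.δmin * ((1 - M.δmin ^ j) * D) := by
        rw [pow_succ]; ring
      rw [e]
      exact h1
  have h1 := hind k le_rfl
  rw [Nat.sub_self] at h1
  refine (HypGap.mono_horizon hT h1 (by omega)).mono_right ?_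
  refine mul_le_mul_of_nonneg_right ?_ hD
  linarith [pow_le_pow_of_le_one hδ0.le hδ1 hfind.1]

theorem hypGap_iterate (hT : ∀ v ∈ T, M.IsSink v) (m : ℕ) (v : V) {x : ℝ × ℝ}
    (hx : x ∈ rvalStar M T v) :
    HypGap M T (m * Fintype.card V) v x ((1 - M.δmin ^ Fintype.card V) ^ m) := by
  have hδ : 0 ≤ 1 - M.δmin ^ Fintype.card V := sub_nonneg.2
    (pow_le_one₀ M.δmin_pos.le (M.δmin_le_half.trans (by norm_num)))
  induction m generalizing v x with
  | zero => simpa using hypGap_one ((isUp_rvalStar v).sub hx)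
  | succ m ih =>
    obtain ⟨y, hy, hy1, hy2⟩ := exists_corner (isCompact_rvalStar v) hx
    have := hypGap_corner hT (pow_nonneg hδ m) (fun u z hz => ih u hz) hy
    rw [Nat.succ_mul, pow_succ']
    exact this.mono_point hy1 hy2

/-- With `z = δ ^ (-N)`, one of the two factors `z` in `δ ^ (-2N)` pays for the division by `N ≤ 2 ^
N ≤ z`, and the other offsets the contraction rate `δ ^ N`. At least `8hz - 1` blocks of `N`
iterations remain, and `1 - x ≤ exp (-x)` applies. -/
lemma contraction_bound {δ : ℝ} (h0 : 0 < δ) (h1 : δ ≤ 1 / 2) {N h n : ℕ} (hN : 0 < N) (hh : 1 ≤ h)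
    (hn : (h : ℝ) * (2 + 8 * (1 / δ) ^ (2 * N)) ≤ n) :
    (1 - δ ^ N) ^ (n / N) < ((2⁻¹ : ℝ) ^ h / 4) * ((2⁻¹ : ℝ) ^ h / 4) := by
  have hδN : 0 < δ ^ N := pow_pos h0 N
  have hh' : (1 : ℝ) ≤ h := by exact_mod_cast hh
  set z := (1 / δ) ^ N with hz
  have hzδ : z * δ ^ N = 1 := by rw [hz, ← mul_pow, one_div_mul_cancel h0.ne', one_pow]
  have h2δ : 2 ≤ 1 / δ := by rw [le_div_iff₀ h0]; linarith
  have hzN : (N : ℝ) ≤ z := by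
    have h2 : (N : ℝ) ≤ 2 ^ N := by exact_mod_cast Nat.lt_two_pow_self.le
    exact h2.trans (pow_le_pow_left₀ (by norm_num) h2δ N)
  have hN' : (1 : ℝ) ≤ N := by exact_mod_cast hN
  have hz0 : 0 < z := by linarith
  have hm : (n : ℝ) / N - 1 ≤ (n / N : ℕ) := by
    have h3 : (n : ℝ) < N * ((n / N : ℕ) + 1) := by
      exact_mod_cast Nat.lt_mul_div_succ n hN
    rw [sub_le_iff_le_add, div_le_iff₀ (by linarith)]
    linarith
  have hm2 : 8 * (h : ℝ) * z - 1 ≤ (n / N : ℕ) := by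
    refine le_trans ?_ hm
    have h4 : 8 * (h : ℝ) * z ≤ n / N := by
      rw [le_div_iff₀ (by linarith)]
      have h5 : (1 / δ) ^ (2 * N) = z * z := by rw [hz, two_mul, pow_add]
      rw [h5] at hn
      nlinarith [mul_le_mul_of_nonneg_left hzN (by positivity : 0 ≤ 8 * (h : ℝ) * z)]
    linarith
  have hm3 : 8 * (h : ℝ) - 1 ≤ (n / N : ℕ) * δ ^ N := by
    have h6 := mul_le_mul_of_nonneg_right hm2 hδN.le
    have h7 : δ ^ N ≤ 1 := pow_le_one₀ h0.le (by linarith)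
    nlinarith
  have hexp : (1 - δ ^ N) ^ (n / N) ≤ Real.exp (-(8 * (h : ℝ) - 1)) := by
    have h8 : 1 - δ ^ N ≤ Real.exp (-δ ^ N) := by
      have := Real.add_one_le_exp (-δ ^ N); linarith
    have h9 : 0 ≤ 1 - δ ^ N := by
      have h7 : δ ^ N ≤ 1 := pow_le_one₀ h0.le (by linarith)
      linarith
    refine (pow_le_pow_left₀ h9 h8 _).trans ?_
    rw [← Real.exp_nat_mul]
    exact Real.exp_le_exp.2 (by linarith)
  -- For `h ≥ 1`, `exp (-(8h - 1)) < exp (-6h) ≤ 2 ^ (-6h) ≤ 2 ^ (-(2h + 4))`, and the last term is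
  -- the square of `2 ^ (-h) / 4`.
  refine hexp.trans_lt ?_
  have h10 : ((2⁻¹ : ℝ) ^ h / 4) * ((2⁻¹ : ℝ) ^ h / 4) = (2⁻¹ : ℝ) ^ (2 * h + 4) := by ring
  have h11 : (2⁻¹ : ℝ) ^ (6 * h) ≤ (2⁻¹ : ℝ) ^ (2 * h + 4) :=
    pow_le_pow_of_le_one (by norm_num) (by norm_num) (by omega)
  have h12 : Real.exp (-(8 * (h : ℝ) - 1)) < Real.exp (-1) ^ (6 * h) := by
    rw [← Real.exp_nat_mul]
    apply Real.exp_lt_exp.2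
    push_cast
    linarith
  rw [h10]
  refine h12.trans_le (le_trans (pow_le_pow_left₀ (Real.exp_pos _).le ?_ _) h11)
  rw [Real.exp_neg]
  exact inv_anti₀ (by norm_num) (by have := Real.exp_one_gt_d9; linarith)

/-- After the prescribed number of iterations, the limit value is within `2⁻ʰ / 4` of the
bounded-horizon value. -/
theorem gap_of_iters (hT : ∀ v ∈ T, M.IsSink v) {h n : ℕ} (hh : 1 ≤ h)
    (hn : (h : ℝ) * (2 + 8 * (1 / M.δmin) ^ (2 * Fintype.card V)) ≤ n) {v : V} {x : ℝ × ℝ}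
    (hx : x ∈ rvalStar M T v) :
    (min (x.1 + (2⁻¹ : ℝ) ^ h / 4) 1, max (x.2 - (2⁻¹ : ℝ) ^ h / 4) 0) ∈ rval M T n v := by
  have hN : 0 < Fintype.card V := Fintype.card_pos_iff.2 ⟨v⟩
  have h1 := (hypGap_iterate hT (n / Fintype.card V) v hx).mono_horizon hT
    (Nat.div_mul_le_self n _)
  -- The hyperbolic gap is evaluated at `a = b = 2⁻ʰ / 4`.
  exact h1 _ _ (by positivity) (by positivity)
    (contraction_bound M.δmin_pos M.δmin_le_half hN hh hn)

end Rate

/-! ### Winning policies -/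

section Histories

variable {V : Type*}

/-- A history extended by one vertex. -/
def Hist.snoc {n : ℕ} (ρ : Hist V n) (w : V) : Hist V (n + 1) :=
  fun i => if h : i.1 ≤ n then ρ ⟨i.1, Finset.mem_Iic.2 h⟩ else w

@[simp] lemma Hist.last_snoc {n : ℕ} (ρ : Hist V n) (w : V) : (ρ.snoc w).last = w := by
  simp [Hist.snoc, Hist.last]

@[simp] lemma Hist.init_snoc {n : ℕ} (ρ : Hist V n) (w : V) : (ρ.snoc w).init = ρ := by
  funext i
  have := Finset.mem_Iic.1 i.2
  simp [Hist.snoc, Hist.init, this]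

/-- The history visits `T`. -/
def Hist.Visits {n : ℕ} (ρ : Hist V n) (T : Set V) : Prop := ∃ i, ρ i ∈ T

lemma Hist.visits_snoc {n : ℕ} (ρ : Hist V n) (w : V) (T : Set V) :
    (ρ.snoc w).Visits T ↔ ρ.Visits T ∨ w ∈ T := by
  constructor
  · rintro ⟨i, hi⟩
    by_cases h : i.1 ≤ n
    · left; exact ⟨⟨i.1, Finset.mem_Iic.2 h⟩, by simpa [Hist.snoc, h] using hi⟩
    · right; simpa [Hist.snoc, h] using hi
  · rintro (⟨i, hi⟩ | h)
    · have h := Finset.mem_Iic.1 i.2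
      exact ⟨⟨i.1, Finset.mem_Iic.2 (h.trans n.le_succ)⟩, by simpa [Hist.snoc, h] using hi⟩
    · exact ⟨⟨n + 1, Finset.mem_Iic.2 le_rfl⟩, by simpa [Hist.snoc] using h⟩

end Histories

/-! ### The law of the play and martingale inequalities. -/

section Law

variable {V : Type*} [Fintype V] {M : MDP V} (σ τ : Policy M) (B : ℝ)
variable [MeasurableSpace V] [DiscreteMeasurableSpace V]

/-- The distribution of the history of length `n`. -/
noncomputable def histLaw (v : V) (n : ℕ) : Measure (Hist V n) :=
  Kernel.partialTraj (X := fun _ => V) (fun n => stepKernel σ τ B n) 0 n (fun _ => v)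

lemma histLaw_zero (v : V) (f : Hist V 0 → ℝ≥0∞) :
    ∫⁻ ρ, f ρ ∂histLaw σ τ B v 0 = f fun _ => v := by
  unfold histLaw
  rw [Kernel.partialTraj_self, Kernel.lintegral_id]

/-- One-step disintegration of the trajectory measure. It reduces statements about expectations to
inequalities for single moves. -/
lemma lintegral_histLaw_succ (v : V) (n : ℕ) (f : Hist V (n + 1) → ℝ≥0∞) :
    ∫⁻ ρ, f ρ ∂histLaw σ τ B v (n + 1) =
      ∫⁻ ρ, ∫⁻ w, f (ρ.snoc w) ∂nextDist σ τ B n ρ ∂histLaw σ τ B v n := by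
  unfold histLaw
  rw [Kernel.partialTraj_succ_eq_comp (Nat.zero_le n), Kernel.lintegral_comp _ _ _
    Measurable.of_discrete]
  refine lintegral_congr fun ρ => ?_
  rw [Kernel.partialTraj_succ_self, Kernel.lintegral_map _ (by fun_prop) _ Measurable.of_discrete,
    Kernel.lintegral_prod _ _ _ Measurable.of_discrete, Kernel.id_apply, lintegral_dirac,
    Kernel.lintegral_map _ (by fun_prop) _ Measurable.of_discrete]
  refine lintegral_congr fun w => congrArg f (funext fun i => ?_)
  simp only [IicProdIoc_def, Hist.snoc]
  split_ifs with h
  · rfl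
  · have h1 := Finset.mem_Iic.1 i.2
    obtain ⟨i, hi⟩ := i
    obtain rfl : i = n + 1 := by dsimp only at h h1; omega
    rfl

lemma lintegral_nextDist_ctrl {n : ℕ} {ρ : Hist V n} (h : ρ.last ∈ M.ctrl) (f : V → ℝ≥0∞) :
    ∫⁻ w, f w ∂nextDist σ τ B n ρ = f (scheduler σ τ B n ρ) := by
  rw [nextDist, if_pos h, lintegral_dirac]

lemma lintegral_nextDist_rand {n : ℕ} {ρ : Hist V n} (h : ρ.last ∉ M.ctrl) {f : V → ℝ}
    (hf : ∀ w, 0 ≤ f w) : ∫⁻ w, ENNReal.ofReal (f w) ∂nextDist σ τ B n ρ =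
      ENNReal.ofReal (∑ w, M.δ ρ.last w * f w) := by
  rw [nextDist, if_neg h, lintegral_finsetSum_measure,
    ENNReal.ofReal_sum_of_nonneg fun w _ => mul_nonneg (M.δ_nonneg _ h w) (hf w)]
  refine Finset.sum_congr rfl fun w _ => ?_
  rw [lintegral_smul_measure, lintegral_dirac, smul_eq_mul, ENNReal.ofReal_mul (M.δ_nonneg _ h w)]

/-- Expectations of a supermartingale. -/
lemma lintegral_histLaw_le {G : (n : ℕ) → Hist V n → ℝ} (h0 : ∀ n ρ, 0 ≤ G n ρ)
    (hc : ∀ n ρ, ρ.last ∈ M.ctrl → G (n + 1) (ρ.snoc (scheduler σ τ B n ρ)) ≤ G n ρ)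
    (hr : ∀ n ρ, ρ.last ∉ M.ctrl → ∑ w, M.δ ρ.last w * G (n + 1) (ρ.snoc w) ≤ G n ρ)
    (v : V) (n : ℕ) :
    ∫⁻ ρ, ENNReal.ofReal (G n ρ) ∂histLaw σ τ B v n ≤ ENNReal.ofReal (G 0 fun _ => v) := by
  induction n with
  | zero => rw [histLaw_zero]
  | succ n ih =>
    rw [lintegral_histLaw_succ]
    refine (lintegral_mono fun ρ => ?_).trans ih
    by_cases h : ρ.last ∈ M.ctrl
    · rw [lintegral_nextDist_ctrl σ τ B h]
      exact ENNReal.ofReal_le_ofReal (hc n ρ h)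
    · rw [lintegral_nextDist_rand σ τ B h fun w => h0 _ _]
      exact ENNReal.ofReal_le_ofReal (hr n ρ h)

/-- Expectations of a submartingale. -/
lemma le_lintegral_histLaw {G : (n : ℕ) → Hist V n → ℝ} {N : ℕ} (h0 : ∀ n ρ, 0 ≤ G n ρ)
    (hc : ∀ n ρ, n < N → ρ.last ∈ M.ctrl → G n ρ ≤ G (n + 1) (ρ.snoc (scheduler σ τ B n ρ)))
    (hr : ∀ n ρ, n < N → ρ.last ∉ M.ctrl → G n ρ ≤ ∑ w, M.δ ρ.last w * G (n + 1) (ρ.snoc w))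
    (v : V) {n : ℕ} (hn : n ≤ N) :
    ENNReal.ofReal (G 0 fun _ => v) ≤ ∫⁻ ρ, ENNReal.ofReal (G n ρ) ∂histLaw σ τ B v n := by
  induction n with
  | zero => rw [histLaw_zero]
  | succ n ih =>
    rw [lintegral_histLaw_succ]
    refine (ih (by omega)).trans (lintegral_mono fun ρ => ?_)
    by_cases h : ρ.last ∈ M.ctrl
    · rw [lintegral_nextDist_ctrl σ τ B h]
      exact ENNReal.ofReal_le_ofReal (hc n ρ hn h)
    · rw [lintegral_nextDist_rand σ τ B h fun w => h0 _ _]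
      exact ENNReal.ofReal_le_ofReal (hr n ρ hn h)

instance (v : V) : IsProbabilityMeasure (pathMeasure σ τ B v) := by
  unfold pathMeasure; infer_instance

lemma histLaw_apply (v : V) (n : ℕ) (A : Set (Hist V n)) :
    histLaw σ τ B v n A = pathMeasure σ τ B v {x | (fun i : Finset.Iic n => x i) ∈ A} := by
  unfold histLaw pathMeasure
  rw [← Kernel.traj_map_frestrictLe_apply, Measure.map_apply (by fun_prop)
    (DiscreteMeasurableSpace.forall_measurableSet A)]
  rfl

omit [Fintype V] [MeasurableSpace V] [DiscreteMeasurableSpace V] in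
lemma visits_eq (T : Set V) (n : ℕ) :
    {x : ℕ → V | (fun i : Finset.Iic n => x i) ∈ {ρ : Hist V n | ρ.Visits T}} =
      {x | ∃ i ≤ n, x i ∈ T} := by
  ext x
  simp [Hist.Visits]

/-- A bound on the probability of reaching `T` within every finite horizon is a bound on the
probability of reaching `T`. -/
lemma reachProb_le {T : Set V} {v : V} {p : ℝ} (hp : 0 ≤ p)
    (h : ∀ n, histLaw σ τ B v n {ρ | ρ.Visits T} ≤ ENNReal.ofReal p) :
    reachProb σ τ B T v ≤ p := by
  have hU : {x : ℕ → V | ∃ i, x i ∈ T} = ⋃ n, {x | ∃ i ≤ n, x i ∈ T} := by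
    ext x
    simp only [mem_ofPred_eq, mem_iUnion]
    exact ⟨fun ⟨i, hi⟩ => ⟨i, i, le_rfl, hi⟩, fun ⟨_, i, _, hi⟩ => ⟨i, hi⟩⟩
  have hmono : Monotone fun n => {x : ℕ → V | ∃ i ≤ n, x i ∈ T} := fun m n hmn x ⟨i, hi, hx⟩ =>
    ⟨i, hi.trans hmn, hx⟩
  refine ENNReal.toReal_le_of_le_ofReal hp ?_
  rw [hU, hmono.measure_iUnion]
  exact iSup_le fun n => by simpa only [histLaw_apply, visits_eq] using h n

lemma le_reachProb {T : Set V} {v : V} {p : ℝ} (n : ℕ)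
    (h : ENNReal.ofReal p ≤ histLaw σ τ B v n {ρ | ρ.Visits T}) : p ≤ reachProb σ τ B T v := by
  rw [histLaw_apply, visits_eq] at h
  refine (ENNReal.ofReal_le_iff_le_toReal (measure_ne_top _ _)).1 (h.trans (measure_mono ?_))
  rintro x ⟨i, -, hi⟩
  exact ⟨i, hi⟩

end Law

/-! ### Policies read off from the values. -/

section Strategies

variable {V : Type*} [Fintype V] {M : MDP V} {T : Set V}

/-- The bid is half the difference of the two budgets with mean `c`: winning leads down to the
smaller one, and losing raises the budget at least to the larger one, which is good for every
successor. If their order is reversed, a bid of zero suffices. -/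
lemma exists_bid_up {X : V → Set (ℝ × ℝ)} (hX : ∀ w, IsUp (X w)) {v : V} (hv : v ∈ M.ctrl)
    {c q : ℝ} (h : (c, q) ∈ bellman M v X) :
    ∃ x, 0 ≤ x ∧ ∃ w ∈ M.succ v, (c - x, q) ∈ X w ∧
      ∀ w ∈ M.succ v, ∀ b, c + x ≤ b → b ≤ 1 → (b, q) ∈ X w := by
  obtain ⟨hq, b, b', h1, ⟨w, hw, h2⟩, h3⟩ := (mem_bellman_ctrl hv).1 h
  dsimp only at h1 h2 h3 hq
  rcases le_total b' b with hb | hb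
  · exact ⟨(b - b') / 2, by linarith, w, hw, by rwa [show c - (b - b') / 2 = b' by linarith],
      fun w hw d hd hd1 => (hX w).mono (h3 w hw) (by linarith) hd1 le_rfl hq.1⟩
  · refine ⟨0, le_rfl, w, hw, ?_, fun w hw d hd hd1 => (hX w).mono (h3 w hw) (by linarith) hd1
      le_rfl hq.1⟩
    have := ((hX w).sub h2).1.2
    exact (hX w).mono (h3 w hw) (by linarith) (by dsimp only at this; linarith) le_rfl hq.1

lemma exists_bid_dn {X : V → Set (ℝ × ℝ)} (hX : ∀ w, IsDn (X w)) {v : V} (hv : v ∈ M.ctrl)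
    {c q : ℝ} (h : (c, q) ∈ bellman M v X) :
    ∃ x, 0 ≤ x ∧ ∃ w ∈ M.succ v, (c + x, q) ∈ X w ∧
      ∀ w ∈ M.succ v, ∀ b, b ≤ c - x → 0 ≤ b → (b, q) ∈ X w := by
  obtain ⟨hq, b, b', h1, ⟨w, hw, h2⟩, h3⟩ := (mem_bellman_ctrl hv).1 h
  dsimp only at h1 h2 h3 hq
  rcases le_total b b' with hb | hb
  · exact ⟨(b' - b) / 2, by linarith, w, hw, by rwa [show c + (b' - b) / 2 = b' by linarith],
      fun w hw d hd hd1 => (hX w).mono (h3 w hw) (by linarith) hd1 le_rfl hq.2⟩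
  · refine ⟨0, le_rfl, w, hw, ?_, fun w hw d hd hd1 => (hX w).mono (h3 w hw) (by linarith) hd1
      le_rfl hq.2⟩
    have := ((hX w).sub h2).1.1
    exact (hX w).mono (h3 w hw) (by linarith) (by dsimp only at this; linarith) le_rfl hq.2

/-- The largest probability that a region allows for a budget. -/
noncomputable def topProb (X : Set (ℝ × ℝ)) (b : ℝ) : ℝ := sSup {q | (b, q) ∈ X}

/-- The smallest probability that a region allows for a budget. -/
noncomputable def botProb (X : Set (ℝ × ℝ)) (b : ℝ) : ℝ := sInf {q | (b, q) ∈ X}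

lemma topProb_mem {X : Set (ℝ × ℝ)} (hX : IsUp X) (cX : IsClosed X) {b : ℝ}
    (hb : b ∈ Icc (0 : ℝ) 1) : (b, topProb X b) ∈ X :=
  IsClosed.csSup_mem (s := {q | (b, q) ∈ X}) (cX.preimage (f := fun q => (b, q)) (by fun_prop))
    ⟨0, hX.bot hb⟩ ⟨1, fun _ hq => (hX.sub hq).2.2⟩

lemma le_topProb {X : Set (ℝ × ℝ)} (hX : IsUp X) {b q : ℝ} (h : (b, q) ∈ X) : q ≤ topProb X b :=
  le_csSup ⟨1, fun _ hq => (hX.sub hq).2.2⟩ h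

lemma botProb_mem {X : Set (ℝ × ℝ)} (hX : IsDn X) (cX : IsClosed X) {b : ℝ}
    (hb : b ∈ Icc (0 : ℝ) 1) : (b, botProb X b) ∈ X :=
  IsClosed.csInf_mem (s := {q | (b, q) ∈ X}) (cX.preimage (f := fun q => (b, q)) (by fun_prop))
    ⟨1, hX.top hb⟩ ⟨0, fun _ hq => (hX.sub hq).2.1⟩

lemma botProb_le {X : Set (ℝ × ℝ)} (hX : IsDn X) {b q : ℝ} (h : (b, q) ∈ X) : botProb X b ≤ q :=
  csInf_le ⟨0, fun _ hq => (hX.sub hq).2.1⟩ h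

lemma budget_snoc (σ τ : Policy M) (B : ℝ) {n : ℕ} (ρ : Hist V n) (w : V) :
    (ρ.last ∈ M.ctrl → τ.bid n ρ (1 - budget σ τ B n ρ) ≤ σ.bid n ρ (budget σ τ B n ρ) →
      budget σ τ B (n + 1) (ρ.snoc w) =
        budget σ τ B n ρ - σ.bid n ρ (budget σ τ B n ρ)) ∧
    (ρ.last ∈ M.ctrl → σ.bid n ρ (budget σ τ B n ρ) < τ.bid n ρ (1 - budget σ τ B n ρ) →
      budget σ τ B (n + 1) (ρ.snoc w) =
        budget σ τ B n ρ + τ.bid n ρ (1 - budget σ τ B n ρ)) ∧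
    (ρ.last ∉ M.ctrl → budget σ τ B (n + 1) (ρ.snoc w) = budget σ τ B n ρ) := by
  refine ⟨fun h1 h2 => ?_, fun h1 h2 => ?_, fun h1 => ?_⟩
  · simp [budget, h1, h2]
  · simp [budget, h1, not_le.2 h2]
  · simp [budget, h1]

omit [Fintype V] in
lemma Hist.eq_snoc {n : ℕ} (ρ : Hist V (n + 1)) : ρ.init.snoc ρ.last = ρ := by
  funext i
  by_cases h : i.1 ≤ n
  · simp [Hist.snoc, Hist.init, h]
  · have := Finset.mem_Iic.1 i.2
    have h' : i = ⟨n + 1, Finset.mem_Iic.2 le_rfl⟩ := Subtype.ext (by simp; omega)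
    subst h'
    simp [Hist.snoc, Hist.last]

/-- The winner pays his own bid, so neither player's reserve, `η` or `1 - θ`, is ever touched. -/
lemma budget_mem (σ τ : Policy M) {B η θ : ℝ} (hη : 0 ≤ η) (hθ : θ ≤ 1) (hB : B ∈ Icc η θ)
    (hσ : ∀ n ρ, ∀ b ∈ Icc η θ, ρ.last ∈ M.ctrl → σ.bid n ρ b ≤ b - η)
    (hτ : ∀ n ρ, ∀ b ∈ Icc η θ, ρ.last ∈ M.ctrl → τ.bid n ρ (1 - b) ≤ θ - b)
    (n : ℕ) (ρ : Hist V n) : budget σ τ B n ρ ∈ Icc η θ := by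
  induction n with
  | zero => exact hB
  | succ n ih =>
    rw [← ρ.eq_snoc]
    obtain ⟨h1, h2, h3⟩ := budget_snoc σ τ B ρ.init ρ.last
    have hb := ih ρ.init
    by_cases hc : ρ.init.last ∈ M.ctrl
    · have hb1 : budget σ τ B n ρ.init ∈ Icc (0 : ℝ) 1 := ⟨hη.trans hb.1, hb.2.trans hθ⟩
      have h4 := σ.bid_mem n ρ.init _ hb1 hc
      have h5 := τ.bid_mem n ρ.init (1 - budget σ τ B n ρ.init)
        ⟨by linarith [hb1.2], by linarith [hb1.1]⟩ hc
      have h6 := hσ n ρ.init _ hb hc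
      have h7 := hτ n ρ.init _ hb hc
      rcases le_or_gt (τ.bid n ρ.init (1 - budget σ τ B n ρ.init))
        (σ.bid n ρ.init (budget σ τ B n ρ.init)) with h | h
      · rw [h1 hc h]
        exact ⟨by linarith, by linarith [hb.2, h4.1]⟩
      · rw [h2 hc h]
        exact ⟨by linarith [hb.1, h5.1], by linarith⟩
    · rw [h3 hc]; exact hb

variable [MeasurableSpace V] [DiscreteMeasurableSpace V]

/-- The reachability player wins with more budget and less probability than a point of the value of
some horizon. -/
theorem reach_wins_of_rval {N : ℕ} {v : V} {B p : ℝ} {z : ℝ × ℝ} (hz : z ∈ rval M T N v)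
    (hB1 : B ≤ 1) (h1 : z.1 < B) (h2 : p ≤ z.2) :
    (winPol M T B p v .reach).Nonempty := by
  classical
  -- The surplus is kept as a reserve, and the policy plays with the virtual budget `b - η`. Since
  -- this stays below `1`, the edge of budget `1` in the horizon-zero value never occurs: at the end
  -- either `T` is visited or the guaranteed probability is zero.
  set η := B - z.1 with hη
  have hη0 : 0 < η := by rw [hη]; linarith
  have hz' := (isUp_rval N v).sub hz
  have hstep : ∀ k v c, ∃ x w, v ∈ M.ctrl → c ∈ Icc (0 : ℝ) 1 → 0 ≤ x ∧ w ∈ M.succ v ∧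
      (c - x, topProb (rval M T (k + 1) v) c) ∈ rval M T k w ∧ ∀ w ∈ M.succ v, ∀ b, c + x ≤ b →
      b ≤ 1 → (b, topProb (rval M T (k + 1) v) c) ∈ rval M T k w := fun k v c => by
    by_cases h : v ∈ M.ctrl ∧ c ∈ Icc (0 : ℝ) 1
    · obtain ⟨x, hx, w, hw, h3⟩ := exists_bid_up (isUp_rval k) h.1
        (topProb_mem (isUp_rval (M := M) (T := T) (k + 1) v) (isClosed_rval (k + 1) v) h.2)
      exact ⟨x, w, fun _ _ => ⟨hx, hw, h3⟩⟩
    · exact ⟨0, v, fun h3 h4 => absurd ⟨h3, h4⟩ h⟩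
  choose bid mv hbid using hstep
  have hbid0 : ∀ k v c, v ∈ M.ctrl → c ∈ Icc (0 : ℝ) 1 → 0 ≤ bid k v c ∧ bid k v c ≤ c := by
    intro k v c hv hc
    have h3 := hbid k v c hv hc
    have h4 := ((isUp_rval k _).sub h3.2.2.1).1.1
    dsimp only at h4
    exact ⟨h3.1, by linarith⟩
  let σ : Policy M :=
    -- At time `n < N` the remaining horizon is `N - n`, so the move leads into values of horizon `N
    -- - 1 - n`. What is played from time `N` on is immaterial.
    { bid := fun n ρ b => if η ≤ b then bid (N - 1 - n) ρ.last (b - η) else 0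
      move := fun n ρ b => if η ≤ b then mv (N - 1 - n) ρ.last (b - η) else
        (M.succ_nonempty ρ.last).some
      bid_mem := fun n ρ b hb hc => by
        split_ifs with h
        · have h3 := hbid0 (N - 1 - n) ρ.last (b - η) hc ⟨by linarith, by linarith [hb.2]⟩
          exact ⟨h3.1, by linarith⟩
        · exact ⟨le_rfl, hb.1⟩
      move_mem := fun n ρ b hb hc => by
        split_ifs with h
        · exact (hbid (N - 1 - n) ρ.last (b - η) hc ⟨by linarith, by linarith [hb.2]⟩).2.1
        · exact (M.succ_nonempty ρ.last).some_mem }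
  refine ⟨σ, fun τ => ?_⟩
  have hbud : ∀ n ρ, budget σ τ B n ρ ∈ Icc η 1 := by
    intro n ρ
    refine budget_mem σ τ hη0.le le_rfl ⟨by linarith [hz'.1.1], hB1⟩ (fun n ρ b hb hc => ?_)
      (fun n ρ b hb hc => ?_) n ρ
    · simp only [σ, if_pos hb.1]
      exact (hbid0 _ _ _ hc ⟨by linarith [hb.1], by linarith [hb.2]⟩).2
    · exact (τ.bid_mem n ρ (1 - b) ⟨by linarith [hb.2], by linarith [hb.1]⟩ hc).2
  -- The best probability guaranteed by the virtual budget within the remaining horizon is a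
  -- submartingale up to time `N`.
  let G : (n : ℕ) → Hist V n → ℝ := fun n ρ =>
    topProb (rval M T (N - n) ρ.last) (budget σ τ B n ρ - η)
  have hcI : ∀ n ρ, budget σ τ B n ρ - η ∈ Icc (0 : ℝ) 1 := fun n ρ =>
    ⟨by linarith [(hbud n ρ).1], by linarith [(hbud n ρ).2]⟩
  have hG0 : ∀ n ρ, 0 ≤ G n ρ := fun n ρ => ((isUp_rval _ _).sub
    (topProb_mem (isUp_rval (M := M) (T := T) (N - n) ρ.last) (isClosed_rval _ _) (hcI n ρ))).2.1
  have hsub := le_lintegral_histLaw σ τ B (G := G) (N := N) hG0 ?_ ?_ v le_rfl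
  · refine h2.trans (le_reachProb σ τ B N ?_)
    refine le_trans (ENNReal.ofReal_le_ofReal ?_) (hsub.trans ?_)
    · refine le_topProb (isUp_rval _ _) ?_
      have : budget σ τ B 0 (fun _ => v) - η = z.1 := by simp [budget, hη]
      rw [this]
      exact hz
    · rw [← lintegral_indicator_one (DiscreteMeasurableSpace.forall_measurableSet _)]
      refine lintegral_mono fun ρ => ?_
      have h3 : (budget σ τ B N ρ - η, G N ρ) ∈ rval M T (N - N) ρ.last :=
        topProb_mem (isUp_rval (M := M) (T := T) (N - N) ρ.last) (isClosed_rval _ _) (hcI N ρ)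
      rw [Nat.sub_self] at h3
      have h4 := mem_rval0.1 h3
      rcases h4.2 with h5 | h5 | h5
      · have : ρ ∈ {ρ : Hist V N | ρ.Visits T} := ⟨_, h5⟩
        rw [indicator_of_mem this]
        exact ENNReal.ofReal_le_one.2 h4.1.2.2
      · simp [h5]
      · linarith [(hbud N ρ).2]
  · intro n ρ hn hc
    have hk : N - n = (N - 1 - n) + 1 := by omega
    have hk' : N - (n + 1) = N - 1 - n := by omega
    obtain ⟨hx0, hw, hwin, hlose⟩ := hbid (N - 1 - n) ρ.last _ hc (hcI n ρ)
    have hb := hbud n ρ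
    have hbid' : σ.bid n ρ (budget σ τ B n ρ) = bid (N - 1 - n) ρ.last (budget σ τ B n ρ - η) := by
      simp only [σ, if_pos hb.1]
    have hmv' : σ.move n ρ (budget σ τ B n ρ) = mv (N - 1 - n) ρ.last (budget σ τ B n ρ - η) := by
      simp only [σ, if_pos hb.1]
    have hτI : 1 - budget σ τ B n ρ ∈ Icc (0 : ℝ) 1 := ⟨by linarith [hb.2], by linarith [hb.1]⟩
    simp only [G, Hist.last_snoc, hk', hk]
    refine le_topProb (isUp_rval _ _) ?_
    rcases le_or_gt (τ.bid n ρ (1 - budget σ τ B n ρ)) (σ.bid n ρ (budget σ τ B n ρ)) with h | h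
    · rw [(budget_snoc σ τ B ρ _).1 hc h, scheduler, if_pos h, hbid', hmv', sub_right_comm]
      exact hwin
    · rw [(budget_snoc σ τ B ρ _).2.1 hc h, scheduler, if_neg (not_le.2 h)]
      have := (τ.bid_mem n ρ _ hτI hc).2
      rw [hbid'] at h
      -- Ties are won, so losing means that the opponent bid more and the budget grows by at least
      -- the own bid, wherever the token is moved.
      exact hlose _ (τ.move_mem n ρ _ hτI hc) _ (by linarith) (by linarith)
  · intro n ρ hn hc
    have hk : N - n = (N - 1 - n) + 1 := by omega
    have hk' : N - (n + 1) = N - 1 - n := by omega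
    simp only [G, Hist.last_snoc, hk', hk, (budget_snoc σ τ B ρ _).2.2 hc]
    have h3 := topProb_mem (isUp_rval (M := M) (T := T) ((N - 1 - n) + 1) ρ.last)
      (isClosed_rval _ _) (hcI n ρ)
    obtain ⟨-, q, h4, h5⟩ := (mem_bellman_rand hc).1 h3
    exact h5.trans_le (weighted_le hc fun w hw => le_topProb (isUp_rval _ _) (h4 w hw))

/-- The safety player wins against less budget and with more probability than a point of the limit
value. -/
theorem safe_wins_of_svalStar (hT : ∀ v ∈ T, M.IsSink v) {v : V} {B p : ℝ} {z : ℝ × ℝ}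
    (hz : z ∈ svalStar M T v) (hB0 : 0 ≤ B) (h1 : B < z.1) (h2 : z.2 ≤ p) :
    (winPol M T B p v .safe).Nonempty := by
  classical
  -- The safety player keeps `η` in reserve and acts as if the opponent owned `η` more. This virtual
  -- budget is positive, so at targets the left edge is excluded and the smallest admissible
  -- probability is `1`.
  set η := z.1 - B with hη
  have hη0 : 0 < η := by rw [hη]; linarith
  have hz' := (isDn_svalStar v).sub hz
  have hcl : ∀ w, IsClosed (svalStar M T w) := fun w => isClosed_iInter fun i => isClosed_sval i w
  have hstep : ∀ v c, ∃ x w, v ∈ M.ctrl → c ∈ Icc (0 : ℝ) 1 → 0 ≤ x ∧ w ∈ M.succ v ∧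
      (c + x, botProb (svalStar M T v) c) ∈ svalStar M T w ∧ ∀ w ∈ M.succ v, ∀ b, b ≤ c - x →
      0 ≤ b → (b, botProb (svalStar M T v) c) ∈ svalStar M T w := fun v c => by
    by_cases h : v ∈ M.ctrl ∧ c ∈ Icc (0 : ℝ) 1
    · obtain ⟨x, hx, w, hw, h3⟩ := exists_bid_dn isDn_svalStar h.1
        (svalStar_subset_bellman hT v (botProb_mem (isDn_svalStar v) (hcl v) h.2))
      exact ⟨x, w, fun _ _ => ⟨hx, hw, h3⟩⟩
    · exact ⟨0, v, fun h3 h4 => absurd ⟨h3, h4⟩ h⟩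
  choose bid mv hbid using hstep
  have hbid0 : ∀ v c, v ∈ M.ctrl → c ∈ Icc (0 : ℝ) 1 → 0 ≤ bid v c ∧ bid v c ≤ 1 - c := by
    intro v c hv hc
    have h3 := hbid v c hv hc
    have h4 := ((isDn_svalStar _).sub h3.2.2.1).1.2
    dsimp only at h4
    exact ⟨h3.1, by linarith⟩
  let τ : Policy M :=
    -- An own budget `s` corresponds to the virtual reachability budget `1 - s + η`. The policy
    -- depends only on the current vertex and budget, so it works for all horizons at once.
    { bid := fun _ ρ s => if η ≤ s then bid ρ.last (1 - s + η) else 0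
      move := fun _ ρ s => if η ≤ s then mv ρ.last (1 - s + η) else
        (M.succ_nonempty ρ.last).some
      bid_mem := fun n ρ b hb hc => by
        split_ifs with h
        · have h3 := hbid0 ρ.last (1 - b + η) hc ⟨by linarith [hb.2], by linarith⟩
          exact ⟨h3.1, by linarith⟩
        · exact ⟨le_rfl, hb.1⟩
      move_mem := fun n ρ b hb hc => by
        split_ifs with h
        · exact (hbid ρ.last (1 - b + η) hc ⟨by linarith [hb.2], by linarith⟩).2.1
        · exact (M.succ_nonempty ρ.last).some_mem }
  refine ⟨τ, fun σ => ?_⟩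
  have hbud : ∀ n ρ, budget σ τ B n ρ ∈ Icc 0 (1 - η) := by
    intro n ρ
    refine budget_mem σ τ le_rfl (by linarith) ⟨hB0, by linarith [hz'.1.2]⟩ (fun n ρ b hb hc => ?_)
      (fun n ρ b hb hc => ?_) n ρ
    · have := (σ.bid_mem n ρ b ⟨hb.1, by linarith [hb.2]⟩ hc).2
      linarith
    · have h3 : η ≤ 1 - b := by linarith [hb.2]
      simp only [τ, if_pos h3]
      have := (hbid0 ρ.last (1 - (1 - b) + η) hc ⟨by linarith [hb.1], by linarith⟩).2
      linarith
  have hcI : ∀ n ρ, budget σ τ B n ρ + η ∈ Icc (0 : ℝ) 1 := fun n ρ =>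
    ⟨by linarith [(hbud n ρ).1], by linarith [(hbud n ρ).2]⟩
  let g : (n : ℕ) → Hist V n → ℝ := fun n ρ =>
    botProb (svalStar M T ρ.last) (budget σ τ B n ρ + η)
  have hgm : ∀ n ρ, (budget σ τ B n ρ + η, g n ρ) ∈ svalStar M T ρ.last := fun n ρ =>
    botProb_mem (isDn_svalStar _) (hcl _) (hcI n ρ)
  have hg0 : ∀ n ρ, 0 ≤ g n ρ := fun n ρ => ((isDn_svalStar _).sub (hgm n ρ)).2.1
  have hgT : ∀ n ρ, ρ.last ∈ T → g n ρ = 1 := fun n ρ hρ => by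
    have h3 := (mem_sval0.1 (mem_iInter.1 (hgm n ρ) 0)).2
    rcases h3 with h3 | h3 | h3
    · exact absurd hρ h3
    · exact h3
    · linarith [(hbud n ρ).1]
  -- Stopping at `1` after a visit to `T` gives a supermartingale that dominates the indicator of
  -- having visited `T`. The stopping causes no jump, since `g` is already `1` at targets.
  let G : (n : ℕ) → Hist V n → ℝ := fun n ρ => if ρ.Visits T then 1 else g n ρ
  have hG0 : ∀ n ρ, 0 ≤ G n ρ := fun n ρ => by
    simp only [G]; split_ifs
    exacts [zero_le_one, hg0 n ρ]
  have hGs : ∀ n (ρ : Hist V n) w, ¬ρ.Visits T → G (n + 1) (ρ.snoc w) = g (n + 1) (ρ.snoc w) := by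
    intro n ρ w hρ
    simp only [G, Hist.visits_snoc, hρ, false_or]
    split_ifs with hw
    · exact (hgT _ _ (by simpa using hw)).symm
    · rfl
  have hGv : ∀ n (ρ : Hist V n) w, ρ.Visits T → G (n + 1) (ρ.snoc w) = 1 := fun n ρ w hρ => by
    simp [G, Hist.visits_snoc, hρ]
  have hsup := lintegral_histLaw_le σ τ B (G := G) hG0 ?_ ?_ v
  · refine reachProb_le σ τ B (hz'.2.1.trans h2) fun n => le_trans ?_
      ((hsup n).trans (ENNReal.ofReal_le_ofReal ?_))
    · rw [← lintegral_indicator_one (DiscreteMeasurableSpace.forall_measurableSet _)]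
      refine lintegral_mono fun ρ => ?_
      by_cases hρ : ρ ∈ {ρ : Hist V n | ρ.Visits T}
      · rw [indicator_of_mem hρ]
        simp only [G, if_pos (show ρ.Visits T from hρ)]
        simp
      · rw [indicator_of_notMem hρ]
        exact zero_le
    · have hg : g 0 (fun _ => v) ≤ z.2 := by
        refine botProb_le (isDn_svalStar _) ?_
        have : budget σ τ B 0 (fun _ => v) + η = z.1 := by simp [budget, hη]
        rw [this]
        exact hz
      by_cases hv : v ∈ T
      · have h3 := hgT 0 (fun _ => v) hv
        have : G 0 (fun _ => v) ≤ 1 := by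
          simp only [G]; split_ifs
          exacts [le_rfl, h3.le]
        linarith
      · have : G 0 (fun _ => v) = g 0 fun _ => v := by
          simp only [G]
          rw [if_neg]
          rintro ⟨i, hi⟩
          exact hv hi
        linarith
  · intro n ρ hc
    by_cases hρ : ρ.Visits T
    · rw [hGv n ρ _ hρ]
      simp [G, hρ]
    rw [hGs n ρ _ hρ]
    simp only [G, if_neg hρ]
    have hb := hbud n ρ
    have h3 : η ≤ 1 - budget σ τ B n ρ := by linarith [hb.2]
    obtain ⟨hx0, hw, hwin, hlose⟩ := hbid ρ.last _ hc (hcI n ρ)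
    have e1 : 1 - (1 - budget σ τ B n ρ) + η = budget σ τ B n ρ + η := by ring
    have hbid' : τ.bid n ρ (1 - budget σ τ B n ρ) = bid ρ.last (budget σ τ B n ρ + η) := by
      simp only [τ, if_pos h3, e1]
    have hmv' : τ.move n ρ (1 - budget σ τ B n ρ) = mv ρ.last (budget σ τ B n ρ + η) := by
      simp only [τ, if_pos h3, e1]
    have hσI : budget σ τ B n ρ ∈ Icc (0 : ℝ) 1 := ⟨hb.1, by linarith [hb.2]⟩
    simp only [g, Hist.last_snoc]
    refine botProb_le (isDn_svalStar _) ?_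
    rcases le_or_gt (τ.bid n ρ (1 - budget σ τ B n ρ)) (σ.bid n ρ (budget σ τ B n ρ)) with h | h
    · rw [(budget_snoc σ τ B ρ _).1 hc h, scheduler, if_pos h]
      have := (σ.bid_mem n ρ _ hσI hc).2
      rw [hbid'] at h
      exact hlose _ (σ.move_mem n ρ _ hσI hc) _ (by linarith) (by linarith)
    · rw [(budget_snoc σ τ B ρ _).2.1 hc h, scheduler, if_neg (not_le.2 h), hbid', hmv',
        add_right_comm]
      exact hwin
  · intro n ρ hc
    by_cases hρ : ρ.Visits T
    · simp only [hGv n ρ _ hρ, weighted_const hc]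
      simp [G, hρ]
    simp only [hGs n ρ _ hρ]
    simp only [G, if_neg hρ]
    obtain ⟨-, q, h4, h5⟩ := (mem_bellman_rand hc).1 (svalStar_subset_bellman hT _ (hgm n ρ))
    dsimp only at h4 h5
    rw [h5]
    refine weighted_le hc fun w hw => ?_
    simp only [g, Hist.last_snoc, (budget_snoc σ τ B ρ _).2.2 hc]
    exact botProb_le (isDn_svalStar _) (h4 w hw)

end Strategies

/-! ### The error of abstract value iteration -/

lemma gridHull_mono (α : ℝ) {S S' : Set (ℝ × ℝ)} (h : S ⊆ S') : gridHull α S ⊆ gridHull α S' := by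
  intro x hx
  simp only [gridHull, mem_iUnion, exists_prop] at hx ⊢
  obtain ⟨i, j, ⟨h1, h2, h3⟩, h4⟩ := hx
  exact ⟨i, j, ⟨h1, h2, h3.mono (inter_subset_inter_right _ h)⟩, h4⟩

lemma exists_near_of_mem_gridHull {α : ℝ} {S : Set (ℝ × ℝ)} {y : ℝ × ℝ} (hy : y ∈ gridHull α S) :
    ∃ z ∈ S, y.1 - α ≤ z.1 ∧ z.1 ≤ y.1 + α ∧ y.2 - α ≤ z.2 ∧ z.2 ≤ y.2 + α := by
  simp only [gridHull, mem_iUnion, exists_prop] at hy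
  obtain ⟨i, j, ⟨_, _, z, ⟨⟨h1, h2⟩, h3, h4⟩, hz⟩, ⟨h5, h6⟩, h7, h8⟩ := hy
  exact ⟨z, hz, by linarith, by linarith, by linarith, by linarith⟩

lemma exists_cell {K : ℕ} (hK : 0 < K) {x : ℝ} (hx : x ∈ Icc (0 : ℝ) 1) :
    ∃ i < K, (i : ℝ) * (1 / K) ≤ x ∧ x ≤ (i + 1) * (1 / K) := by
  have hK' : (0 : ℝ) < K := by exact_mod_cast hK
  have key : ∀ i : ℕ, ((i : ℝ) * (1 / K) ≤ x ∧ x ≤ (i + 1) * (1 / K)) ↔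
      ((i : ℝ) ≤ x * K ∧ x * K ≤ i + 1) := fun i => by
    rw [mul_one_div, mul_one_div, div_le_iff₀ hK', le_div_iff₀ hK']
  simp only [key]
  -- The right end belongs to the last cell, whereas rounding down would give the index `K`.
  rcases eq_or_lt_of_le hx.2 with rfl | h1
  · refine ⟨K - 1, by omega, ?_, ?_⟩
    · rw [one_mul]; exact_mod_cast Nat.sub_le K 1
    · rw [one_mul]; exact_mod_cast (by omega : K ≤ K - 1 + 1)
  · have h0 : 0 ≤ x * K := mul_nonneg hx.1 hK'.le
    refine ⟨⌊x * K⌋₊, (Nat.floor_lt h0).2 (by nlinarith), Nat.floor_le h0, (Nat.lt_floor_add_one _).le⟩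

lemma subset_gridHull {K : ℕ} (hK : 0 < K) {S : Set (ℝ × ℝ)} (hS : S ⊆ unitSquare) :
    S ⊆ gridHull (1 / K) S := by
  intro x hx
  obtain ⟨i, hi, h1⟩ := exists_cell hK (hS hx).1
  obtain ⟨j, hj, h2⟩ := exists_cell hK (hS hx).2
  simp only [gridHull, mem_iUnion, exists_prop, one_div_one_div, Nat.cast_lt]
  exact ⟨i, j, ⟨hi, hj, x, ⟨h1, h2⟩, hx⟩, h1, h2⟩

lemma gridHull_subset {K : ℕ} (S : Set (ℝ × ℝ)) : gridHull (1 / K) S ⊆ unitSquare := by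
  intro x hx
  simp only [gridHull, mem_iUnion, exists_prop, one_div_one_div, Nat.cast_lt] at hx
  obtain ⟨i, j, ⟨hi, hj, -⟩, ⟨h5, h6⟩, h7, h8⟩ := hx
  have hK' : (0 : ℝ) < K := by exact_mod_cast (by omega : 0 < K)
  have key : ∀ i < K, ((i : ℝ) + 1) * (1 / K) ≤ 1 := fun i hi => by
    rw [mul_one_div, div_le_one hK']; exact_mod_cast hi
  exact ⟨⟨le_trans (by positivity) h5, h6.trans (key i hi)⟩,
    le_trans (by positivity) h7, h8.trans (key j hj)⟩

section Abstract

variable {V : Type*} [Fintype V] {M : MDP V} {T : Set V}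

lemma sval_subset_absSval {K : ℕ} (hK : 0 < K) (i : ℕ) (v : V) :
    sval M T i v ⊆ absSval M T (1 / K) i v := by
  induction i generalizing v with
  | zero => exact subset_gridHull hK (isDn_sval (M := M) 0 v).sub
  | succ i ih =>
    exact (subset_gridHull hK (isDn_sval (i + 1) v).sub).trans (gridHull_mono _ (bellman_mono ih))

/-- A common shift of all successors towards the upper left passes through both averages, so the
operator does not amplify the error. Each of the `i + 1` grid hulls adds at most `α`. -/
lemma absSval_error {α : ℝ} (hα : 0 ≤ α) (i : ℕ) (v : V) {y : ℝ × ℝ}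
    (hy : y ∈ absSval M T α i v) :
    (max (y.1 - (i + 1) * α) 0, min (y.2 + (i + 1) * α) 1) ∈ sval M T i v := by
  induction i generalizing v y with
  | zero =>
    obtain ⟨z, hz, h1, h2, h3, h4⟩ := exists_near_of_mem_gridHull hy
    have hz' := (isDn_sval (M := M) (T := T) 0 v).sub hz
    refine (isDn_sval (M := M) (T := T) 0 v).mono (B := z.1) (p := z.2) hz ?_ (le_max_right _ _) ?_
      (min_le_right _ _)
    · exact max_le (by push_cast; linarith) hz'.1.1
    · exact le_min (by push_cast; linarith) hz'.2.2
  | succ i ih =>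
    obtain ⟨z, hz, h1, h2, h3, h4⟩ := exists_near_of_mem_gridHull hy
    set e := ((i : ℝ) + 1) * α
    have he : 0 ≤ e := by positivity
    have he' : ((i + 1 : ℕ) + 1 : ℝ) * α = e + α := by push_cast; ring
    suffices h : (max (z.1 - e) 0, min (z.2 + e) 1) ∈ sval M T (i + 1) v by
      rw [he']
      exact (isDn_sval _ v).mono h (max_le_max_right _ (by linarith)) (le_max_right _ _)
        (min_le_min_right _ (by linarith)) (min_le_right _ _)
    by_cases hv : v ∈ M.ctrl
    · obtain ⟨hp, b, c, hB, ⟨w, hw, h5⟩, h6⟩ := (mem_bellman_ctrl hv).1 hz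
      have h7 := ih w h5
      have h8 := fun w hw => ih w (h6 w hw)
      dsimp only at h7 h8
      refine (isDn_sval (i + 1) v).mono (B := (max (b - e) 0 + max (c - e) 0) / 2)
        (p := min (z.2 + e) 1) ((mem_bellman_ctrl hv).2 ⟨⟨le_min (by linarith [hp.1]) (by simp),
        min_le_right _ _⟩, _, _, rfl, ⟨w, hw, h7⟩, h8⟩) (max_le ?_ ?_) (le_max_right _ _) le_rfl
        (min_le_right _ _)
      · have := le_max_left (b - e) 0
        have := le_max_left (c - e) 0
        linarith
      · have := le_max_right (b - e) 0
        have := le_max_right (c - e) 0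
        linarith
    · obtain ⟨hB, q, h5, h6⟩ := (mem_bellman_rand hv).1 hz
      have h7 := fun w hw => ih w (h5 w hw)
      dsimp only at h7
      refine (isDn_sval (i + 1) v).mono (B := max (z.1 - e) 0)
        (p := ∑ w, M.δ v w * min (q w + e) 1) ((mem_bellman_rand hv).2 ⟨⟨le_max_right _ _,
        max_le (by linarith [hB.2]) zero_le_one⟩, _, h7, rfl⟩) le_rfl (le_max_right _ _)
        (le_min ?_ ?_) (min_le_right _ _)
      · refine (weighted_le hv (g := fun w => q w + e) fun w _ => min_le_left _ _).trans ?_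
        simp only [mul_add, Finset.sum_add_distrib, weighted_const hv, ← h6, le_refl]
      · refine (weighted_le hv (g := fun w => 1) fun w _ => min_le_right _ _).trans ?_
        rw [weighted_const hv]

end Abstract

/-! ### The two sides of the threshold -/

section Sides

variable {V : Type*} [Fintype V] {M : MDP V} {T : Set V}

/-- Some open quadrant around `x` misses the limit safety value. -/
def ReachSide (M : MDP V) (T : Set V) (v : V) (x : ℝ × ℝ) : Prop :=
  ∃ y : ℝ × ℝ, y.1 < x.1 ∧ x.2 < y.2 ∧
    ∀ z ∈ unitSquare, y.1 < z.1 → z.2 < y.2 → z ∉ svalStar M T v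

/-- Some open quadrant around `x` misses the limit reachability value. -/
def SafeSide (M : MDP V) (T : Set V) (v : V) (x : ℝ × ℝ) : Prop :=
  ∃ y : ℝ × ℝ, x.1 < y.1 ∧ y.2 < x.2 ∧
    ∀ z ∈ unitSquare, z.1 < y.1 → y.2 < z.2 → z ∉ rvalStar M T v

lemma isOpen_quadrant_lower (y : ℝ × ℝ) : IsOpen {z : ℝ × ℝ | y.1 < z.1 ∧ z.2 < y.2} :=
  (isOpen_lt continuous_const continuous_fst).inter (isOpen_lt continuous_snd continuous_const)

lemma isOpen_quadrant_upper (y : ℝ × ℝ) : IsOpen {z : ℝ × ℝ | z.1 < y.1 ∧ y.2 < z.2} :=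
  (isOpen_lt continuous_fst continuous_const).inter (isOpen_lt continuous_const continuous_snd)

lemma ReachSide.mem_nhds {v : V} {x : ℝ × ℝ} (h : ReachSide M T v x) :
    rvalStar M T v ∈ 𝓝[unitSquare] x := by
  obtain ⟨y, h1, h2, h3⟩ := h
  refine mem_nhdsWithin.2 ⟨_, isOpen_quadrant_lower y, ⟨h1, h2⟩, ?_⟩
  rintro z ⟨⟨h4, h5⟩, hz⟩
  exact mem_rvalStar_of_notMem_svalStar hz (h3 z hz h4 h5)

lemma SafeSide.mem_nhds {v : V} {x : ℝ × ℝ} (h : SafeSide M T v x) :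
    svalStar M T v ∈ 𝓝[unitSquare] x := by
  obtain ⟨y, h1, h2, h3⟩ := h
  refine mem_nhdsWithin.2 ⟨_, isOpen_quadrant_upper y, ⟨h1, h2⟩, ?_⟩
  rintro z ⟨⟨h4, h5⟩, hz⟩
  exact not_not.1 fun h => h3 z hz h4 h5 (mem_rvalStar_of_notMem_svalStar hz h)

lemma ReachSide.mem {v : V} {x : ℝ × ℝ} (h : ReachSide M T v x) (hx : x ∈ unitSquare) :
    x ∈ rvalStar M T v := mem_of_mem_nhdsWithin hx h.mem_nhds

lemma SafeSide.notMem {v : V} {x : ℝ × ℝ} (h : SafeSide M T v x) (hx : x ∈ unitSquare) :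
    x ∉ rvalStar M T v := by
  obtain ⟨y, h1, h2, h3⟩ := h
  exact h3 x hx h1 h2

lemma infDist_nonneg_le {S : Set (ℝ × ℝ)} {x y : ℝ × ℝ} (hy : y ∈ S) {r : ℝ}
    (h1 : |x.1 - y.1| ≤ r) (h2 : |x.2 - y.2| ≤ r) : Metric.infDist x S ≤ r := by
  refine (Metric.infDist_le_dist_of_mem hy).trans ?_
  rw [Prod.dist_eq]
  exact max_le h1 h2

lemma SafeSide.thresholdDist_eq {v : V} {x : ℝ × ℝ} (h : SafeSide M T v x) (hx : x ∈ unitSquare) :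
    thresholdDist M T v x = Metric.infDist x (rvalStar M T v) := by
  rw [thresholdDist, if_neg (h.notMem hx)]

lemma ReachSide.thresholdDist_eq {v : V} {x : ℝ × ℝ} (h : ReachSide M T v x)
    (hx : x ∈ unitSquare) : thresholdDist M T v x = Metric.infDist x (svalStar M T v) := by
  rw [thresholdDist, if_pos (h.mem hx)]

lemma thresholdDist_le_one {v : V} {x : ℝ × ℝ} (hx : x ∈ unitSquare) :
    thresholdDist M T v x ≤ 1 := by
  obtain ⟨⟨h1, h2⟩, h3, h4⟩ := hx
  unfold thresholdDist
  split_ifs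
  · refine infDist_nonneg_le ((isDn_svalStar v).left ⟨h3, h4⟩) ?_ ?_ <;> dsimp only <;>
      rw [abs_le] <;> constructor <;> linarith
  · refine infDist_nonneg_le ((isUp_rvalStar v).right ⟨h3, h4⟩) ?_ ?_ <;> dsimp only <;>
      rw [abs_le] <;> constructor <;> linarith

lemma thresholdDist_pos {v : V} {x : ℝ × ℝ} (hx : x ∈ unitSquare)
    (h : ReachSide M T v x ∨ SafeSide M T v x) : 0 < thresholdDist M T v x := by
  rcases h with h | h
  · rw [h.thresholdDist_eq hx]
    refine (Metric.infDist_pos_iff_notMem_closure ⟨_, (isDn_svalStar v).left hx.2⟩).1 fun hcl => ?_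
    obtain ⟨y, h1, h2, h3⟩ := h
    obtain ⟨z, h4, h5⟩ := mem_closure_iff.1 hcl _ (isOpen_quadrant_lower y) ⟨h1, h2⟩
    exact h3 z ((isDn_svalStar v).sub h5) h4.1 h4.2 h5
  · rw [h.thresholdDist_eq hx]
    refine (Metric.infDist_pos_iff_notMem_closure ⟨_, (isUp_rvalStar v).bot hx.1⟩).1 fun hcl => ?_
    obtain ⟨y, h1, h2, h3⟩ := h
    obtain ⟨z, h4, h5⟩ := mem_closure_iff.1 hcl _ (isOpen_quadrant_upper y) ⟨h1, h2⟩
    exact h3 z ((isUp_rvalStar v).sub h5) h4.1 h4.2 h5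

variable [MeasurableSpace V] [DiscreteMeasurableSpace V]

/-- If the reachability player fails at a point to the lower right of `x`, no point of the limit
reachability value can lie strictly to the upper left of that point, since it would yield a winning
policy there. The other failure is symmetric. -/
lemma sides_of_notMem_threshold (hT : ∀ v ∈ T, M.IsSink v) {v : V} {x : ℝ × ℝ}
    (hx : x ∈ unitSquare) (h : x ∉ threshold M T v) : ReachSide M T v x ∨ SafeSide M T v x := by
  by_contra hcon
  rw [not_or] at hcon
  refine h ⟨hx, fun y hy h1 h2 => ?_, fun y hy h1 h2 => ?_⟩
  · by_contra hn
    refine hcon.2 ⟨y, h1, h2, fun z hz h3 h4 hzR => hn ?_⟩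
    obtain ⟨z', h5, h6⟩ := mem_closure_iff.1 hzR _ (isOpen_quadrant_upper y) ⟨h3, h4⟩
    obtain ⟨N, hN⟩ := mem_iUnion.1 h6
    exact reach_wins_of_rval hN hy.1.2 h5.1 h5.2.le
  · by_contra hn
    exact hcon.1 ⟨y, h1, h2, fun z hz h3 h4 hzS =>
      hn (safe_wins_of_svalStar hT hzS hy.1.1 h3 h4.le)⟩

lemma not_both_win {v : V} {B p p' : ℝ} (hp : p < p') :
    ¬((winPol M T B p' v .reach).Nonempty ∧ (winPol M T B p v .safe).Nonempty) := by
  rintro ⟨⟨σ, hσ⟩, τ, hτ⟩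
  have h1 : p' ≤ reachProb σ τ B T v := hσ τ
  have h2 : reachProb σ τ B T v ≤ p := hτ σ
  linarith

/-- A point strictly between `x` and the apex of the quadrant already lies in a bounded-horizon
value. Its smaller budget leaves the surplus needed for a policy, and its strictly larger
probability excludes a winning policy of the opponent. -/
lemma ReachSide.wins {v : V} {x : ℝ × ℝ} (h : ReachSide M T v x) (hx : x ∈ unitSquare) :
    (winPol M T x.1 x.2 v .reach).Nonempty ∧ ¬(winPol M T x.1 x.2 v .safe).Nonempty := by
  obtain ⟨y, h1, h2, h3⟩ := h
  have hx1 : 0 < x.1 := lt_of_le_of_ne hx.1.1 fun h0 => h3 x hx h1 h2 <| by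
    have := (isDn_svalStar (M := M) (T := T) v).left hx.2
    rw [h0] at this
    exact this
  have hx2 : x.2 < 1 := lt_of_le_of_ne hx.2.2 fun h0 => h3 x hx h1 h2 <| by
    have := (isDn_svalStar (M := M) (T := T) v).top hx.1
    rw [← h0] at this
    exact this
  obtain ⟨B', hB1, hB2⟩ := exists_between (max_lt h1 hx1)
  obtain ⟨p', hp1, hp2⟩ := exists_between (lt_min h2 hx2)
  rw [max_lt_iff] at hB1
  rw [lt_min_iff] at hp2
  have hz : (B', p') ∈ unitSquare := ⟨⟨hB1.2.le, hB2.le.trans hx.1.2⟩, hx.2.1.trans hp1.le, hp2.2.le⟩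
  have hzS := h3 (B', p') hz hB1.1 hp2.1
  simp only [svalStar, mem_iInter, not_forall] at hzS
  obtain ⟨N, hN⟩ := hzS
  have hR := (cover_rval_sval N v hz).resolve_right hN
  refine ⟨reach_wins_of_rval hR hx.1.2 hB2 hp1.le, fun hs => ?_⟩
  exact not_both_win hp1 ⟨reach_wins_of_rval hR hx.1.2 hB2 le_rfl, hs⟩

lemma SafeSide.wins (hT : ∀ v ∈ T, M.IsSink v) {v : V} {x : ℝ × ℝ} (h : SafeSide M T v x)
    (hx : x ∈ unitSquare) :
    (winPol M T x.1 x.2 v .safe).Nonempty ∧ ¬(winPol M T x.1 x.2 v .reach).Nonempty := by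
  obtain ⟨y, h1, h2, h3⟩ := h
  have hx1 : x.1 < 1 := lt_of_le_of_ne hx.1.2 fun h0 => h3 x hx h1 h2 <| by
    have := (isUp_rvalStar (M := M) (T := T) v).right hx.2
    rw [← h0] at this
    exact this
  have hx2 : 0 < x.2 := lt_of_le_of_ne hx.2.1 fun h0 => h3 x hx h1 h2 <| by
    have := (isUp_rvalStar (M := M) (T := T) v).bot hx.1
    rw [h0] at this
    exact this
  obtain ⟨B', hB1, hB2⟩ := exists_between (lt_min h1 hx1)
  obtain ⟨p', hp1, hp2⟩ := exists_between (max_lt h2 hx2)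
  rw [lt_min_iff] at hB2
  rw [max_lt_iff] at hp1
  have hz : (B', p') ∈ unitSquare := ⟨⟨hx.1.1.trans hB1.le, hB2.2.le⟩, hp1.2.le, hp2.le.trans hx.2.2⟩
  have hS : (B', p') ∈ svalStar M T v := not_not.1 fun hn =>
    h3 (B', p') hz hB2.1 hp1.1 (mem_rvalStar_of_notMem_svalStar hz hn)
  refine ⟨safe_wins_of_svalStar hT hS hx.1.1 hB1 hp2.le, fun hr => ?_⟩
  exact not_both_win hp2 ⟨hr, safe_wins_of_svalStar hT hS hx.1.1 hB1 le_rfl⟩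

end Sides

/-! ### Soundness and completeness of the algorithm -/

lemma rval0_subset_absRval {V : Type*} [Fintype V] {M : MDP V} {T : Set V} {α : ℝ} {n : ℕ} {v : V} :
    rval0 T v ⊆ absRval M T α n v := subset_union_right

/-- The grid only enlarges safety values, so the abstract reachability value errs on one side; the
answer for the reachability player needs no margin. -/
lemma absRval_subset {V : Type*} [Fintype V] {M : MDP V} {T : Set V} {K : ℕ} (hK : 0 < K) {n : ℕ}
    {v : V} : absRval M T (1 / K) n v ⊆ rvalStar M T v := by
  refine union_subset ?_ (rval_subset_rvalStar 0 v)
  rintro x ⟨hx, h⟩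
  exact rval_subset_rvalStar n v
    ((cover_rval_sval n v hx).resolve_right fun h' => h (sval_subset_absSval hK n v h'))

namespace Instance

variable {V : Type*} [Fintype V] (I : Instance V)

lemma mem_square : (I.B, I.p) ∈ unitSquare := ⟨I.B_mem, I.p_mem⟩

lemma eps_pos (h : ℕ) : 0 < eps h := by unfold eps; positivity

lemma logb_eps (h : ℕ) : Real.logb 2 (1 / eps h) = h := by
  rw [eps, inv_pow, one_div, inv_inv, Real.logb_pow, Real.logb_self_eq_one (by norm_num), mul_one]

lemma iters_eq (h : ℕ) :
    I.iters 2 8 h = ⌈(h : ℝ) * (2 + 8 * (1 / I.M.δmin) ^ (2 * Fintype.card V))⌉₊ := by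
  rw [iters, logb_eps]

lemma le_iters (h : ℕ) :
    (h : ℝ) * (2 + 8 * (1 / I.M.δmin) ^ (2 * Fintype.card V)) ≤ I.iters 2 8 h := by
  rw [iters_eq]; exact Nat.le_ceil _

lemma two_le_iters {h : ℕ} (hh : 1 ≤ h) : 2 ≤ I.iters 2 8 h := by
  have h1 := I.le_iters h
  have h2 : (1 : ℝ) ≤ h := by exact_mod_cast hh
  have h3 : 0 < (1 / I.M.δmin) ^ (2 * Fintype.card V) := pow_pos (by
    have := I.M.δmin_pos; positivity) _
  have h4 : (2 : ℝ) ≤ I.iters 2 8 h := by nlinarith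
  exact_mod_cast h4

/-- The number of grid cells per side in round `h`. -/
noncomputable def cells (h : ℕ) : ℕ := 2 ^ h * I.iters 2 8 h

lemma cells_pos {h : ℕ} (hh : 1 ≤ h) : 0 < I.cells h :=
  Nat.mul_pos (by positivity) (by have := I.two_le_iters hh; omega)

lemma mesh_eq (h : ℕ) : eps h / I.iters 2 8 h = 1 / (I.cells h : ℕ) := by
  rw [eps, cells]
  push_cast
  rw [inv_pow, one_div, mul_inv, div_eq_mul_inv]

/-- There are `n + 1` hulls of mesh `ε / n`, and `(n + 1) / n ≤ 3 / 2` because `n ≥ 2`. -/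
lemma mesh_error {h : ℕ} (hh : 1 ≤ h) :
    ((I.iters 2 8 h : ℝ) + 1) * (1 / (I.cells h : ℕ)) ≤ 3 / 2 * eps h := by
  rw [← mesh_eq]
  have h1 := I.two_le_iters hh
  have h2 : (2 : ℝ) ≤ I.iters 2 8 h := by exact_mod_cast h1
  rw [← mul_div_assoc, div_le_iff₀ (by linarith)]
  nlinarith [eps_pos h]

lemma roundRval_eq (h : ℕ) : I.roundRval 2 8 h =
    absRval I.M I.T (1 / (I.cells h : ℕ)) (I.iters 2 8 h) I.v := by
  rw [roundRval, mesh_eq]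

lemma gap {h : ℕ} (hh : 1 ≤ h) {x : ℝ × ℝ} (hx : x ∈ rvalStar I.M I.T I.v) :
    (min (x.1 + eps h / 4) 1, max (x.2 - eps h / 4) 0) ∈ rval I.M I.T (I.iters 2 8 h) I.v :=
  gap_of_iters I.sinks hh (I.le_iters h) hx

lemma round_ne_reach {h : ℕ} (hh : 1 ≤ h) (hs : SafeSide I.M I.T I.v (I.B, I.p)) :
    (I.B, I.p) ∉ I.roundRval 2 8 h := fun hmem =>
  hs.notMem I.mem_square (absRval_subset (I.cells_pos hh) (I.roundRval_eq h ▸ hmem))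

/-- On this side a shift by `ε / 4` already lands in the bounded-horizon reachability value. If a
shift by `r` still lay in the abstract safety value, undoing the grid error would give a point of
the bounded-horizon safety value strictly to the lower right, against `thin_rval_sval`. -/
lemma round_ne_safe {h : ℕ} (hh : 1 ≤ h) (hs : ReachSide I.M I.T I.v (I.B, I.p)) :
    Metric.infDist (I.B, I.p) (I.roundRval 2 8 h) < 2 * eps h := by
  have he := eps_pos h
  have herr := I.mesh_error hh
  set s := ((I.iters 2 8 h : ℝ) + 1) * (1 / (I.cells h : ℕ)) with hsdef
  have hs0 : 0 ≤ s := by positivity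
  set e := eps h
  have hgap := I.gap hh (hs.mem I.mem_square)
  dsimp only at hgap
  obtain ⟨⟨hB0, hB1⟩, hp0, hp1⟩ := I.mem_square
  dsimp only at hB0 hB1 hp0 hp1
  -- Error of the iteration, error of the grid, and a margin for strictness; since `s ≤ 3e / 2`, the
  -- sum is at most `15e / 8 < 2e`.
  set r := e / 4 + s + e / 8 with hr
  have hz : (min (I.B + r) 1, max (I.p - r) 0) ∈ I.roundRval 2 8 h := by
    rw [roundRval_eq]
    have hsq : (min (I.B + r) 1, max (I.p - r) 0) ∈ unitSquare :=
      ⟨⟨le_min (by linarith) zero_le_one, min_le_right _ _⟩, le_max_right _ _,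
        max_le (by linarith) zero_le_one⟩
    by_contra hn
    have h0 : (min (I.B + r) 1, max (I.p - r) 0) ∉ rval0 I.T I.v := fun h0 =>
      hn (rval0_subset_absRval h0)
    rw [mem_rval0] at h0
    have h1 : I.B + r < 1 := not_le.1 fun h1 => h0 ⟨hsq, Or.inr (Or.inr (min_eq_right h1))⟩
    have h2 : 0 < I.p - r := not_le.1 fun h2 => h0 ⟨hsq, Or.inr (Or.inl (max_eq_right h2))⟩
    rw [min_eq_left h1.le, max_eq_left h2.le] at hn hsq
    have h3 := absSval_error (by positivity) _ _
      (not_not.1 fun h3 => hn (Or.inl ⟨hsq, h3⟩))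
    dsimp only at h3
    rw [← hsdef] at h3
    refine thin_rval_sval _ _ hgap h3 ?_ ?_
    · exact (min_le_left _ _).trans_lt (lt_of_lt_of_le (by linarith) (le_max_left _ _))
    · exact (min_le_left _ _).trans_lt (lt_of_lt_of_le (by linarith) (le_max_left _ _))
  refine (infDist_nonneg_le hz (r := r) ?_ ?_).trans_lt (by linarith)
  · dsimp only
    rw [abs_le]
    have h1 := min_le_left (I.B + r) 1
    have h2 : I.B ≤ min (I.B + r) 1 := le_min (by linarith) hB1
    constructor <;> linarith
  · dsimp only
    rw [abs_le]
    have h1 := le_max_left (I.p - r) 0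
    have h2 : max (I.p - r) 0 ≤ I.p := max_le (by linarith) hp0
    constructor <;> linarith

/-- A point of the abstract safety value lies in the bounded-horizon safety value after a shift by
`s` to the upper left. The shift by the slightly larger `g < 2ε` is still outside the limit safety
value, hence in the limit reachability value, and `gap` brings it into the bounded-horizon one. The
two points contradict thinness. -/
lemma round_reach_of_dist {h : ℕ} (hh : 1 ≤ h) (hs : ReachSide I.M I.T I.v (I.B, I.p))
    (hd : 2 * eps h ≤ I.dist) : (I.B, I.p) ∈ I.roundRval 2 8 h := by
  have he := eps_pos h
  have herr := I.mesh_error hh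
  rw [Instance.dist, hs.thresholdDist_eq I.mem_square] at hd
  rw [roundRval_eq]
  by_contra hn
  have h1 := absSval_error (by positivity) _ _
    (not_not.1 fun h3 => hn (Or.inl ⟨I.mem_square, h3⟩))
  set s := ((I.iters 2 8 h : ℝ) + 1) * (1 / (I.cells h : ℕ)) with hsdef
  have hs0 : 0 ≤ s := by positivity
  set e := eps h
  dsimp only at h1
  obtain ⟨⟨hB0, hB1⟩, hp0, hp1⟩ := I.mem_square
  dsimp only at hB0 hB1 hp0 hp1
  set g := e / 4 + s + e / 8 with hg
  have hy : (max (I.B - g) 0, min (I.p + g) 1) ∉ svalStar I.M I.T I.v := by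
    intro hy
    have : Metric.infDist (I.B, I.p) (svalStar I.M I.T I.v) ≤ g := by
      refine infDist_nonneg_le hy ?_ ?_
      · dsimp only
        rw [abs_le]
        have h1 := le_max_left (I.B - g) 0
        have h2 : max (I.B - g) 0 ≤ I.B := max_le (by linarith) hB0
        constructor <;> linarith
      · dsimp only
        rw [abs_le]
        have h1 := min_le_left (I.p + g) 1
        have h2 : I.p ≤ min (I.p + g) 1 := le_min (by linarith) hp1
        constructor <;> linarith
    linarith
  have hB : 0 < I.B - g := not_le.1 fun h2 => hy <| by
    rw [max_eq_right h2]
    exact (isDn_svalStar _).left ⟨le_min (by linarith) zero_le_one, min_le_right _ _⟩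
  have hp : I.p + g < 1 := not_le.1 fun h2 => hy <| by
    rw [min_eq_right h2]
    exact (isDn_svalStar _).top ⟨le_max_right _ _, max_le (by linarith) zero_le_one⟩
  rw [max_eq_left hB.le, min_eq_left hp.le] at hy
  have h2 := I.gap hh (mem_rvalStar_of_notMem_svalStar
    ⟨⟨hB.le, by dsimp only; linarith⟩, by dsimp only; linarith, hp.le⟩ hy)
  dsimp only at h2
  refine thin_rval_sval _ _ h2 h1 ?_ ?_
  · exact (min_le_left _ _).trans_lt (lt_of_lt_of_le (by linarith) (le_max_left _ _))
  · exact (min_le_left _ _).trans_lt (lt_of_lt_of_le (by linarith) (le_max_left _ _))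

lemma round_safe_of_dist {h : ℕ} (hh : 1 ≤ h) (hs : SafeSide I.M I.T I.v (I.B, I.p))
    (hd : 2 * eps h ≤ I.dist) : 2 * eps h ≤ Metric.infDist (I.B, I.p) (I.roundRval 2 8 h) := by
  rw [Instance.dist, hs.thresholdDist_eq I.mem_square] at hd
  refine hd.trans (Metric.infDist_le_infDist_of_subset ?_ ?_)
  · rw [roundRval_eq]; exact absRval_subset (I.cells_pos hh)
  · exact ⟨_, rval0_subset_absRval ((isUp_rval0 _).bot I.B_mem)⟩

lemma two_eps_le_dist (hd : 0 < I.dist) :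
    2 * eps (⌈Real.logb 2 (1 / I.dist)⌉₊ + 1) ≤ I.dist := by
  have h1 := Nat.le_ceil (Real.logb 2 (1 / I.dist))
  set m := ⌈Real.logb 2 (1 / I.dist)⌉₊
  rw [Real.logb_le_iff_le_rpow (by norm_num) (by positivity), Real.rpow_natCast] at h1
  have h2 : 2 * eps (m + 1) = (2 ^ m)⁻¹ := by
    rw [eps, pow_succ, inv_pow]; ring
  rw [h2]
  rw [one_div] at h1
  exact inv_le_of_inv_le₀ hd h1

variable [MeasurableSpace V] [DiscreteMeasurableSpace V]

/-- Off the threshold the point lies strictly on one side. There the wrong answer is impossible in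
every round, and the right one is given at the latest when twice the precision is at most the
distance. -/
theorem algApprox_correct (hoff : I.OffThreshold) :
    0 < I.dist ∧
      ∃ (h : ℕ) (w : Player), I.AlgApproxReturns 2 8 h w ∧
        (∀ j, w = j ↔ I.Wins j) ∧
        (w = .reach → rvalStar I.M I.T I.v ∈ 𝓝[unitSquare] (I.B, I.p)) ∧
        (w = .safe → svalStar I.M I.T I.v ∈ 𝓝[unitSquare] (I.B, I.p)) ∧
        h ≤ ⌈Real.logb 2 (1 / I.dist)⌉₊ + 1 := by
  classical
  have hside := sides_of_notMem_threshold I.sinks I.mem_square hoff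
  have hd : 0 < I.dist := thresholdDist_pos I.mem_square hside
  refine ⟨hd, ?_⟩
  set H := ⌈Real.logb 2 (1 / I.dist)⌉₊ + 1
  have hH : 2 * eps H ≤ I.dist := I.two_eps_le_dist hd
  have hret : ∃ h, 1 ≤ h ∧ I.round 2 8 h ≠ none := by
    refine ⟨H, by omega, ?_⟩
    unfold Instance.round
    rcases hside with hs | hs
    · simp [I.round_reach_of_dist (by omega) hs hH]
    · split_ifs with h1 h2
      · simp
      · simp
      · exact absurd (I.round_safe_of_dist (by omega) hs hH) h2
  have hle : Nat.find hret ≤ H := Nat.find_min' hret ⟨by omega, by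
    unfold Instance.round
    rcases hside with hs | hs
    · simp [I.round_reach_of_dist (by omega) hs hH]
    · split_ifs with h1 h2
      · simp
      · simp
      · exact absurd (I.round_safe_of_dist (by omega) hs hH) h2⟩
  obtain ⟨h1, h2⟩ := Nat.find_spec hret
  have hmin : ∀ h', 1 ≤ h' → h' < Nat.find hret → I.round 2 8 h' = none := fun h' h3 h4 => by
    by_contra h5
    exact Nat.find_min hret h4 ⟨h3, h5⟩
  set h := Nat.find hret
  obtain ⟨w, hw⟩ := Option.ne_none_iff_exists'.1 h2
  refine ⟨h, w, ⟨h1, hw, hmin⟩, ?_⟩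
  rcases hside with hs | hs
  · have hwr : w = .reach := by
      unfold Instance.round at hw
      rw [if_neg (not_le.2 (I.round_ne_safe h1 hs))] at hw
      split_ifs at hw with h3
      simpa using hw.symm
    subst hwr
    obtain ⟨w1, w2⟩ := hs.wins I.mem_square
    refine ⟨fun j => ?_, fun _ => hs.mem_nhds, fun h => (by cases h), hle⟩
    cases j
    · exact ⟨fun _ => w1, fun _ => rfl⟩
    · exact ⟨fun h => (by cases h), fun h => absurd h w2⟩
  · have hwr : w = .safe := by
      unfold Instance.round at hw
      rw [if_neg (I.round_ne_reach h1 hs)] at hw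
      split_ifs at hw with h3
      simpa using hw.symm
    subst hwr
    obtain ⟨w1, w2⟩ := hs.wins I.sinks I.mem_square
    refine ⟨fun j => ?_, fun h => (by cases h), fun _ => hs.mem_nhds, hle⟩
    cases j
    · exact ⟨fun h => (by cases h), fun h => absurd h w2⟩
    · exact ⟨fun _ => w1, fun _ => rfl⟩

end Instance

/-! ### Abstract value iteration on grid cells -/

/-- The upper left corner of a grid cell. -/
noncomputable def cellCorner (K i j : ℕ) : ℝ × ℝ := ((i : ℝ) / K, ((j : ℝ) + 1) / K)

lemma mem_gridCell {K i j : ℕ} (hK : 0 < K) {x : ℝ × ℝ} : x ∈ gridCell (1 / K) i j ↔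
    ((i : ℝ) ≤ x.1 * K ∧ x.1 * K ≤ i + 1) ∧ (j : ℝ) ≤ x.2 * K ∧ x.2 * K ≤ j + 1 := by
  have hK' : (0 : ℝ) < K := by exact_mod_cast hK
  simp only [gridCell, mem_prod, mem_Icc, mul_one_div, div_le_iff₀ hK', le_div_iff₀ hK']

lemma cellCorner_mem_gridCell {K i j : ℕ} (hK : 0 < K) :
    cellCorner K i j ∈ gridCell (1 / K) i j := by
  have hK' : (0 : ℝ) < K := by exact_mod_cast hK
  rw [mem_gridCell hK, cellCorner, div_mul_cancel₀ _ hK'.ne', div_mul_cancel₀ _ hK'.ne']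
  exact ⟨⟨le_rfl, by linarith⟩, by linarith, le_rfl⟩

/-- A region closed towards the upper left meets a cell exactly if it contains the upper left corner
of the cell. This makes the hull computable. -/
lemma mem_gridHull {K : ℕ} (hK : 0 < K) {X : Set (ℝ × ℝ)} (hX : IsDn X) {x : ℝ × ℝ} :
    x ∈ gridHull (1 / K) X ↔
      ∃ i < K, ∃ j < K, cellCorner K i j ∈ X ∧ x ∈ gridCell (1 / K) i j := by
  have hK' : (0 : ℝ) < K := by exact_mod_cast hK
  simp only [gridHull, mem_iUnion, exists_prop, one_div_one_div, Nat.cast_lt]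
  constructor
  · rintro ⟨i, j, ⟨hi, hj, z, hz, hzX⟩, hx⟩
    refine ⟨i, hi, j, hj, ?_, hx⟩
    rw [mem_gridCell hK] at hz
    refine hX.mono (B := z.1) (p := z.2) hzX ?_ (by positivity) ?_ ?_
    · rw [div_le_iff₀ hK']; exact hz.1.1
    · rw [le_div_iff₀ hK']; exact hz.2.2
    · rw [div_le_one hK']; exact_mod_cast hj
  · rintro ⟨i, hi, j, hj, h1, h2⟩
    exact ⟨i, j, ⟨hi, hj, _, cellCorner_mem_gridCell hK, h1⟩, h2⟩

lemma exists_cell' {K : ℕ} (hK : 0 < K) {x : ℝ} (hx : x ∈ Icc (0 : ℝ) 1) :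
    ∃ i < K, (i : ℝ) ≤ x * K ∧ x * K ≤ i + 1 := by
  have hK' : (0 : ℝ) < K := by exact_mod_cast hK
  obtain ⟨i, hi, h⟩ := exists_cell hK hx
  rw [mul_one_div, mul_one_div, div_le_iff₀ hK', le_div_iff₀ hK'] at h
  exact ⟨i, hi, h⟩

lemma cellCorner_mem_of_le {K i j i' j' : ℕ} (hK : 0 < K) {X : Set (ℝ × ℝ)} (hX : IsDn X)
    (h : cellCorner K i j ∈ X) (hi : i' ≤ i) (hj : j ≤ j') (hj' : j' < K) :
    cellCorner K i' j' ∈ X := by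
  have hK' : (0 : ℝ) < K := by exact_mod_cast hK
  have hi' : (i' : ℝ) ≤ i := by exact_mod_cast hi
  have hj2 : (j : ℝ) ≤ j' := by exact_mod_cast hj
  refine hX.mono h ?_ (by positivity) ?_ ?_
  · gcongr
  · gcongr
  · rw [div_le_one hK']; exact_mod_cast hj'

lemma isDn_gridHull {K : ℕ} (hK : 0 < K) {X : Set (ℝ × ℝ)} (hX : IsDn X) :
    IsDn (gridHull (1 / K) X) where
  sub := gridHull_subset X
  mono {B p B' p'} hx h1 h2 h3 h4 := by
    have hsq := gridHull_subset X hx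
    have hK' : (0 : ℝ) < K := by exact_mod_cast hK
    rw [mem_gridHull hK hX] at hx ⊢
    obtain ⟨i, hi, j, hj, hc, hx⟩ := hx
    rw [mem_gridCell hK] at hx
    obtain ⟨i', hi', hb⟩ := exists_cell' hK (x := B') ⟨h2, h1.trans hsq.1.2⟩
    obtain ⟨j', hj', hp⟩ := exists_cell' hK (x := p') ⟨hsq.2.1.trans h3, h4⟩
    have e1 : B' * K ≤ B * K := mul_le_mul_of_nonneg_right h1 hK'.le
    have e2 : p * K ≤ p' * K := mul_le_mul_of_nonneg_right h3 hK'.le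
    dsimp only at hx
    refine ⟨min i i', by omega, max j j', by omega,
      cellCorner_mem_of_le hK hX hc (min_le_left _ _) (le_max_left _ _) (by omega), ?_⟩
    rw [mem_gridCell hK]
    dsimp only
    rcases le_total i i' with hii | hii
    · rw [min_eq_left hii]
      have : (i : ℝ) ≤ i' := by exact_mod_cast hii
      rcases le_total j j' with hjj | hjj
      · rw [max_eq_right hjj]
        exact ⟨⟨by linarith, by linarith⟩, hp⟩
      · rw [max_eq_left hjj]
        have : (j' : ℝ) ≤ j := by exact_mod_cast hjj
        exact ⟨⟨by linarith, by linarith⟩, by linarith, by linarith⟩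
    · rw [min_eq_right hii]
      rcases le_total j j' with hjj | hjj
      · rw [max_eq_right hjj]
        exact ⟨hb, hp⟩
      · rw [max_eq_left hjj]
        have : (j' : ℝ) ≤ j := by exact_mod_cast hjj
        exact ⟨hb, by linarith, by linarith⟩
  top hB := subset_gridHull hK hX.sub (hX.top hB)
  left hp := subset_gridHull hK hX.sub (hX.left hp)

lemma isDn_sval0 {V : Type*} [Fintype V] {T : Set V} (v : V) : IsDn (sval0 T v) := by
  refine IsUp.isDn ?_
  rw [sval0_eq, reflect_reflect]
  exact isUp_rval0 v

lemma isDn_absSval {V : Type*} [Fintype V] {M : MDP V} {T : Set V} {K : ℕ} (hK : 0 < K) (t : ℕ)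
    (v : V) : IsDn (absSval M T (1 / K) t v) := by
  induction t generalizing v with
  | zero => exact isDn_gridHull hK (isDn_sval0 v)
  | succ t ih => exact isDn_gridHull hK (isDn_bellman ih)

/-- The lower boundary `m` (lowest row of every column) and the right boundary `c` (number of
columns of every row) of a monotone region of cells. -/
structure Boundary (K : ℕ) (m c : ℕ → ℕ) : Prop where
  mono : ∀ {i i'}, i ≤ i' → i' < K → m i ≤ m i'
  zero : m 0 = 0
  lt : ∀ {i}, i < K → m i < K
  adj : ∀ {i j}, i < K → j < K → (m i ≤ j ↔ i < c j)
  le : ∀ {j}, j < K → c j ≤ K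

lemma Boundary.pos {K : ℕ} {m c : ℕ → ℕ} (h : Boundary K m c) {j : ℕ} (hj : j < K) : 0 < c j :=
  (h.adj (by omega) hj).1 (by simp [h.zero])

lemma Boundary.c_mono {K : ℕ} {m c : ℕ → ℕ} (h : Boundary K m c) {j j' : ℕ} (hj : j ≤ j')
    (hj' : j' < K) : c j ≤ c j' := by
  by_contra hcon
  have h1 := h.le (hj.trans_lt hj')
  have h2 := (h.adj (by omega : c j' < K) (hj.trans_lt hj')).2 (by omega)
  have h3 := (h.adj (by omega : c j' < K) hj').1 (h2.trans hj)
  omega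

lemma Boundary.c_last {K : ℕ} {m c : ℕ → ℕ} (h : Boundary K m c) (hK : 0 < K) :
    c (K - 1) = K := by
  have h1 := h.le (by omega : K - 1 < K)
  have h2 := (h.adj (by omega : K - 1 < K) (by omega : K - 1 < K)).1
    (by have := h.lt (by omega : K - 1 < K); omega)
  omega

/-- The region `X` consists of the cells with boundary `m`. -/
def IsCells (K : ℕ) (m : ℕ → ℕ) (X : Set (ℝ × ℝ)) : Prop :=
  ∀ x, x ∈ X ↔ ∃ i < K, ∃ j < K, m i ≤ j ∧ x ∈ gridCell (1 / K) i j

lemma isCells_gridHull {K : ℕ} (hK : 0 < K) {m : ℕ → ℕ} {X : Set (ℝ × ℝ)} (hX : IsDn X)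
    (h : ∀ i < K, ∀ j < K, cellCorner K i j ∈ X ↔ m i ≤ j) : IsCells K m (gridHull (1 / K) X) := by
  intro x
  rw [mem_gridHull hK hX]
  constructor
  · rintro ⟨i, hi, j, hj, h1, h2⟩
    exact ⟨i, hi, j, hj, (h i hi j hj).1 h1, h2⟩
  · rintro ⟨i, hi, j, hj, h1, h2⟩
    exact ⟨i, hi, j, hj, (h i hi j hj).2 h1, h2⟩

/-- The line of budget `i / K` bounds the columns `i - 1` and `i`, and the left one reaches lower.
For `i = 0` truncated subtraction gives column `0`, as it should. -/
lemma IsCells.mem_column {K : ℕ} (hK : 0 < K) {m c : ℕ → ℕ} (hb : Boundary K m c)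
    {X : Set (ℝ × ℝ)} (hX : IsCells K m X) {i : ℕ} (hi : i ≤ K) {p : ℝ} (hp : p ∈ Icc (0 : ℝ) 1) :
    ((i : ℝ) / K, p) ∈ X ↔ (m (i - 1) : ℝ) / K ≤ p := by
  have hK' : (0 : ℝ) < K := by exact_mod_cast hK
  rw [hX, div_le_iff₀ hK']
  simp only [mem_gridCell hK, div_mul_cancel₀ _ hK'.ne']
  constructor
  · rintro ⟨i', hi', j', hj', h1, ⟨h2, h3⟩, h4, h5⟩
    have h6 : i ≤ i' + 1 := by exact_mod_cast h3
    have h7 : m (i - 1) ≤ j' := (hb.mono (by omega) hi').trans h1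
    have h8 : (m (i - 1) : ℝ) ≤ j' := by exact_mod_cast h7
    linarith
  · intro h
    obtain ⟨j, hj, h1, h2⟩ := exists_cell' hK hp
    have h3 := hb.lt (by omega : i - 1 < K)
    refine ⟨i - 1, by omega, max (m (i - 1)) j, by omega, le_max_left _ _, ⟨?_, ?_⟩, ?_, ?_⟩
    · exact_mod_cast Nat.sub_le i 1
    · exact_mod_cast (by omega : i ≤ i - 1 + 1)
    · push_cast; exact max_le h h1
    · push_cast
      have := le_max_right (m (i - 1) : ℝ) j
      linarith

/-- Of the rows adjacent to the height `j / K` the upper one extends further right; at the top edge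
only row `K - 1` is left. -/
lemma IsCells.mem_row {K : ℕ} (hK : 0 < K) {m c : ℕ → ℕ} (hb : Boundary K m c)
    {X : Set (ℝ × ℝ)} (hX : IsCells K m X) {j : ℕ} (hj : j ≤ K) {b : ℝ} (hb' : b ∈ Icc (0 : ℝ) 1) :
    (b, (j : ℝ) / K) ∈ X ↔ b ≤ (c (min j (K - 1)) : ℝ) / K := by
  have hK' : (0 : ℝ) < K := by exact_mod_cast hK
  rw [hX, le_div_iff₀ hK']
  simp only [mem_gridCell hK, div_mul_cancel₀ _ hK'.ne']
  constructor
  · rintro ⟨i', hi', j', hj', h1, ⟨h2, h3⟩, h4, h5⟩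
    have h6 : j' ≤ j := by exact_mod_cast h4
    have h7 := (hb.adj hi' hj').1 h1
    have h8 := hb.c_mono (by omega : j' ≤ min j (K - 1)) (by omega)
    have h9 : ((i' : ℝ) + 1) ≤ c (min j (K - 1)) := by exact_mod_cast (by omega)
    linarith
  · intro h
    obtain ⟨i, hi, h1, h2⟩ := exists_cell' hK hb'
    have hj' : min j (K - 1) < K := by omega
    have h3 := hb.pos hj'
    have h4 := hb.le hj'
    refine ⟨min i (c (min j (K - 1)) - 1), by omega, min j (K - 1), hj',
      (hb.adj (by omega) hj').2 (by omega), ⟨?_, ?_⟩, ?_, ?_⟩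
    · push_cast; exact (min_le_left _ _).trans h1
    · have h5 : b * K ≤ ((c (min j (K - 1)) - 1 : ℕ) : ℝ) + 1 := by
        refine h.trans ?_
        exact_mod_cast (by omega : c (min j (K - 1)) ≤ c (min j (K - 1)) - 1 + 1)
      push_cast
      rw [← min_add_add_right]
      exact le_min h2 h5
    · exact_mod_cast min_le_left j (K - 1)
    · exact_mod_cast (by omega : j ≤ min j (K - 1) + 1)

/-- The number of indices at which the value is at most `j`. -/
def conj (K : ℕ) (f : ℕ → ℕ) (j : ℕ) : ℕ := ((Finset.range K).filter fun i => f i ≤ j).card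

lemma conj_le (K : ℕ) (f : ℕ → ℕ) (j : ℕ) : conj K f j ≤ K :=
  (Finset.card_filter_le (Finset.range K) fun i => f i ≤ j).trans_eq (Finset.card_range K)

/-- For monotone `f` the counted indices form an initial segment of length `conj K f j`. -/
lemma lt_conj {K : ℕ} {f : ℕ → ℕ} (hf : ∀ i i', i ≤ i' → i' < K → f i ≤ f i') {i j : ℕ}
    (hi : i < K) : i < conj K f j ↔ f i ≤ j := by
  constructor
  · intro h
    by_contra hcon
    have : (Finset.range K).filter (fun i => f i ≤ j) ⊆ Finset.range i := fun k hk => by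
      simp only [Finset.mem_filter, Finset.mem_range] at hk ⊢
      by_contra hki
      have := hf i k (by omega) hk.1
      omega
    have := Finset.card_le_card this
    rw [Finset.card_range] at this
    unfold conj at h
    omega
  · intro h
    have : Finset.range (i + 1) ⊆ (Finset.range K).filter (fun i => f i ≤ j) := fun k hk => by
      simp only [Finset.mem_filter, Finset.mem_range] at hk ⊢
      have := hf k i (by omega) hi
      omega
    have := Finset.card_le_card this
    rw [Finset.card_range] at this
    exact this

lemma boundary_conj {K : ℕ} {m : ℕ → ℕ} (h1 : ∀ i i', i ≤ i' → i' < K → m i ≤ m i')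
    (h2 : m 0 = 0) (h3 : ∀ i < K, m i < K) : Boundary K m (conj K m) where
  mono := h1 _ _
  zero := h2
  lt := h3 _
  adj hi _ := (lt_conj h1 hi).symm
  le _ := conj_le _ _ _

/-- Here the right boundary is given. That every row is nonempty and the last one full makes the
conjugate start at `0` and stay below `K`. -/
lemma boundary_conj' {K : ℕ} (hK : 0 < K) {c : ℕ → ℕ} (h1 : ∀ j j', j ≤ j' → j' < K → c j ≤ c j')
    (h2 : c (K - 1) = K) (h3 : ∀ j < K, 0 < c j) : Boundary K (conj K c) c where
  mono {i i'} h _ := Finset.card_le_card fun k hk => by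
    simp only [Finset.mem_filter, Finset.mem_range] at hk ⊢
    omega
  zero := by
    rw [conj, Finset.card_eq_zero, Finset.filter_eq_empty_iff]
    intro j hj
    have := h3 j (Finset.mem_range.1 hj)
    omega
  lt {i} hi := by
    by_contra hcon
    have := (lt_conj h1 (by omega : K - 1 < K) (j := i)).1 (by omega)
    omega
  adj {i j} hi hj := by
    have := lt_conj h1 hj (j := i)
    omega
  le {j} hj := by
    have := h1 j (K - 1) (by omega) (by omega)
    omega

/-- At budget `i / K` the least admissible probability of a successor is its lower boundary in
column `i - 1`, so only the mean of these matters. -/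
lemma cellCorner_mem_bellman_rand {V : Type*} [Fintype V] {M : MDP V} {v : V} (hv : v ∉ M.ctrl)
    {K : ℕ} (hK : 0 < K) {m c : V → ℕ → ℕ} {X : V → Set (ℝ × ℝ)} (hb : ∀ w, Boundary K (m w) (c w))
    (hX : ∀ w, IsCells K (m w) (X w)) (hdn : ∀ w, IsDn (X w)) {i j : ℕ} (hi : i < K) (hj : j < K) :
    cellCorner K i j ∈ bellman M v X ↔ ∑ w, M.δ v w * m w (i - 1) ≤ j + 1 := by
  have hK' : (0 : ℝ) < K := by exact_mod_cast hK
  have e : ∑ w, M.δ v w * ((m w (i - 1) : ℝ) / K) = (∑ w, M.δ v w * m w (i - 1)) / K := by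
    rw [Finset.sum_div]; simp only [mul_div_assoc]
  rw [← div_le_div_iff_of_pos_right hK', ← e]
  have hiI : (i : ℝ) / K ∈ Icc (0 : ℝ) 1 :=
    ⟨by positivity, by rw [div_le_one hK']; exact_mod_cast hi.le⟩
  constructor
  · intro h
    obtain ⟨-, q, h1, h2⟩ := (mem_bellman_rand hv).1 h
    refine (weighted_le hv fun w hw => ?_).trans_eq h2.symm
    have h3 := h1 w hw
    exact ((hX w).mem_column hK (hb w) hi.le ((hdn w).sub h3).2).1 h3
  · intro h
    refine (isDn_bellman hdn).mono (B := (i : ℝ) / K)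
      (p := ∑ w, M.δ v w * ((m w (i - 1) : ℝ) / K)) ((mem_bellman_rand hv).2 ⟨hiI, _, fun w _ =>
      ((hX w).mem_column hK (hb w) hi.le ?_).2 le_rfl, rfl⟩) le_rfl hiI.1 h ?_
    · have := (hb w).lt (by omega : i - 1 < K)
      exact ⟨by positivity, by rw [div_le_one hK']; exact_mod_cast this.le⟩
    · rw [div_le_one hK']; exact_mod_cast hj

/-- At height `(j + 1) / K` the largest budgets are the right boundaries. The best midpoint takes
their minimum for all successors and their maximum for one of them. -/
lemma cellCorner_mem_bellman_ctrl {V : Type*} [Fintype V] {M : MDP V} {v : V} (hv : v ∈ M.ctrl)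
    {K : ℕ} (hK : 0 < K) {m c : V → ℕ → ℕ} {X : V → Set (ℝ × ℝ)} (hb : ∀ w, Boundary K (m w) (c w))
    (hX : ∀ w, IsCells K (m w) (X w)) (hdn : ∀ w, IsDn (X w)) {i j lo hi : ℕ} (_ : i < K)
    (hj : j < K) (hlo : ∀ w ∈ M.succ v, lo ≤ c w (min (j + 1) (K - 1)))
    (hlo' : ∃ w ∈ M.succ v, lo = c w (min (j + 1) (K - 1)))
    (hhi : ∀ w ∈ M.succ v, c w (min (j + 1) (K - 1)) ≤ hi)
    (hhi' : ∃ w ∈ M.succ v, hi = c w (min (j + 1) (K - 1))) :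
    cellCorner K i j ∈ bellman M v X ↔ 2 * i ≤ lo + hi := by
  have hK' : (0 : ℝ) < K := by exact_mod_cast hK
  have hpI : ((j + 1 : ℕ) : ℝ) / K ∈ Icc (0 : ℝ) 1 :=
    ⟨by positivity, by rw [div_le_one hK']; exact_mod_cast hj⟩
  have hc : cellCorner K i j = ((i : ℝ) / K, ((j + 1 : ℕ) : ℝ) / K) := by
    simp [cellCorner]
  have hrow : ∀ w b, (b, ((j + 1 : ℕ) : ℝ) / K) ∈ X w → b ≤ (c w (min (j + 1) (K - 1)) : ℝ) / K :=
    fun w b h => ((hX w).mem_row hK (hb w) (by omega) ((hdn w).sub h).1).1 h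
  have hrow' : ∀ w k, k ≤ c w (min (j + 1) (K - 1)) →
      ((k : ℝ) / K, ((j + 1 : ℕ) : ℝ) / K) ∈ X w := fun w k hk => by
    have h1 := (hb w).le (by omega : min (j + 1) (K - 1) < K)
    refine ((hX w).mem_row hK (hb w) (by omega) ⟨by positivity, ?_⟩).2 ?_
    · rw [div_le_one hK']; exact_mod_cast hk.trans h1
    · gcongr
  rw [hc]
  constructor
  · intro h
    obtain ⟨-, b, b', h1, ⟨w, hw, h2⟩, h3⟩ := (mem_bellman_ctrl hv).1 h
    dsimp only at h1 h2 h3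
    obtain ⟨w', hw', e⟩ := hlo'
    have h4 := hrow w _ h2
    have h5 := hrow w' _ (h3 w' hw')
    rw [← e] at h5
    have h6 : (c w (min (j + 1) (K - 1)) : ℝ) / K ≤ (hi : ℝ) / K := by
      have : (c w (min (j + 1) (K - 1)) : ℝ) ≤ hi := by exact_mod_cast hhi w hw
      gcongr
    have h7 : (2 * i : ℝ) / K ≤ (lo + hi) / K := by
      rw [add_div, mul_div_assoc]; linarith
    rw [div_le_div_iff_of_pos_right hK'] at h7
    exact_mod_cast h7
  · intro h
    obtain ⟨w', hw', e⟩ := hhi'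
    refine (isDn_bellman hdn).mono (B := ((lo : ℝ) / K + (hi : ℝ) / K) / 2)
      (p := ((j + 1 : ℕ) : ℝ) / K) ((mem_bellman_ctrl hv).2 ⟨hpI, _, _, rfl,
      ⟨w', hw', hrow' w' hi e.le⟩, fun w hw => hrow' w lo (hlo w hw)⟩) ?_ (by positivity) le_rfl
      hpI.2
    have h7 : (2 * i : ℝ) ≤ lo + hi := by exact_mod_cast h
    rw [← add_div, div_div, div_le_div_iff₀ hK' (by positivity)]
    nlinarith

/-! ### The iteration on natural numbers -/

/-- The data of an instance that value iteration depends on, as functions on natural numbers. -/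
structure GridData where
  N : ℕ
  ctl : ℕ → ℕ
  tgt : ℕ → ℕ
  ed : ℕ → ℕ → ℕ
  num : ℕ → ℕ → ℕ
  den : ℕ → ℕ → ℕ

namespace GridData

variable (G : GridData)

/-- The common denominator of the probabilities of the first successors. -/
def sumDen (u : ℕ) : ℕ → ℕ
  | 0 => 1
  | w + 1 => sumDen u w * G.den u w

/-- The numerator of the weighted sum of the lower boundaries over the first successors. -/
def sumNum (m : ℕ → ℕ → ℕ) (u i : ℕ) : ℕ → ℕ
  | 0 => 0
  | w + 1 => sumNum m u i w * G.den u w + m w i * G.num u w * G.sumDen u w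

/-- The minimum of the right boundaries over the first successors. -/
def lo (K : ℕ) (c : ℕ → ℕ → ℕ) (u j : ℕ) : ℕ → ℕ
  | 0 => K
  | w + 1 => if G.ed u w = 0 then lo K c u j w else min (lo K c u j w) (c w j)

/-- The maximum of the right boundaries over the first successors. -/
def hi (c : ℕ → ℕ → ℕ) (u j : ℕ) : ℕ → ℕ
  | 0 => 0
  | w + 1 => if G.ed u w = 0 then hi c u j w else max (hi c u j w) (c w j)

/-- The new lower boundary at a random vertex. -/
def randRow (m : ℕ → ℕ → ℕ) (u i : ℕ) : ℕ :=
  (G.sumNum m u (i - 1) G.N - 1) / G.sumDen u G.N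

/-- The new right boundary at a control vertex. -/
def ctrlRow (K : ℕ) (c : ℕ → ℕ → ℕ) (u j : ℕ) : ℕ :=
  min K ((G.lo K c u (min (j + 1) (K - 1)) G.N + G.hi c u (min (j + 1) (K - 1)) G.N) / 2 + 1)

/-- The initial lower boundary. -/
def initRow (K : ℕ) (u i : ℕ) : ℕ := if G.tgt u = 0 ∨ i = 0 then 0 else K - 1

/-- The lower and the right boundaries of the abstract values. -/
def iter (K : ℕ) : ℕ → (ℕ → ℕ → ℕ) × (ℕ → ℕ → ℕ)
  | 0 => (G.initRow K, fun u => conj K (G.initRow K u))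
  | t + 1 =>
    (fun u => if G.ctl u = 0 then G.randRow (iter K t).1 u
      else conj K (G.ctrlRow K (iter K t).2 u),
    fun u => if G.ctl u = 0 then conj K (G.randRow (iter K t).1 u)
      else G.ctrlRow K (iter K t).2 u)

lemma lo_le {K : ℕ} {c : ℕ → ℕ → ℕ} {u j w n : ℕ} (hw : w < n) (he : G.ed u w ≠ 0) :
    G.lo K c u j n ≤ c w j := by
  induction n with
  | zero => omega
  | succ n ih =>
    rw [lo]
    rcases Nat.lt_succ_iff_lt_or_eq.1 hw with h | rfl
    · split_ifs
      · exact ih h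
      · exact (min_le_left _ _).trans (ih h)
    · rw [if_neg he]; exact min_le_right _ _

lemma le_hi {c : ℕ → ℕ → ℕ} {u j w n : ℕ} (hw : w < n) (he : G.ed u w ≠ 0) :
    c w j ≤ G.hi c u j n := by
  induction n with
  | zero => omega
  | succ n ih =>
    rw [hi]
    rcases Nat.lt_succ_iff_lt_or_eq.1 hw with h | rfl
    · split_ifs
      · exact ih h
      · exact (ih h).trans (le_max_left _ _)
    · rw [if_neg he]; exact le_max_right _ _

lemma lo_eq {K : ℕ} {c : ℕ → ℕ → ℕ} {u j : ℕ} (n : ℕ) :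
    G.lo K c u j n = K ∨ ∃ w < n, G.ed u w ≠ 0 ∧ G.lo K c u j n = c w j := by
  induction n with
  | zero => exact Or.inl rfl
  | succ n ih =>
    rw [lo]
    split_ifs with he
    · rcases ih with h | ⟨w, hw, h⟩
      · exact Or.inl h
      · exact Or.inr ⟨w, by omega, h⟩
    · rcases min_choice (G.lo K c u j n) (c n j) with h | h <;> rw [h]
      · rcases ih with h | ⟨w, hw, h⟩
        · exact Or.inl h
        · exact Or.inr ⟨w, by omega, h⟩
      · exact Or.inr ⟨n, by omega, he, rfl⟩

lemma hi_eq {c : ℕ → ℕ → ℕ} {u j : ℕ} (n : ℕ) :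
    G.hi c u j n = 0 ∨ ∃ w < n, G.ed u w ≠ 0 ∧ G.hi c u j n = c w j := by
  induction n with
  | zero => exact Or.inl rfl
  | succ n ih =>
    rw [hi]
    split_ifs with he
    · rcases ih with h | ⟨w, hw, h⟩
      · exact Or.inl h
      · exact Or.inr ⟨w, by omega, h⟩
    · rcases max_choice (G.hi c u j n) (c n j) with h | h <;> rw [h]
      · rcases ih with h | ⟨w, hw, h⟩
        · exact Or.inl h
        · exact Or.inr ⟨w, by omega, h⟩
      · exact Or.inr ⟨n, by omega, he, rfl⟩

lemma sumDen_pos {u : ℕ} {n : ℕ} (h : ∀ w < n, 0 < G.den u w) : 0 < G.sumDen u n := by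
  induction n with
  | zero => exact Nat.one_pos
  | succ n ih => exact Nat.mul_pos (ih fun w hw => h w (by omega)) (h n (by omega))

lemma sum_eq {m : ℕ → ℕ → ℕ} {u i n : ℕ} (h : ∀ w < n, 0 < G.den u w) :
    ∑ w ∈ Finset.range n, (G.num u w : ℝ) / G.den u w * m w i =
      (G.sumNum m u i n : ℝ) / G.sumDen u n := by
  induction n with
  | zero => simp [sumNum]
  | succ n ih =>
    have h1 : (0 : ℝ) < G.den u n := by exact_mod_cast h n (by omega)
    have h2 : (0 : ℝ) < G.sumDen u n := by
      exact_mod_cast G.sumDen_pos fun w hw => h w (by omega)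
    rw [Finset.sum_range_succ, ih fun w hw => h w (by omega), sumNum, sumDen]
    push_cast
    field_simp

/-- `(x - 1) / d` is the ceiling of `x / d` minus one for `x > 0`, hence the least `j` with `x ≤ (j
+ 1) d`. For `x = 0` truncation gives the correct value `0`. -/
lemma randRow_le_iff {m : ℕ → ℕ → ℕ} {u i j : ℕ} (h : ∀ w < G.N, 0 < G.den u w) :
    G.randRow m u i ≤ j ↔
      ∑ w ∈ Finset.range G.N, (G.num u w : ℝ) / G.den u w * m w (i - 1) ≤ j + 1 := by
  have hd := G.sumDen_pos h
  have hd' : (0 : ℝ) < G.sumDen u G.N := by exact_mod_cast hd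
  rw [G.sum_eq h, div_le_iff₀ hd', randRow, ← Nat.lt_succ_iff, Nat.div_lt_iff_lt_mul hd]
  have : (G.sumNum m u (i - 1) G.N : ℝ) ≤ (j + 1) * G.sumDen u G.N ↔
      G.sumNum m u (i - 1) G.N ≤ (j + 1) * G.sumDen u G.N := by exact_mod_cast Iff.rfl
  rw [this]
  have : 0 < (j + 1) * G.sumDen u G.N := Nat.mul_pos (by omega) hd
  rw [Nat.succ_eq_add_one]
  omega

end GridData

/-! ### Reading instances off their encodings; abstract values as staircases. -/

namespace RatInstance

variable (I : RatInstance)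

/-- The encoding as the initial contents of the memory. -/
def input (a : ℕ) : ℕ := I.encode.getD a 0

/-- The data of the instance, read off from the encoding. -/
def data : GridData where
  N := I.N
  ctl u := I.input (6 + 2 * u)
  tgt u := I.input (6 + 2 * u + 1)
  ed u w := I.input (6 + 2 * I.N + 3 * (u * I.N + w))
  num u w := I.input (6 + 2 * I.N + 3 * (u * I.N + w) + 1)
  den u w := I.input (6 + 2 * I.N + 3 * (u * I.N + w) + 2)

lemma getD_flatMap {α : Type*} {f : α → List ℕ} {L : ℕ} (hL : ∀ a, (f a).length = L) (l : List α)
    {i k : ℕ} (hi : i < l.length) (hk : k < L) :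
    (l.flatMap f).getD (L * i + k) 0 = (f l[i]).getD k 0 := by
  induction l generalizing i with
  | nil => simp at hi
  | cons a l ih =>
    rw [List.flatMap_cons]
    cases i with
    | zero => rw [Nat.mul_zero, Nat.zero_add, List.getD_append _ _ _ _ (by rw [hL]; exact hk)]; rfl
    | succ i =>
      rw [List.getD_append_right _ _ _ _ (by rw [hL]; nlinarith), hL]
      have : L * (i + 1) + k - L = L * i + k := by rw [Nat.mul_succ]; omega
      rw [this, ih (by simpa using hi)]
      rfl

lemma length_flatMap {α : Type*} {f : α → List ℕ} {L : ℕ} (hL : ∀ a, (f a).length = L)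
    (l : List α) : (l.flatMap f).length = L * l.length := by
  induction l with
  | nil => simp
  | cons a l ih => rw [List.flatMap_cons, List.length_append, ih, hL, List.length_cons]; ring

/-- The part of the encoding that describes the vertices. -/
def encV : List ℕ := (List.finRange I.N).flatMap (fun u => [(I.ctrl u).toNat, (I.tgt u).toNat])

/-- The part of the encoding that describes the transitions. -/
def encE : List ℕ := (List.finRange I.N).flatMap fun u => (List.finRange I.N).flatMap fun w =>
      [(I.edge u w).toNat, (I.δ u w).num, (I.δ u w).den]

lemma encode_eq : I.encode = [I.N, I.v.1, I.B.num, I.B.den, I.p.num, I.p.den] ++ I.encV ++ I.encE :=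
  rfl

lemma length_encV : I.encV.length = 2 * I.N := by
  rw [encV, length_flatMap (L := 2) (fun _ => rfl), List.length_finRange]

lemma length_row (u : Fin I.N) : ((List.finRange I.N).flatMap fun w =>
      [(I.edge u w).toNat, (I.δ u w).num, (I.δ u w).den]).length = 3 * I.N := by
  rw [length_flatMap (L := 3) (fun _ => rfl), List.length_finRange]

lemma length_encE : I.encE.length = 3 * I.N * I.N := by
  rw [encE, length_flatMap (L := 3 * I.N) (fun u => I.length_row u), List.length_finRange]

lemma length_encode : I.encode.length = 6 + 2 * I.N + 3 * I.N * I.N := by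
  rw [encode_eq, List.length_append, List.length_append, length_encV, length_encE]
  rfl

lemma input_header {k : ℕ} (hk : k < 6) :
    I.input k = [I.N, I.v.1, I.B.num, I.B.den, I.p.num, I.p.den].getD k 0 := by
  rw [input, encode_eq, List.append_assoc, List.getD_append _ _ _ _ (by simpa using hk)]

lemma input_vertex (u : Fin I.N) {k : ℕ} (hk : k < 2) :
    I.input (6 + 2 * u + k) = [(I.ctrl u).toNat, (I.tgt u).toNat].getD k 0 := by
  have h := u.2
  rw [input, encode_eq, List.getD_append _ _ _ _ (by
    rw [List.length_append, length_encV]; simp only [List.length_cons, List.length_nil]; omega),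
    List.getD_append_right _ _ _ _ (by simp only [List.length_cons, List.length_nil]; omega)]
  have e : 6 + 2 * u.1 + k -
      [I.N, I.v.1, I.B.num, I.B.den, I.p.num, I.p.den].length = 2 * u.1 + k := by
    simp only [List.length_cons, List.length_nil]; omega
  rw [e, encV, getD_flatMap (L := 2) (fun _ => rfl) _ (by simp) hk]
  simp

lemma input_edge (u w : Fin I.N) {k : ℕ} (hk : k < 3) :
    I.input (6 + 2 * I.N + 3 * (u * I.N + w) + k) =
      [(I.edge u w).toNat, (I.δ u w).num, (I.δ u w).den].getD k 0 := by
  have h := u.2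
  have h' := w.2
  rw [input, encode_eq, List.getD_append_right _ _ _ _ (by
    rw [List.length_append, length_encV]; simp only [List.length_cons, List.length_nil]; omega),
    List.length_append, length_encV]
  have e : 6 + 2 * I.N + 3 * (u.1 * I.N + w.1) + k -
      ([I.N, I.v.1, I.B.num, I.B.den, I.p.num, I.p.den].length + 2 * I.N) =
      3 * I.N * u.1 + (3 * w.1 + k) := by
    simp only [List.length_cons, List.length_nil]
    have : 3 * (u.1 * I.N + w.1) = 3 * I.N * u.1 + 3 * w.1 := by ring
    omega
  rw [e, encE, getD_flatMap (L := 3 * I.N) (fun u => I.length_row u) _ (by simp) (by omega),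
    getD_flatMap (L := 3) (fun _ => rfl) _ (by simp) hk]
  simp

lemma data_ctl (u : Fin I.N) : I.data.ctl u = (I.ctrl u).toNat := I.input_vertex u (k := 0) (by omega)
lemma data_tgt (u : Fin I.N) : I.data.tgt u = (I.tgt u).toNat := I.input_vertex u (k := 1) (by omega)
lemma data_ed (u w : Fin I.N) : I.data.ed u w = (I.edge u w).toNat :=
  I.input_edge u w (k := 0) (by omega)
lemma data_num (u w : Fin I.N) : I.data.num u w = (I.δ u w).num :=
  I.input_edge u w (k := 1) (by omega)
lemma data_den (u w : Fin I.N) : I.data.den u w = (I.δ u w).den :=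
  I.input_edge u w (k := 2) (by omega)

lemma data_den_pos (u : Fin I.N) : ∀ w < I.N, 0 < I.data.den u w := fun w hw => by
  have := I.data_den u ⟨w, hw⟩
  rw [show I.data.den u w = (I.δ u ⟨w, hw⟩).den from this]
  exact (I.δ u ⟨w, hw⟩).den_pos

lemma data_sum (u : Fin I.N) (f : ℕ → ℕ) :
    ∑ w ∈ Finset.range I.N, (I.data.num u w : ℝ) / I.data.den u w * f w =
      ∑ w : Fin I.N, I.toMDP.δ u w * f w := by
  rw [Finset.sum_range]
  refine Finset.sum_congr rfl fun w _ => ?_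
  rw [data_num, data_den]
  congr 1
  change _ = ((I.δ u w : ℚ≥0) : ℝ)
  rw [NNRat.cast_def]

/-- Induction on the horizon: a hull is determined by the corners of its cells. At a control vertex
the criterion for corners is a bound on the column for each row, at a random vertex a bound on the
row for each column; conjugation supplies the other boundary. -/
theorem absSval_isCells {K : ℕ} (hK : 0 < K) (t : ℕ) (u : Fin I.N) :
    Boundary K ((I.data.iter K t).1 u) ((I.data.iter K t).2 u) ∧
      IsCells K ((I.data.iter K t).1 u)
        (absSval I.toMDP {u | I.tgt u = true} (1 / K) t u) := by
  have hK' : (0 : ℝ) < K := by exact_mod_cast hK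
  induction t generalizing u with
  | zero =>
    constructor
    · refine boundary_conj (fun i i' h1 h2 => ?_) ?_ fun i hi => ?_
      · simp only [GridData.iter, GridData.initRow]
        split_ifs <;> omega
      · simp [GridData.iter, GridData.initRow]
      · simp only [GridData.iter, GridData.initRow]
        split_ifs <;> omega
    · refine isCells_gridHull hK (isDn_sval0 u) fun i hi j hj => ?_
      have e1 : ((j : ℝ) + 1) / K = 1 ↔ j + 1 = K := by
        rw [div_eq_one_iff_eq hK'.ne']; exact_mod_cast Iff.rfl
      have e2 : (i : ℝ) / K = 0 ↔ i = 0 := by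
        rw [div_eq_zero_iff, or_iff_left hK'.ne']; exact_mod_cast Iff.rfl
      have hsq : cellCorner K i j ∈ unitSquare :=
        ⟨⟨div_nonneg (by positivity) hK'.le, (div_le_one hK').2 (by exact_mod_cast hi.le)⟩,
          div_nonneg (by positivity) hK'.le, (div_le_one hK').2 (by exact_mod_cast hj)⟩
      rw [cellCorner] at hsq ⊢
      rw [mem_sval0, e1, e2]
      simp only [hsq, true_and, GridData.iter, GridData.initRow, data_tgt, mem_ofPred_eq]
      cases I.tgt u <;> simp
      split_ifs <;> omega
  | succ t ih =>
    have hdn : ∀ w, IsDn (absSval I.toMDP {u | I.tgt u = true} (1 / K) t w) := isDn_absSval hK t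
    by_cases hu : I.ctrl u = true
    · have hc : I.data.ctl u ≠ 0 := by rw [data_ctl, hu]; simp
      have hv : u ∈ I.toMDP.ctrl := hu
      have hsucc : ∀ w : Fin I.N, w ∈ I.toMDP.succ u ↔ I.data.ed u w ≠ 0 := fun w => by
        rw [MDP.succ_ctrl hv, data_ed]
        change I.edge u w = true ↔ _
        cases I.edge u w <;> simp
      obtain ⟨w₀, hw₀⟩ := I.edge_nonempty u hu
      have hw₀ : I.data.ed u w₀ ≠ 0 := by rw [data_ed, hw₀]; simp
      set c := (I.data.iter K t).2
      have hlo : ∀ j < K, ∃ w : Fin I.N, I.data.ed u w ≠ 0 ∧ I.data.lo K c u j I.N = c w j := by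
        intro j hj
        rcases I.data.lo_eq (K := K) (c := c) (u := u) (j := j) I.N with h | ⟨w, hw, h1, h2⟩
        -- If the minimum still has its default value `K`, it is attained at any successor, because
        -- right boundaries are at most `K`.
        · refine ⟨w₀, hw₀, le_antisymm (I.data.lo_le w₀.2 hw₀) ?_⟩
          rw [h]; exact (ih w₀).1.le hj
        · exact ⟨⟨w, hw⟩, h1, h2⟩
      have hhi : ∀ j < K, ∃ w : Fin I.N, I.data.ed u w ≠ 0 ∧ I.data.hi c u j I.N = c w j := by
        intro j hj
        rcases I.data.hi_eq (c := c) (u := u) (j := j) I.N with h | ⟨w, hw, h1, h2⟩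
        · refine ⟨w₀, hw₀, le_antisymm ?_ (I.data.le_hi w₀.2 hw₀)⟩
          rw [h]; exact Nat.zero_le _
        · exact ⟨⟨w, hw⟩, h1, h2⟩
      have hrow : (I.data.iter K (t + 1)).2 u = I.data.ctrlRow K c u := if_neg hc
      have hrow1 : (I.data.iter K (t + 1)).1 u = conj K (I.data.ctrlRow K c u) := if_neg hc
      have hbd : Boundary K (conj K (I.data.ctrlRow K c u)) (I.data.ctrlRow K c u) := by
        have key : ∀ j j', j ≤ j' → j' < K → I.data.lo K c u j I.N ≤ I.data.lo K c u j' I.N ∧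
            I.data.hi c u j I.N ≤ I.data.hi c u j' I.N := by
          intro j j' h1 h2
          obtain ⟨w, hw, h3⟩ := hlo j' h2
          obtain ⟨w', hw', h4⟩ := hhi j (by omega)
          constructor
          · rw [h3]; exact (I.data.lo_le w.2 hw).trans ((ih w).1.c_mono h1 h2)
          · rw [h4]; exact ((ih w').1.c_mono h1 h2).trans (I.data.le_hi w'.2 hw')
        refine boundary_conj' hK (fun j j' h1 h2 => ?_) ?_ fun j hj => ?_
        · have := key (min (j + 1) (K - 1)) (min (j' + 1) (K - 1)) (by omega) (by omega)
          have e : I.data.N = I.N := rfl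
          simp only [GridData.ctrlRow, e]
          omega
        · obtain ⟨w, hw, h3⟩ := hlo (K - 1) (by omega)
          obtain ⟨w', hw', h4⟩ := hhi (K - 1) (by omega)
          have e : I.data.N = I.N := rfl
          have e1 : min (K - 1 + 1) (K - 1) = K - 1 := by omega
          simp only [GridData.ctrlRow, e, e1, h3, h4]
          rw [show c w (K - 1) = K from (ih w).1.c_last hK,
            show c w' (K - 1) = K from (ih w').1.c_last hK]
          omega
        · simp only [GridData.ctrlRow]; omega
      rw [hrow, hrow1]
      refine ⟨hbd, isCells_gridHull hK (isDn_bellman hdn) fun i hi j hj => ?_⟩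
      have hj' : min (j + 1) (K - 1) < K := by omega
      obtain ⟨w, hw, h3⟩ := hlo _ hj'
      obtain ⟨w', hw', h4⟩ := hhi _ hj'
      rw [cellCorner_mem_bellman_ctrl hv hK (m := fun w => (I.data.iter K t).1 w)
        (c := fun w => c w) (fun w => (ih w).1) (fun w => (ih w).2) hdn hi hj
        (fun w hw => I.data.lo_le w.2 ((hsucc w).1 hw)) ⟨w, (hsucc w).2 hw, h3⟩
        (fun w hw => I.data.le_hi w.2 ((hsucc w).1 hw)) ⟨w', (hsucc w').2 hw', h4⟩,
        hbd.adj hi hj]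
      have e : I.data.N = I.N := rfl
      simp only [GridData.ctrlRow, e]
      omega
    · have hc : I.data.ctl u = 0 := by rw [data_ctl]; simp [hu]
      have hv : u ∉ I.toMDP.ctrl := hu
      set m := (I.data.iter K t).1
      have hrow : (I.data.iter K (t + 1)).1 u = I.data.randRow m u := by
        exact if_pos hc
      have hrow1 : (I.data.iter K (t + 1)).2 u = conj K (I.data.randRow m u) := by
        exact if_pos hc
      have hiff : ∀ i j : ℕ, I.data.randRow m u i ≤ j ↔
          ∑ w : Fin I.N, I.toMDP.δ u w * m w (i - 1) ≤ (j : ℝ) + 1 := fun i j => by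
        rw [I.data.randRow_le_iff (I.data_den_pos u), ← I.data_sum u fun w => m w (i - 1)]
        rfl
      have hbd : Boundary K (I.data.randRow m u) (conj K (I.data.randRow m u)) := by
        refine boundary_conj (fun i i' h1 h2 => ?_) ?_ fun i hi => ?_
        · rw [hiff]
          refine le_trans (weighted_le hv fun w _ => ?_) ((hiff i' _).1 le_rfl)
          exact_mod_cast (ih w).1.mono (by omega) (by omega)
        · rw [← Nat.le_zero, hiff]
          have : ∀ w : Fin I.N, m w (0 - 1) = 0 := fun w => (ih w).1.zero
          simp only [this]
          simp
        · have : I.data.randRow m u i ≤ K - 1 := by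
            rw [hiff]
            refine (weighted_le hv (g := fun _ => (K : ℝ)) fun w _ => ?_).trans ?_
            · exact_mod_cast ((ih w).1.lt (by omega : i - 1 < K)).le
            · rw [weighted_const hv]; exact_mod_cast (by omega : K ≤ K - 1 + 1)
          omega
      rw [hrow, hrow1]
      refine ⟨hbd, isCells_gridHull hK (isDn_bellman hdn) fun i hi j hj => ?_⟩
      rw [cellCorner_mem_bellman_rand hv hK (m := fun w => m w)
        (c := fun w => (I.data.iter K t).2 w) (fun w => (ih w).1) (fun w => (ih w).2) hdn hi hj,
        hiff]

end RatInstance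

/-! ### The test of a round on natural numbers -/

section RoundTest

variable {K : ℕ} {m c : ℕ → ℕ} {X : Set (ℝ × ℝ)} {B p : ℝ} {a q : ℕ}

/-- Here `a` is the ceiling of `BK` and `q` the floor of `pK`. Among the cells containing the point,
the one in column `a - 1` and row `min q (K - 1)` is furthest up and to the left, so it decides. -/
lemma IsCells.mem_iff (hK : 0 < K) (hb : Boundary K m c) (hX : IsCells K m X)
    (hB : B ∈ Icc (0 : ℝ) 1) (hp : p ∈ Icc (0 : ℝ) 1) (ha : (a : ℝ) < B * K + 1)
    (ha' : B * K ≤ a) (hq : (q : ℝ) ≤ p * K) (hq' : p * K < q + 1) :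
    (B, p) ∈ X ↔ m (a - 1) ≤ min q (K - 1) := by
  have hK' : (0 : ℝ) < K := by exact_mod_cast hK
  have hBK : B * K ≤ K := by nlinarith [hB.2]
  have hpK : p * K ≤ K := by nlinarith [hp.2]
  have haK : a ≤ K := by
    have : (a : ℝ) < K + 1 := by linarith
    have : a < K + 1 := by exact_mod_cast this
    omega
  rw [hX]
  simp only [mem_gridCell hK]
  constructor
  · rintro ⟨i, hi, j, hj, h1, ⟨h2, h3⟩, h4, h5⟩
    have h6 : (a : ℝ) < i + 1 + 1 := by linarith
    have h7 : a < i + 1 + 1 := by exact_mod_cast h6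
    have h8 : (j : ℝ) < q + 1 := by linarith
    have h9 : j < q + 1 := by exact_mod_cast h8
    have h10 := hb.mono (by omega : a - 1 ≤ i) hi
    omega
  · intro h
    refine ⟨a - 1, by omega, min q (K - 1), by omega, h, ⟨?_, ?_⟩, ?_, ?_⟩
    · rcases Nat.eq_zero_or_pos a with h0 | h0
      · subst h0
        simpa using mul_nonneg hB.1 hK'.le
      · rw [Nat.cast_sub h0, Nat.cast_one]; linarith
    · refine ha'.trans ?_
      exact_mod_cast (by omega : a ≤ a - 1 + 1)
    · refine le_trans ?_ hq
      exact_mod_cast min_le_left _ _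
    · rcases le_total q (K - 1) with h0 | h0
      · rw [min_eq_left h0]; exact hq'.le
      · rw [min_eq_right h0]
        refine hpK.trans ?_
        exact_mod_cast (by omega : K ≤ K - 1 + 1)

/-- The first two conditions keep the right and the bottom edge at distance `R / K`. Given these,
the staircase is far enough exactly if the cell in column `a + R - 1` and row `q - R` belongs to it,
since its lower right corner then has everything up and to the left inside `X`. -/
lemma IsCells.le_infDist_iff {V : Type*} [Fintype V] {T : Set V} {v : V} (hv : v ∉ T)
    {R : ℕ} (hR : 0 < R)
    (hK : 0 < K) (hb : Boundary K m c) (hX : IsCells K m X) (hdn : IsDn X)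
    (hB : B ∈ Icc (0 : ℝ) 1) (hp : p ∈ Icc (0 : ℝ) 1) (ha : (a : ℝ) < B * K + 1)
    (ha' : B * K ≤ a) (hq : (q : ℝ) ≤ p * K) (hq' : p * K < q + 1) :
    (R : ℝ) / K ≤ Metric.infDist (B, p) ((unitSquare \ X) ∪ rval0 T v) ↔
      a + R ≤ K ∧ R ≤ q ∧ m (a + R - 1) ≤ q - R := by
  have hK' : (0 : ℝ) < K := by exact_mod_cast hK
  have hR' : (0 : ℝ) < R := by exact_mod_cast hR
  have hne : ((unitSquare \ X) ∪ rval0 T v).Nonempty :=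
    ⟨_, Or.inr ((isUp_rval0 v).bot hB)⟩
  rw [Metric.le_infDist hne]
  constructor
  · intro h
    have h1 : a + R ≤ K := by
      have h2 := h (y := (1, p)) (Or.inr ((isUp_rval0 v).right hp))
      rw [Prod.dist_eq] at h2
      dsimp only at h2
      rw [dist_self, max_eq_left dist_nonneg, Real.dist_eq, abs_of_nonpos (by linarith [hB.2]),
        div_le_iff₀ hK'] at h2
      have h3 : (a : ℝ) + R < K + 1 := by linarith
      have h4 : a + R < K + 1 := by exact_mod_cast h3
      omega
    have h2 : R ≤ q := by
      have h2 := h (y := (B, 0)) (Or.inr ((isUp_rval0 v).bot hB))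
      rw [Prod.dist_eq] at h2
      dsimp only at h2
      rw [dist_self, max_eq_right dist_nonneg, Real.dist_eq, sub_zero, abs_of_nonneg hp.1,
        div_le_iff₀ hK'] at h2
      have h3 : (R : ℝ) < q + 1 := by linarith
      have h4 : R < q + 1 := by exact_mod_cast h3
      omega
    refine ⟨h1, h2, ?_⟩
    by_contra hcon
    have hm : q - R + 1 ≤ m (a + R - 1) := by omega
    have hm' : (q : ℝ) - R + 1 ≤ m (a + R - 1) := by
      rw [← Nat.cast_sub h2]; exact_mod_cast hm
    have h1' : (a : ℝ) + R ≤ K := by exact_mod_cast h1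
    have h2' : (R : ℝ) ≤ q := by exact_mod_cast h2
    -- In units of cells, `(y, z)` lies to the right of the left side of column `a + R - 1` and
    -- below the top of row `q - R`, hence outside `X`, yet at distance less than `R` from the given
    -- point.
    obtain ⟨y, hy1, hy2⟩ : ∃ y, max ((a : ℝ) + R - 1) (B * K) < y ∧ y < B * K + R :=
      exists_between (max_lt (by linarith) (by linarith))
    obtain ⟨z, hz1, hz2⟩ : ∃ z, p * K - R < z ∧ z < min ((q : ℝ) - R + 1) (p * K) :=
      exists_between (lt_min (by linarith) (by linarith))
    obtain ⟨hy0, hy1⟩ := max_lt_iff.1 hy1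
    obtain ⟨hz2, hz3⟩ := lt_min_iff.1 hz2
    have hBK : 0 ≤ B * K := mul_nonneg hB.1 hK'.le
    have hpK : p * K ≤ K := by nlinarith [hp.2]
    have hsq : (y / K, z / K) ∈ unitSquare := by
      refine ⟨⟨div_nonneg (by linarith) hK'.le, (div_le_one hK').2 (by linarith)⟩,
        div_nonneg (by linarith) hK'.le, (div_le_one hK').2 (by linarith)⟩
    have hnX : (y / K, z / K) ∉ X := by
      rw [hX]
      simp only [mem_gridCell hK, div_mul_cancel₀ _ hK'.ne']
      rintro ⟨i, hi, j, hj, h3, ⟨h4, h5⟩, h6, h7⟩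
      have h8 : (a : ℝ) + R < i + 1 + 1 := by linarith
      have h9 : a + R < i + 1 + 1 := by exact_mod_cast h8
      have h10 : m (a + R - 1) ≤ j := (hb.mono (by omega) hi).trans h3
      have h11 : (m (a + R - 1) : ℝ) ≤ j := by exact_mod_cast h10
      linarith
    have h3 := h (Or.inl ⟨hsq, hnX⟩)
    refine absurd h3 (not_le.2 ?_)
    rw [Prod.dist_eq]
    have e1 : B - y / K = (B * K - y) / K := by field_simp
    have e2 : p - z / K = (p * K - z) / K := by field_simp
    refine max_lt ?_ ?_
    · rw [Real.dist_eq, e1, abs_div, abs_of_pos hK', div_lt_div_iff_of_pos_right hK', abs_lt]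
      constructor <;> linarith
    · rw [Real.dist_eq, e2, abs_div, abs_of_pos hK', div_lt_div_iff_of_pos_right hK', abs_lt]
      constructor <;> linarith
  · rintro ⟨h1, h2, h3⟩ ⟨y, z⟩ hyz
    have h1' : (a : ℝ) + R ≤ K := by exact_mod_cast h1
    have h2' : (R : ℝ) ≤ q := by exact_mod_cast h2
    by_contra hcon
    rw [Prod.dist_eq, not_le, max_lt_iff, Real.dist_eq, Real.dist_eq, abs_lt, abs_lt] at hcon
    obtain ⟨⟨h4, h5⟩, h6, h7⟩ := hcon
    dsimp only at h4 h5 h6 h7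
    have hy : y * K < B * K + R := by
      have := mul_lt_mul_of_pos_right (by linarith : y < B + R / K) hK'
      rwa [add_mul, div_mul_cancel₀ _ hK'.ne'] at this
    have hz : p * K < z * K + R := by
      have := mul_lt_mul_of_pos_right (by linarith : p < z + R / K) hK'
      rwa [add_mul, div_mul_cancel₀ _ hK'.ne'] at this
    rcases hyz with ⟨hsq, hnX⟩ | h0
    · have hcol := (hX.mem_column hK hb h1 (p := ((q - R : ℕ) : ℝ) / K) ⟨by positivity, ?_⟩).2
        (by gcongr)
      · refine hnX (hdn.mono hcol ?_ hsq.1.1 ?_ hsq.2.2)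
        · rw [le_div_iff₀ hK']; push_cast; linarith
        · rw [div_le_iff₀ hK', Nat.cast_sub h2]; linarith
      · rw [div_le_one hK', Nat.cast_sub h2]
        nlinarith [hp.2]
    · rw [mem_rval0] at h0
      rcases h0.2 with h0 | h0 | h0
      · exact hv h0
      · subst h0; linarith
      · subst h0; linarith

end RoundTest

namespace GridData

/-- Whether the answer of a round is that the reachability player wins, in terms of the number of
cells, the lower boundary, the numerators and the denominators of the budget and the probability. -/
def ReachTest (t K : ℕ) (m : ℕ → ℕ) (Bn Bd pn pd : ℕ) : Prop :=
  t ≠ 0 ∨ pn = 0 ∨ Bn = Bd ∨ min (pn * K / pd) (K - 1) < m ((Bn * K + (Bd - 1)) / Bd - 1)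

/-- Whether the answer of a round is that the safety player wins. -/
def SafeTest (R K : ℕ) (m : ℕ → ℕ) (Bn Bd pn pd : ℕ) : Prop :=
  (Bn * K + (Bd - 1)) / Bd + R ≤ K ∧ R ≤ pn * K / pd ∧
    m ((Bn * K + (Bd - 1)) / Bd + R - 1) ≤ pn * K / pd - R

end GridData

namespace RatInstance

variable (I : RatInstance)

open Classical in
/-- The answer of a round in terms of the iteration on natural numbers. -/
theorem round_eq {h : ℕ} (hh : 1 ≤ h) : I.toInstance.round 2 8 h =
    if GridData.ReachTest (I.data.tgt I.v) (I.toInstance.cells h)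
        ((I.data.iter (I.toInstance.cells h) (I.toInstance.iters 2 8 h)).1 I.v)
        I.B.num I.B.den I.p.num I.p.den then some .reach
    else if GridData.SafeTest (2 * I.toInstance.iters 2 8 h) (I.toInstance.cells h)
        ((I.data.iter (I.toInstance.cells h) (I.toInstance.iters 2 8 h)).1 I.v)
        I.B.num I.B.den I.p.num I.p.den then some .safe
    else none := by
  set K := I.toInstance.cells h with hKdef
  set n := I.toInstance.iters 2 8 h with hn
  have hK : 0 < K := I.toInstance.cells_pos hh
  have hK' : (0 : ℝ) < K := by exact_mod_cast hK
  have hn2 := I.toInstance.two_le_iters hh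
  obtain ⟨hb, hX⟩ := I.absSval_isCells hK n I.v
  set m := (I.data.iter K n).1 I.v
  have hdn : IsDn (absSval I.toMDP {u | I.tgt u = true} (1 / K) n I.v) := isDn_absSval hK _ _
  set X := absSval I.toMDP {u | I.tgt u = true} (1 / K) n I.v
  have hround : I.toInstance.roundRval 2 8 h =
      (unitSquare \ X) ∪ rval0 {u | I.tgt u = true} I.v := I.toInstance.roundRval_eq h
  have hBd : (0 : ℝ) < I.B.den := by exact_mod_cast I.B.den_pos
  have hpd : (0 : ℝ) < I.p.den := by exact_mod_cast I.p.den_pos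
  have eB : I.toInstance.B = (I.B.num : ℝ) / I.B.den := NNRat.cast_def _
  have ep : I.toInstance.p = (I.p.num : ℝ) / I.p.den := NNRat.cast_def _
  have hBm := I.toInstance.B_mem
  have hpm := I.toInstance.p_mem
  set a := (I.B.num * K + (I.B.den - 1)) / I.B.den with ha
  set q := I.p.num * K / I.p.den with hq
  have ha1 : (a : ℝ) < I.toInstance.B * K + 1 := by
    rw [eB, div_mul_eq_mul_div, ← sub_lt_iff_lt_add, lt_div_iff₀ hBd]
    have : a * I.B.den ≤ I.B.num * K + (I.B.den - 1) := Nat.div_mul_le_self _ _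
    have h1 := I.B.den_pos
    have : a * I.B.den < I.B.num * K + I.B.den := by omega
    have : (a * I.B.den : ℝ) < I.B.num * K + I.B.den := by exact_mod_cast this
    linarith
  have ha2 : I.toInstance.B * K ≤ a := by
    rw [eB, div_mul_eq_mul_div, div_le_iff₀ hBd]
    have h1 := I.B.den_pos
    have : I.B.num * K + (I.B.den - 1) < I.B.den * (a + 1) := Nat.lt_mul_div_succ _ h1
    have : I.B.num * K ≤ a * I.B.den := by rw [mul_add, mul_comm] at this; lia
    exact_mod_cast this
  have hq1 : (q : ℝ) ≤ I.toInstance.p * K := by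
    rw [ep, div_mul_eq_mul_div, le_div_iff₀ hpd]
    exact_mod_cast Nat.div_mul_le_self _ _
  have hq2 : I.toInstance.p * K < q + 1 := by
    rw [ep, div_mul_eq_mul_div, div_lt_iff₀ hpd, mul_comm ((q : ℝ) + 1)]
    exact_mod_cast Nat.lt_mul_div_succ _ I.p.den_pos
  have htgt : I.data.tgt I.v ≠ 0 ↔ I.tgt I.v = true := by
    rw [data_tgt]; cases I.tgt I.v <;> simp
  have hmem : (I.toInstance.B, I.toInstance.p) ∈ I.toInstance.roundRval 2 8 h ↔
      GridData.ReachTest (I.data.tgt I.v) K m I.B.num I.B.den I.p.num I.p.den := by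
    have hsq := I.toInstance.mem_square
    have e1 : I.toInstance.p = 0 ↔ I.p.num = 0 := by
      rw [ep, div_eq_zero_iff, or_iff_left hpd.ne']; exact_mod_cast Iff.rfl
    have e2 : I.toInstance.B = 1 ↔ I.B.num = I.B.den := by
      rw [eB, div_eq_one_iff_eq hBd.ne']; exact_mod_cast Iff.rfl
    rw [hround, mem_union, mem_sdiff, mem_rval0,
      hX.mem_iff hK hb hBm hpm ha1 ha2 hq1 hq2, GridData.ReachTest, htgt, e1, e2, not_le]
    simp only [hsq, true_and, mem_ofPred_eq]
    tauto
  unfold Instance.round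
  simp only [hmem]
  by_cases h1 : GridData.ReachTest (I.data.tgt I.v) K m I.B.num I.B.den I.p.num I.p.den
  · simp only [h1, if_true]
  · have hv : I.v ∉ {u | I.tgt u = true} := fun hv => h1 (Or.inl (htgt.2 hv))
    -- As `K = 2 ^ h * n`, the radius of the safety test is a whole number `2n` of cells.
    have e : 2 * Instance.eps h = ((2 * n : ℕ) : ℝ) / K := by
      have : (n : ℝ) ≠ 0 := by exact_mod_cast (by omega : n ≠ 0)
      rw [hKdef, Instance.cells, ← hn, Instance.eps]
      push_cast
      field_simp
      rw [← mul_pow]; norm_num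
    have key : 2 * Instance.eps h ≤
        Metric.infDist (I.toInstance.B, I.toInstance.p) (I.toInstance.roundRval 2 8 h) ↔
        GridData.SafeTest (2 * n) K m I.B.num I.B.den I.p.num I.p.den := by
      rw [hround, e, hX.le_infDist_iff hv (by omega) hK hb hdn hBm hpm ha1 ha2 hq1 hq2]
      rfl
    simp only [h1, if_false, key]

end RatInstance

/-! ### Bounding the logarithmic cost by the uniform cost -/

/-- Executions with uniform cost `t` in which constants are at most `8` and the second factor of
every multiplication is at most `Y`. -/
inductive Run (Y : ℕ) : Prog → RAM → RAM → ℕ → Prop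
  | const (r k : ℕ) (s : RAM) : k ≤ 8 → Run Y (.const r k) s (s.setReg r k) 1
  | arith (o : ArithOp) (r a b : ℕ) (s : RAM) : (o = .mul → s.reg b ≤ Y) →
      Run Y (.arith o r a b) s (s.setReg r (o.eval (s.reg a) (s.reg b))) 1
  | load (r a : ℕ) (s : RAM) : Run Y (.load r a) s (s.setReg r (s.mem (s.reg a))) 1
  | store (a r : ℕ) (s : RAM) : Run Y (.store a r) s (s.setMem (s.reg a) (s.reg r)) 1
  | seq {P Q : Prog} {s₁ s₂ s₃ : RAM} {t t' : ℕ} :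
      Run Y P s₁ s₂ t → Run Y Q s₂ s₃ t' → Run Y (.seq P Q) s₁ s₃ (t + t')
  | iteTrue {r : ℕ} {P Q : Prog} {s s' : RAM} {t : ℕ} :
      s.reg r ≠ 0 → Run Y P s s' t → Run Y (.ite r P Q) s s' (1 + t)
  | iteFalse {r : ℕ} {P Q : Prog} {s s' : RAM} {t : ℕ} :
      s.reg r = 0 → Run Y Q s s' t → Run Y (.ite r P Q) s s' (1 + t)
  | loopDone {r : ℕ} {P : Prog} {s : RAM} : s.reg r = 0 → Run Y (.loop r P) s s 1
  | loopStep {r : ℕ} {P : Prog} {s₁ s₂ s₃ : RAM} {t t' : ℕ} :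
      s₁.reg r ≠ 0 → Run Y P s₁ s₂ t → Run Y (.loop r P) s₂ s₃ t' →
      Run Y (.loop r P) s₁ s₃ (1 + t + t')

/-- All numbers in the state have at most `z` bits. -/
def RAM.Small (z : ℕ) (s : RAM) : Prop := (∀ r, (s.reg r).size ≤ z) ∧ ∀ a, (s.mem a).size ≤ z

lemma RAM.Small.mono {z z' : ℕ} {s : RAM} (h : s.Small z) (hz : z ≤ z') : s.Small z' :=
  ⟨fun r => (h.1 r).trans hz, fun a => (h.2 a).trans hz⟩

lemma RAM.Small.setReg {z : ℕ} {s : RAM} (h : s.Small z) (r : ℕ) {x : ℕ} (hx : x.size ≤ z) :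
    (s.setReg r x).Small z := by
  refine ⟨fun r' => ?_, h.2⟩
  rw [RAM.setReg]
  dsimp only
  rw [Function.update_apply]
  split_ifs
  · exact hx
  · exact h.1 r'

lemma RAM.Small.setMem {z : ℕ} {s : RAM} (h : s.Small z) (r : ℕ) {x : ℕ} (hx : x.size ≤ z) :
    (s.setMem r x).Small z := by
  refine ⟨h.1, fun r' => ?_⟩
  rw [RAM.setMem]
  dsimp only
  rw [Function.update_apply]
  split_ifs
  · exact hx
  · exact h.2 r'

/-- Addition gains one bit and multiplication by a number up to `Y` gains `Y.size` bits. Without the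
cap on the second factor, repeated squaring would make the length exponential. -/
lemma size_eval_le (o : ArithOp) {a b z Y : ℕ} (ha : a.size ≤ z) (hb : b.size ≤ z)
    (h : o = .mul → b ≤ Y) : (o.eval a b).size ≤ z + (Y.size + 1) := by
  rw [Nat.size_le] at ha hb
  cases o with
  | add =>
    rw [Nat.size_le, ArithOp.eval]
    have : 2 ^ (z + (Y.size + 1)) = 2 ^ z * 2 ^ Y.size * 2 := by rw [pow_add, pow_succ]; ring
    have h1 := Nat.one_le_two_pow (n := Y.size)
    nlinarith
  | sub =>
    refine (Nat.size_le_size (Nat.sub_le a b)).trans ?_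
    exact (Nat.size_le.2 ha).trans (by omega)
  | mul =>
    rw [Nat.size_le, ArithOp.eval]
    have h1 : b < 2 ^ Y.size := (h rfl).trans_lt (Nat.lt_size_self Y)
    calc a * b < 2 ^ z * 2 ^ Y.size := Nat.mul_lt_mul'' ha h1
      _ = 2 ^ (z + Y.size) := (pow_add _ _ _).symm
      _ ≤ _ := Nat.pow_le_pow_right (by norm_num) (by omega)
  | div =>
    refine (Nat.size_le_size (Nat.div_le_self a b)).trans ?_
    exact (Nat.size_le.2 ha).trans (by omega)

/-- Lengths grow by at most `Y.size + 1` per step and an instruction handles at most three numbers.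
The condition `4 ≤ z` accommodates the constants, which are at most `8`. -/
theorem Run.exec {Y : ℕ} {P : Prog} {s s' : RAM} {t : ℕ} (h : Run Y P s s' t) {z Z : ℕ}
    (hz : 4 ≤ z) (hs : s.Small z) (hZ : z + t * (Y.size + 1) ≤ Z) :
    s'.Small (z + t * (Y.size + 1)) ∧ ∃ b, Exec P s s' t b ∧ b ≤ t * (1 + 3 * Z) := by
  induction h generalizing z with
  | const r k s hk =>
    have h1 : k.size ≤ 4 := (Nat.size_le_size hk).trans (by decide)
    exact ⟨(hs.mono (by omega)).setReg _ (by omega), _, .const r k s, by omega⟩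
  | arith o r a b s hm =>
    have h1 := hs.1 a
    have h2 := hs.1 b
    have h3 := size_eval_le o h1 h2 hm
    exact ⟨(hs.mono (by omega)).setReg _ (by omega), _, .arith o r a b s, by omega⟩
  | load r a s =>
    have h1 := hs.1 a
    have h2 := hs.2 (s.reg a)
    exact ⟨(hs.mono (by omega)).setReg _ (by omega), _, .load r a s, by omega⟩
  | store a r s =>
    have h1 := hs.1 a
    have h2 := hs.1 r
    exact ⟨(hs.mono (by omega)).setMem _ (by omega), _, .store a r s, by omega⟩
  | @seq P Q s₁ s₂ s₃ t t' _ _ ih1 ih2 =>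
    rw [add_mul, ← add_assoc] at hZ ⊢
    obtain ⟨hs2, b1, e1, h1⟩ := ih1 hz hs (by omega)
    obtain ⟨hs3, b2, e2, h2⟩ := ih2 (by omega) hs2 hZ
    exact ⟨hs3, _, .seq e1 e2, by rw [add_mul]; omega⟩
  | @iteTrue r P Q s s' t hr _ ih =>
    have h1 := hs.1 r
    rw [add_mul] at hZ ⊢
    obtain ⟨hs2, b1, e1, h1⟩ := ih hz hs (by omega)
    exact ⟨hs2.mono (by omega), _, .iteTrue hr e1, by rw [add_mul]; omega⟩
  | @iteFalse r P Q s s' t hr _ ih =>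
    have h1 := hs.1 r
    rw [add_mul] at hZ ⊢
    obtain ⟨hs2, b1, e1, h1⟩ := ih hz hs (by omega)
    exact ⟨hs2.mono (by omega), _, .iteFalse hr e1, by rw [add_mul]; omega⟩
  | @loopDone r P s hr =>
    have h1 := hs.1 r
    exact ⟨hs.mono (by omega), _, .loopDone hr, by omega⟩
  | @loopStep r P s₁ s₂ s₃ t t' hr _ _ ih1 ih2 =>
    have h1 := hs.1 r
    rw [add_mul, add_mul] at hZ ⊢
    obtain ⟨hs2, b1, e1, h1⟩ := ih1 hz hs (by omega)
    obtain ⟨hs3, b2, e2, h2⟩ := ih2 (by omega) hs2 (by omega)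
    exact ⟨hs3.mono (by omega), _, .loopStep hr e1 e2, by rw [add_mul, add_mul]; omega⟩

/-! ### Expressions and commands with bounded loops -/

@[simp] lemma RAM.setReg_reg (s : RAM) (r x r' : ℕ) :
    (s.setReg r x).reg r' = if r' = r then x else s.reg r' := Function.update_apply _ _ _ _

@[simp] lemma RAM.setReg_mem (s : RAM) (r x : ℕ) : (s.setReg r x).mem = s.mem := rfl

@[simp] lemma RAM.setMem_reg (s : RAM) (a x : ℕ) : (s.setMem a x).reg = s.reg := rfl

@[simp] lemma RAM.setMem_mem (s : RAM) (a x a' : ℕ) :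
    (s.setMem a x).mem a' = if a' = a then x else s.mem a' := Function.update_apply _ _ _ _

/-- Expressions over the registers and the memory. -/
inductive Expr
  | reg (r : ℕ)
  | lit (k : ℕ)
  | op (o : ArithOp) (a b : Expr)
  | load (a : Expr)

namespace Expr

/-- The value of an expression. -/
def eval (s : RAM) : Expr → ℕ
  | reg r => s.reg r
  | lit k => k
  | op o a b => o.eval (a.eval s) (b.eval s)
  | load a => s.mem (a.eval s)

/-- The second factors of all multiplications are at most `Y`. -/
def Ok (Y : ℕ) (s : RAM) : Expr → Prop
  | reg _ => True
  | lit _ => True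
  | op o a b => a.Ok Y s ∧ b.Ok Y s ∧ (o = .mul → b.eval s ≤ Y)
  | load a => a.Ok Y s

/-- All registers are below `T` and all constants are at most `8`. -/
def wf (T : ℕ) : Expr → Bool
  | reg r => r < T
  | lit k => k ≤ 8
  | op _ a b => a.wf T && b.wf T
  | load a => a.wf T

/-- The number of instructions needed to evaluate an expression. -/
def cost : Expr → ℕ
  | reg _ => 2
  | lit _ => 1
  | op _ a b => a.cost + b.cost + 1
  | load a => a.cost + 1

/-- A program that evaluates an expression into register `d`, changing no register below `d`. -/
def comp (d : ℕ) : Expr → Prog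
  | reg r => .seq (.const d 0) (.arith .add d d r)
  | lit k => .const d k
  | op o a b => .seq (.seq (a.comp d) (b.comp (d + 1))) (.arith o d d (d + 1))
  | load a => .seq (a.comp d) (.load d d)

instance : Add Expr := ⟨op .add⟩
instance : Sub Expr := ⟨op .sub⟩
instance : Mul Expr := ⟨op .mul⟩
instance : Div Expr := ⟨op .div⟩

@[simp] lemma eval_reg (s : RAM) (r : ℕ) : (reg r).eval s = s.reg r := rfl
@[simp] lemma eval_lit (s : RAM) (k : ℕ) : (lit k).eval s = k := rfl
@[simp] lemma eval_load (s : RAM) (a : Expr) : (load a).eval s = s.mem (a.eval s) := rfl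
@[simp] lemma eval_add (s : RAM) (a b : Expr) : (a + b).eval s = a.eval s + b.eval s := rfl
@[simp] lemma eval_sub (s : RAM) (a b : Expr) : (a - b).eval s = a.eval s - b.eval s := rfl
@[simp] lemma eval_mul (s : RAM) (a b : Expr) : (a * b).eval s = a.eval s * b.eval s := rfl
@[simp] lemma eval_div (s : RAM) (a b : Expr) : (a / b).eval s = a.eval s / b.eval s := rfl

@[simp] lemma ok_reg (Y : ℕ) (s : RAM) (r : ℕ) : (reg r).Ok Y s ↔ True := Iff.rfl
@[simp] lemma ok_lit (Y : ℕ) (s : RAM) (k : ℕ) : (lit k).Ok Y s ↔ True := Iff.rfl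
@[simp] lemma ok_load (Y : ℕ) (s : RAM) (a : Expr) : (load a).Ok Y s ↔ a.Ok Y s := Iff.rfl
@[simp] lemma ok_add (Y : ℕ) (s : RAM) (a b : Expr) : (a + b).Ok Y s ↔ a.Ok Y s ∧ b.Ok Y s :=
  ⟨fun h => ⟨h.1, h.2.1⟩, fun h => ⟨h.1, h.2, fun h => by cases h⟩⟩
@[simp] lemma ok_sub (Y : ℕ) (s : RAM) (a b : Expr) : (a - b).Ok Y s ↔ a.Ok Y s ∧ b.Ok Y s :=
  ⟨fun h => ⟨h.1, h.2.1⟩, fun h => ⟨h.1, h.2, fun h => by cases h⟩⟩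
@[simp] lemma ok_div (Y : ℕ) (s : RAM) (a b : Expr) : (a / b).Ok Y s ↔ a.Ok Y s ∧ b.Ok Y s :=
  ⟨fun h => ⟨h.1, h.2.1⟩, fun h => ⟨h.1, h.2, fun h => by cases h⟩⟩
@[simp] lemma ok_mul (Y : ℕ) (s : RAM) (a b : Expr) :
    (a * b).Ok Y s ↔ a.Ok Y s ∧ b.Ok Y s ∧ b.eval s ≤ Y :=
  ⟨fun h => ⟨h.1, h.2.1, h.2.2 rfl⟩, fun h => ⟨h.1, h.2.1, fun _ => h.2.2⟩⟩

/-- The minimum of two expressions. -/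
def emin (a b : Expr) : Expr := a - (a - b)

/-- The maximum of two expressions. -/
def emax (a b : Expr) : Expr := a + (b - a)

/-- A positive number if the first expression is less than the second, and `0` otherwise. -/
def lt (a b : Expr) : Expr := b - a

@[simp] lemma eval_emin (s : RAM) (a b : Expr) : (a.emin b).eval s = min (a.eval s) (b.eval s) := by
  simp only [emin, eval_sub]; omega
@[simp] lemma eval_emax (s : RAM) (a b : Expr) : (a.emax b).eval s = max (a.eval s) (b.eval s) := by
  simp only [emax, eval_add, eval_sub]; omega
@[simp] lemma eval_lt (s : RAM) (a b : Expr) : (a.lt b).eval s ≠ 0 ↔ a.eval s < b.eval s := by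
  simp only [lt, eval_sub]; omega
@[simp] lemma eval_lt_eq_zero (s : RAM) (a b : Expr) :
    (a.lt b).eval s = 0 ↔ b.eval s ≤ a.eval s := by
  simp only [lt, eval_sub]; omega
@[simp] lemma ok_emin (Y : ℕ) (s : RAM) (a b : Expr) : (a.emin b).Ok Y s ↔ a.Ok Y s ∧ b.Ok Y s := by
  simp [emin]
@[simp] lemma ok_emax (Y : ℕ) (s : RAM) (a b : Expr) : (a.emax b).Ok Y s ↔ a.Ok Y s ∧ b.Ok Y s := by
  simp only [emax, ok_add, ok_sub]; tauto
@[simp] lemma ok_lt (Y : ℕ) (s : RAM) (a b : Expr) : (a.lt b).Ok Y s ↔ a.Ok Y s ∧ b.Ok Y s := by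
  simp only [lt, ok_sub]; tauto

end Expr

/-- The states agree on the memory and on the registers below `T`. -/
def RAM.Agree (T : ℕ) (s s' : RAM) : Prop := (∀ r < T, s'.reg r = s.reg r) ∧ s'.mem = s.mem

lemma RAM.Agree.setReg {T : ℕ} {s s' : RAM} (h : s.Agree T s') (r x : ℕ) :
    (s.setReg r x).Agree T (s'.setReg r x) := by
  refine ⟨fun r' hr => ?_, h.2⟩
  simp only [RAM.setReg_reg, h.1 r' hr]

lemma RAM.Agree.setReg_right {T : ℕ} {s s' : RAM} (h : s.Agree T s') {r : ℕ} (hr : T ≤ r) (x : ℕ) :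
    s.Agree T (s'.setReg r x) := by
  refine ⟨fun r' hr' => ?_, h.2⟩
  rw [RAM.setReg_reg, if_neg (by omega), h.1 r' hr']

/-- The registers from `d` on serve as a stack, so the left operand in `d` survives the evaluation
of the right one in `d + 1`. -/
lemma Expr.run_comp {Y T : ℕ} {s : RAM} (e : Expr) {d : ℕ} (hd : T ≤ d) (hwf : e.wf T = true)
    (hok : e.Ok Y s) {s₀ : RAM} (h : s.Agree T s₀) :
    ∃ s₁, Run Y (e.comp d) s₀ s₁ e.cost ∧ s₁.reg d = e.eval s ∧ s₁.mem = s₀.mem ∧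
      ∀ r < d, s₁.reg r = s₀.reg r := by
  induction e generalizing d s₀ with
  | reg r =>
    have hr : r < T := by simpa [wf] using hwf
    refine ⟨_, .seq (.const d 0 s₀ (by omega)) (.arith .add d d r _ fun h => by cases h), ?_, rfl,
      fun r' hr' => ?_⟩
    · simp [ArithOp.eval, eval, h.1 r hr, show r ≠ d by omega]
    · simp [show r' ≠ d by omega]
  | lit k =>
    have hk : k ≤ 8 := by simpa [wf] using hwf
    refine ⟨_, .const d k s₀ hk, by simp [eval], rfl, fun r' hr' => by simp [show r' ≠ d by omega]⟩
  | op o a b iha ihb =>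
    simp only [wf, Bool.and_eq_true] at hwf
    obtain ⟨s₁, r1, v1, m1, f1⟩ := iha hd hwf.1 hok.1 h
    have h1 : s.Agree T s₁ := ⟨fun r hr => (f1 r (by omega)).trans (h.1 r hr), m1.trans h.2⟩
    obtain ⟨s₂, r2, v2, m2, f2⟩ := ihb (d := d + 1) (by omega) hwf.2 hok.2.1 h1
    refine ⟨_, .seq (.seq r1 r2) (.arith o d d (d + 1) s₂ fun ho => ?_), ?_, ?_, fun r hr => ?_⟩
    · rw [v2]; exact hok.2.2 ho
    · rw [RAM.setReg_reg, if_pos rfl, v2, f2 d (by omega), v1]; rfl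
    · rw [RAM.setReg_mem, m2, m1]
    · rw [RAM.setReg_reg, if_neg (by omega), f2 r (by omega), f1 r hr]
  | load a ih =>
    obtain ⟨s₁, r1, v1, m1, f1⟩ := ih hd hwf hok h
    refine ⟨_, .seq r1 (.load d d s₁), ?_, m1, fun r hr => ?_⟩
    · rw [RAM.setReg_reg, if_pos rfl, v1, m1, h.2]; rfl
    · rw [RAM.setReg_reg, if_neg (by omega), f1 r hr]

/-- Commands with bounded loops: `bfor i r c` runs `c` with `i = 0, …, reg r - 1`. -/
inductive Cmd
  | skip
  | set (r : ℕ) (e : Expr)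
  | store (a e : Expr)
  | seq (c d : Cmd)
  | cond (e : Expr) (c d : Cmd)
  | bfor (i r : ℕ) (c : Cmd)

namespace Cmd

/-- The effect of a command. -/
def den : Cmd → RAM → RAM
  | skip, s => s
  | set r e, s => s.setReg r (e.eval s)
  | store a e, s => s.setMem (a.eval s) (e.eval s)
  | seq c d, s => d.den (c.den s)
  | cond e c d, s => if e.eval s ≠ 0 then c.den s else d.den s
  | bfor i r c, s =>
    (fun s' => (c.den s').setReg i ((c.den s').reg i + 1))^[s.reg r] (s.setReg i 0)

/-- One round of a bounded loop. -/
def step (i : ℕ) (c : Cmd) (s : RAM) : RAM := (c.den s).setReg i ((c.den s).reg i + 1)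

/-- The second factors of all multiplications are at most `Y`. -/
def Ok (Y : ℕ) : Cmd → RAM → Prop
  | skip, _ => True
  | set _ e, s => e.Ok Y s
  | store a e, s => a.Ok Y s ∧ e.Ok Y s
  | seq c d, s => c.Ok Y s ∧ d.Ok Y (c.den s)
  | cond e c d, s => e.Ok Y s ∧ (e.eval s ≠ 0 → c.Ok Y s) ∧ (e.eval s = 0 → d.Ok Y s)
  | bfor i r c, s => ∀ j < s.reg r, c.Ok Y ((step i c)^[j] (s.setReg i 0))

/-- The registers that a command may change. -/
def wr : Cmd → List ℕ
  | skip => []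
  | set r _ => [r]
  | store _ _ => []
  | seq c d => c.wr ++ d.wr
  | cond _ c d => c.wr ++ d.wr
  | bfor i _ c => i :: c.wr

/-- The registers that bound the loops of a command. -/
def bounds : Cmd → List ℕ
  | skip => []
  | set _ _ => []
  | store _ _ => []
  | seq c d => c.bounds ++ d.bounds
  | cond _ c d => c.bounds ++ d.bounds
  | bfor _ r c => r :: c.bounds

/-- The command does not write to the memory. -/
def pure : Cmd → Bool
  | skip => true
  | set _ _ => true
  | store _ _ => false
  | seq c d => c.pure && d.pure
  | cond _ c d => c.pure && d.pure
  | bfor _ _ c => c.pure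

/-- All registers are below `T`, all constants are at most `8`, and the counter and the bound of a
loop are distinct and not changed in the loop. -/
def wf (T : ℕ) : Cmd → Bool
  | skip => true
  | set r e => decide (r < T) && e.wf T
  | store a e => a.wf T && e.wf T
  | seq c d => c.wf T && d.wf T
  | cond e c d => e.wf T && c.wf T && d.wf T
  | bfor i r c => decide (i < T) && decide (r < T) && decide (i ≠ r) && !c.wr.contains i &&
      !c.wr.contains r && c.wf T

/-- The uniform cost of a command. -/
def cost : Cmd → RAM → ℕ
  | skip, _ => 1
  | set _ e, _ => e.cost + 2
  | store a e, _ => a.cost + e.cost + 1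
  | seq c d, s => c.cost s + d.cost (c.den s)
  | cond e c d, s => e.cost + (1 + if e.eval s ≠ 0 then c.cost s else d.cost s)
  | bfor i r c, s => 3 + ∑ j ∈ Finset.range (s.reg r), (c.cost ((step i c)^[j] (s.setReg i 0)) + 4)

/-- The program of a command; `T` is the first register for intermediate results. -/
def comp (T : ℕ) : Cmd → Prog
  | skip => .const T 0
  | set r e => .seq (e.comp T) (.seq (.const r 0) (.arith .add r r T))
  | store a e => .seq (.seq (a.comp T) (e.comp (T + 1))) (.store T (T + 1))
  | seq c d => .seq (c.comp T) (d.comp T)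
  | cond e c d => .seq (e.comp T) (.ite T (c.comp T) (d.comp T))
  | bfor i r c => .seq (.seq (.const i 0) (.arith .sub T r i)) (.loop T
      (.seq (c.comp T) (.seq (.seq (.const T 1) (.arith .add i i T)) (.arith .sub T r i))))

lemma reg_den {c : Cmd} {s : RAM} {x : ℕ} (hx : x ∉ c.wr) : (c.den s).reg x = s.reg x := by
  induction c generalizing s with
  | skip => rfl
  | set r e =>
    have : x ≠ r := by simpa [wr] using hx
    simp [den, this]
  | store a e => rfl
  | seq c d ihc ihd =>
    simp only [wr, List.mem_append, not_or] at hx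
    rw [den, ihd hx.2, ihc hx.1]
  | cond e c d ihc ihd =>
    simp only [wr, List.mem_append, not_or] at hx
    rw [den]
    split_ifs
    · exact ihc hx.1
    · exact ihd hx.2
  | bfor i r c ih =>
    simp only [wr, List.mem_cons, not_or] at hx
    rw [den]
    generalize s.reg r = n
    have : ∀ n (s' : RAM), ((fun s' => (c.den s').setReg i ((c.den s').reg i + 1))^[n] s').reg x =
        s'.reg x := by
      intro n
      induction n with
      | zero => intro s'; rfl
      | succ n ihn =>
        intro s'
        rw [Function.iterate_succ_apply, ihn, RAM.setReg_reg, if_neg hx.1, ih hx.2]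
    rw [this, RAM.setReg_reg, if_neg hx.1]

lemma mem_den {c : Cmd} {s : RAM} (hc : c.pure = true) : (c.den s).mem = s.mem := by
  induction c generalizing s with
  | skip => rfl
  | set r e => rfl
  | store a e => cases hc
  | seq c d ihc ihd =>
    simp only [pure, Bool.and_eq_true] at hc
    rw [den, ihd hc.2, ihc hc.1]
  | cond e c d ihc ihd =>
    simp only [pure, Bool.and_eq_true] at hc
    rw [den]
    split_ifs
    · exact ihc hc.1
    · exact ihd hc.2
  | bfor i r c ih =>
    rw [den]
    have : ∀ n (s' : RAM), ((fun s' => (c.den s').setReg i ((c.den s').reg i + 1))^[n] s').mem =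
        s'.mem := by
      intro n
      induction n with
      | zero => intro s'; rfl
      | succ n ihn =>
        intro s'
        rw [Function.iterate_succ_apply, ihn, RAM.setReg_mem, ih hc]
    rw [this, RAM.setReg_mem]

lemma den_bfor (i r : ℕ) (c : Cmd) (s : RAM) :
    (bfor i r c).den s = (step i c)^[s.reg r] (s.setReg i 0) := rfl

lemma reg_step {i r : ℕ} {c : Cmd} (hi : i ∉ c.wr) (s : RAM) (j : ℕ) :
    ((step i c)^[j] (s.setReg i 0)).reg i = j ∧
      ∀ x ∉ (bfor i r c).wr, ((step i c)^[j] (s.setReg i 0)).reg x = s.reg x := by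
  induction j with
  | zero =>
    refine ⟨by simp, fun x hx => ?_⟩
    simp only [wr, List.mem_cons, not_or] at hx
    simp [hx.1]
  | succ j ih =>
    rw [Function.iterate_succ_apply']
    refine ⟨?_, fun x hx => ?_⟩
    · rw [step, RAM.setReg_reg, if_pos rfl, reg_den hi, ih.1]
    · have h := ih.2 x hx
      simp only [wr, List.mem_cons, not_or] at hx
      rw [step, RAM.setReg_reg, if_neg hx.1, reg_den hx.2, h]

theorem run_comp {Y T : ℕ} (c : Cmd) {s : RAM} (hwf : c.wf T = true) (hok : c.Ok Y s) {s₀ : RAM}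
    (h : s.Agree T s₀) :
    ∃ s₁, Run Y (c.comp T) s₀ s₁ (c.cost s) ∧ (c.den s).Agree T s₁ := by
  induction c generalizing s s₀ with
  | skip => exact ⟨_, .const T 0 s₀ (by omega), h.setReg_right le_rfl _⟩
  | set r e =>
    simp only [wf, Bool.and_eq_true, decide_eq_true_eq] at hwf
    obtain ⟨s₁, r1, v1, m1, f1⟩ := e.run_comp le_rfl hwf.2 hok h
    refine ⟨_, .seq r1 (.seq (.const r 0 s₁ (by omega)) (.arith .add r r T _ fun h => by cases h)),
      fun x hx => ?_, ?_⟩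
    · have := hwf.1
      simp only [den, RAM.setReg_reg, ArithOp.eval, if_true, show T ≠ r by omega, if_false, v1,
        zero_add]
      split_ifs
      · rfl
      · rw [f1 x hx, h.1 x hx]
    · exact m1.trans h.2
  | store a e =>
    simp only [wf, Bool.and_eq_true] at hwf
    obtain ⟨s₁, r1, v1, m1, f1⟩ := a.run_comp le_rfl hwf.1 hok.1 h
    have h1 : s.Agree T s₁ := ⟨fun r hr => (f1 r (by omega)).trans (h.1 r hr), m1.trans h.2⟩
    obtain ⟨s₂, r2, v2, m2, f2⟩ := e.run_comp (d := T + 1) (by omega) hwf.2 hok.2 h1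
    refine ⟨_, .seq (.seq r1 r2) (.store T (T + 1) s₂), fun x hx => ?_, ?_⟩
    · rw [RAM.setMem_reg, f2 x (by omega), h1.1 x hx]; rfl
    · rw [den, RAM.setMem, RAM.setMem, v2, f2 T (by omega), v1, m2, h1.2]
  | seq c d ihc ihd =>
    simp only [wf, Bool.and_eq_true] at hwf
    obtain ⟨s₁, r1, h1⟩ := ihc hwf.1 hok.1 h
    obtain ⟨s₂, r2, h2⟩ := ihd hwf.2 hok.2 h1
    exact ⟨s₂, .seq r1 r2, h2⟩
  | cond e c d ihc ihd =>
    simp only [wf, Bool.and_eq_true] at hwf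
    obtain ⟨s₁, r1, v1, m1, f1⟩ := e.run_comp le_rfl hwf.1.1 hok.1 h
    have h1 : s.Agree T s₁ := ⟨fun r hr => (f1 r (by omega)).trans (h.1 r hr), m1.trans h.2⟩
    rw [den, cost]
    split_ifs with hv
    · obtain ⟨s₂, r2, h2⟩ := ihc hwf.1.2 (hok.2.1 hv) h1
      exact ⟨s₂, .seq r1 (.iteTrue (by rw [v1]; exact hv) r2), h2⟩
    · rw [not_not] at hv
      obtain ⟨s₂, r2, h2⟩ := ihd hwf.2 (hok.2.2 hv) h1
      exact ⟨s₂, .seq r1 (.iteFalse (by rw [v1]; exact hv) r2), h2⟩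
  | bfor i r c ih =>
    simp only [wf, Bool.and_eq_true, decide_eq_true_eq, Bool.not_eq_true', List.contains_eq_mem,
      decide_eq_false_iff_not] at hwf
    obtain ⟨⟨⟨⟨⟨hiT, hrT⟩, hir⟩, hi⟩, hr⟩, hc⟩ := hwf
    have hr' : r ∉ (bfor i r c).wr := by simp [wr, hr, Ne.symm hir]
    -- Register `T` holds the number of remaining passes. The body may overwrite it, so it is
    -- recomputed as `r - i` at the end of each pass.
    have key : ∀ k j (s₁ : RAM), j + k = s.reg r →
        ((step i c)^[j] (s.setReg i 0)).Agree T s₁ → s₁.reg T = k →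
        ∃ s₂, Run Y (.loop T (.seq (c.comp T) (.seq (.seq (.const T 1) (.arith .add i i T))
          (.arith .sub T r i)))) s₁ s₂
          (1 + ∑ l ∈ Finset.range k, (c.cost ((step i c)^[j + l] (s.setReg i 0)) + 4)) ∧
          ((step i c)^[s.reg r] (s.setReg i 0)).Agree T s₂ := by
      intro k
      induction k with
      | zero =>
        intro j s₁ hj h1 hk
        rw [add_zero] at hj
        exact ⟨s₁, .loopDone hk, hj ▸ h1⟩
      | succ k ihk =>
        intro j s₁ hj h1 hk
        have hrj := ((reg_step hi s j (r := r)).2 r hr')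
        have hij := ((reg_step hi s j (r := r)).1)
        obtain ⟨s₂, r2, h2⟩ := ih hc (hok j (by omega)) h1
        have hc1 := h2.1 i hiT
        have hc2 := h2.1 r hrT
        rw [reg_den hi, hij] at hc1
        rw [reg_den hr, hrj] at hc2
        set s₃ := ((s₂.setReg T 1).setReg i (ArithOp.add.eval ((s₂.setReg T 1).reg i)
          ((s₂.setReg T 1).reg T))) with hs3
        set s₄ := s₃.setReg T (ArithOp.sub.eval (s₃.reg r) (s₃.reg i)) with hs4
        have h4 : ((step i c)^[j + 1] (s.setReg i 0)).Agree T s₄ := by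
          rw [Function.iterate_succ_apply']
          refine ⟨fun x hx => ?_, h2.2⟩
          rw [hs4, RAM.setReg_reg, if_neg (by omega), hs3]
          simp only [RAM.setReg_reg, if_neg (by omega : i ≠ T), if_neg (by omega : x ≠ T), if_true,
            ArithOp.eval, step, h2.1 i hiT, h2.1 x hx]
        have h5 : s₄.reg T = k := by
          rw [hs4, RAM.setReg_reg, if_pos rfl, hs3]
          simp only [RAM.setReg_reg, if_neg (by omega : i ≠ T), if_neg (by omega : r ≠ T),
            if_neg (Ne.symm hir), if_true, ArithOp.eval, hc1, hc2]
          omega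
        obtain ⟨s₅, r5, h6⟩ := ihk (j + 1) s₄ (by omega) h4 h5
        refine ⟨s₅, ?_, h6⟩
        have hrun := Run.loopStep (r := T) (by omega : s₁.reg T ≠ 0)
          (.seq r2 (.seq (.seq (.const T 1 s₂ (by omega)) (.arith .add i i T _ fun h => by cases h))
            (.arith .sub T r i _ fun h => by cases h))) r5
        convert hrun using 1
        rw [Finset.sum_range_succ']
        have e : ∑ l ∈ Finset.range k, (c.cost ((step i c)^[j + (l + 1)] (s.setReg i 0)) + 4) =
            ∑ l ∈ Finset.range k, (c.cost ((step i c)^[j + 1 + l] (s.setReg i 0)) + 4) :=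
          Finset.sum_congr rfl fun l _ => by rw [show j + (l + 1) = j + 1 + l by omega]
        rw [e, add_zero]
        omega
    have h0 : (s.setReg i 0).Agree T (s₀.setReg i 0) := h.setReg i 0
    have h1 := h0.setReg_right (r := T) le_rfl
      (ArithOp.sub.eval ((s₀.setReg i 0).reg r) ((s₀.setReg i 0).reg i))
    obtain ⟨s₂, r2, h2⟩ := key (s.reg r) 0 _ (by omega) h1 (by
      simp only [RAM.setReg_reg, if_true, ArithOp.eval, if_neg (Ne.symm hir), h.1 r hrT]
      omega)
    refine ⟨s₂, ?_, h2⟩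
    have hrun := Run.seq (.seq (.const i 0 s₀ (by omega)) (.arith .sub T r i _ fun h => by cases h)) r2
    simp only [zero_add] at hrun
    convert hrun using 1
    · rfl
    · rw [cost]; omega

/-- The loop bounds of every part of the command are not changed before or during that part. -/
def stable : Cmd → Bool
  | skip => true
  | set _ _ => true
  | store _ _ => true
  | seq c d => c.stable && d.stable && d.bounds.all fun r => !c.wr.contains r
  | cond _ c d => c.stable && d.stable
  | bfor i _ c => c.stable && c.bounds.all (fun x => !(i :: c.wr).contains x) &&
      !c.wr.contains i

/-- A bound for the cost in terms of the initial values of the loop bounds. -/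
def bound (f : ℕ → ℕ) : Cmd → ℕ
  | skip => 1
  | set _ e => e.cost + 2
  | store a e => a.cost + e.cost + 1
  | seq c d => c.bound f + d.bound f
  | cond e c d => e.cost + 1 + c.bound f + d.bound f
  | bfor _ r c => 3 + f r * (c.bound f + 4)

lemma bound_congr {c : Cmd} {f g : ℕ → ℕ} (h : ∀ r ∈ c.bounds, f r = g r) :
    c.bound f = c.bound g := by
  induction c with
  | skip => rfl
  | set r e => rfl
  | store a e => rfl
  | seq c d ihc ihd =>
    simp only [bounds, List.mem_append] at h
    rw [bound, bound, ihc fun r hr => h r (Or.inl hr), ihd fun r hr => h r (Or.inr hr)]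
  | cond e c d ihc ihd =>
    simp only [bounds, List.mem_append] at h
    rw [bound, bound, ihc fun r hr => h r (Or.inl hr), ihd fun r hr => h r (Or.inr hr)]
  | bfor _ r c ih =>
    simp only [bounds, List.mem_cons] at h
    rw [bound, bound, ih fun r hr => h r (Or.inr hr), h r (Or.inl rfl)]

/-- Stability guarantees that each loop still sees the initial value of its bound, so the cost is a
polynomial in these values. -/
theorem cost_le_bound (c : Cmd) (hc : c.stable = true) (s : RAM) : c.cost s ≤ c.bound s.reg := by
  induction c generalizing s with
  | skip => exact le_rfl
  | set r e => exact le_rfl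
  | store a e => exact le_rfl
  | seq c d ihc ihd =>
    simp only [stable, Bool.and_eq_true, List.all_eq_true, Bool.not_eq_true', List.contains_eq_mem,
      decide_eq_false_iff_not] at hc
    rw [cost, bound]
    have h1 := ihd hc.1.2 (c.den s)
    rw [bound_congr (g := s.reg) fun r hr => reg_den (hc.2 r hr)] at h1
    exact add_le_add (ihc hc.1.1 s) h1
  | cond e c d ihc ihd =>
    simp only [stable, Bool.and_eq_true] at hc
    rw [cost, bound]
    have h1 := ihc hc.1 s
    have h2 := ihd hc.2 s
    split_ifs <;> omega
  | bfor i r c ih =>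
    simp only [stable, Bool.and_eq_true, List.all_eq_true, Bool.not_eq_true', List.contains_eq_mem,
      decide_eq_false_iff_not] at hc
    rw [cost, bound]
    refine Nat.add_le_add_left ?_ _
    refine (Finset.sum_le_card_nsmul _ _ (c.bound s.reg + 4) fun j _ => ?_).trans_eq (by simp)
    have h1 := ih hc.1.1 ((step i c)^[j] (s.setReg i 0))
    rw [bound_congr (g := s.reg) fun x hx =>
      (reg_step hc.2 s j (r := r)).2 x (hc.1.2 x hx)] at h1
    omega

/-! ### Verification of commands -/

/-- Started in `s`, the command respects the bound on factors and ends in a state with `Q`. -/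
def Spec (Y : ℕ) (c : Cmd) (s : RAM) (Q : RAM → Prop) : Prop := c.Ok Y s ∧ Q (c.den s)

variable {Y : ℕ} {s : RAM} {Q : RAM → Prop}

@[simp] lemma spec_skip : Spec Y skip s Q ↔ Q s := by simp [Spec, Ok, den]

@[simp] lemma spec_set {r : ℕ} {e : Expr} :
    Spec Y (set r e) s Q ↔ e.Ok Y s ∧ Q (s.setReg r (e.eval s)) := Iff.rfl

@[simp] lemma spec_store {a e : Expr} :
    Spec Y (store a e) s Q ↔ (a.Ok Y s ∧ e.Ok Y s) ∧ Q (s.setMem (a.eval s) (e.eval s)) := Iff.rfl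

@[simp] lemma spec_seq {c d : Cmd} :
    Spec Y (seq c d) s Q ↔ Spec Y c s fun s' => Spec Y d s' Q := and_assoc

@[simp] lemma spec_cond {e : Expr} {c d : Cmd} : Spec Y (cond e c d) s Q ↔
    e.Ok Y s ∧ (e.eval s ≠ 0 → Spec Y c s Q) ∧ (e.eval s = 0 → Spec Y d s Q) := by
  simp only [Spec, Ok, den]
  split_ifs with h <;> tauto

lemma Spec.mono {c : Cmd} {Q' : RAM → Prop} (h : Spec Y c s Q')
    (hQ : ∀ s', Q' s' → (∀ x ∉ c.wr, s'.reg x = s.reg x) → (c.pure = true → s'.mem = s.mem) → Q s') :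
    Spec Y c s Q := ⟨h.1, hQ _ h.2 (fun _ hx => reg_den hx) mem_den⟩

/-- The invariant rule for loops. The frame conditions are built in, so an invariant needs to
mention only what the body changes. -/
theorem spec_bfor (Inv : ℕ → RAM → Prop) {i r n : ℕ} {c : Cmd} (hi : i ∉ c.wr)
    (hn : s.reg r = n) (h0 : Inv 0 (s.setReg i 0))
    (hstep : ∀ j < n, ∀ s' : RAM, s'.reg i = j → (∀ x ∉ i :: c.wr, s'.reg x = s.reg x) →
      (c.pure = true → s'.mem = s.mem) → Inv j s' →
      Spec Y c s' fun s'' => Inv (j + 1) (s''.setReg i (j + 1)))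
    (hQ : ∀ s' : RAM, (∀ x ∉ i :: c.wr, s'.reg x = s.reg x) → (c.pure = true → s'.mem = s.mem) →
      Inv n s' → Q s') : Spec Y (bfor i r c) s Q := by
  have hfr := fun j => reg_step hi s j (r := r)
  have hmem : c.pure = true → ∀ j, ((step i c)^[j] (s.setReg i 0)).mem = s.mem := by
    intro hp j
    induction j with
    | zero => rfl
    | succ j ih => rw [Function.iterate_succ_apply', step, RAM.setReg_mem, mem_den hp, ih]
  have hinv : ∀ j ≤ n, Inv j ((step i c)^[j] (s.setReg i 0)) := by
    intro j
    induction j with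
    | zero => exact fun _ => h0
    | succ j ih =>
      intro hj
      have h1 := hstep j (by omega) _ (hfr j).1 (hfr j).2 (fun hp => hmem hp j) (ih (by omega))
      rw [Function.iterate_succ_apply', step, reg_den hi, (hfr j).1]
      exact h1.2
  refine ⟨fun j hj => ?_, ?_⟩
  · exact (hstep j (by omega) _ (hfr j).1 (hfr j).2 (fun hp => hmem hp j) (hinv j (by omega))).1
  · rw [den_bfor, hn]
    exact hQ _ (hfr n).2 (fun hp => hmem hp n) (hinv n le_rfl)

end Cmd

/-! ### The program -/

notation "xOut" => (0 : ℕ)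
notation "xH" => (1 : ℕ)
notation "xFlag" => (2 : ℕ)
notation "xN" => (3 : ℕ)
notation "xD" => (4 : ℕ)
notation "xMn" => (5 : ℕ)
notation "xMd" => (6 : ℕ)
notation "xP" => (7 : ℕ)
notation "xQ" => (8 : ℕ)
notation "xE" => (9 : ℕ)
notation "xIt" => (10 : ℕ)
notation "xK" => (11 : ℕ)
notation "xKK" => (12 : ℕ)
notation "xT" => (13 : ℕ)
notation "xU" => (14 : ℕ)
notation "xW" => (15 : ℕ)
notation "xJ" => (16 : ℕ)
notation "xSrc" => (17 : ℕ)
notation "xDst" => (18 : ℕ)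
notation "xA" => (19 : ℕ)
notation "xB" => (20 : ℕ)
notation "xRow" => (21 : ℕ)
notation "xVal" => (22 : ℕ)
notation "xI" => (23 : ℕ)
notation "xL" => (24 : ℕ)
notation "xCnt" => (25 : ℕ)
notation "xFrom" => (26 : ℕ)
notation "xTo" => (27 : ℕ)
notation "xTmp" => (28 : ℕ)

infixr:60 ";;" => Cmd.seq

namespace Cmd

open BiddingMDP.Expr

/-- The entry `k` of the input for the current pair of vertices. -/
def edgeEntry (k : ℕ) : Expr :=
  load ((reg xU * reg xN + reg xW) * lit 3 + (reg xN + reg xN + lit (6 + k)))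

/-- The entry `k` of the input for the current vertex. -/
def vertexEntry (k : ℕ) : Expr := load (reg xU + reg xU + lit (6 + k))

@[simp] lemma eval_edgeEntry (k : ℕ) (s : RAM) : (edgeEntry k).eval s =
    s.mem (6 + 2 * s.reg xN + 3 * (s.reg xU * s.reg xN + s.reg xW) + k) := by
  simp only [edgeEntry, eval_load, eval_add, eval_mul, eval_reg, eval_lit]
  congr 1; ring

@[simp] lemma ok_edgeEntry (k Y : ℕ) (s : RAM) :
    (edgeEntry k).Ok Y s ↔ s.reg xN ≤ Y ∧ 3 ≤ Y := by
  simp [edgeEntry]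

@[simp] lemma eval_vertexEntry (k : ℕ) (s : RAM) : (vertexEntry k).eval s =
    s.mem (6 + 2 * s.reg xU + k) := by
  simp only [vertexEntry, eval_load, eval_add, eval_reg, eval_lit]
  congr 1; ring

@[simp] lemma ok_vertexEntry (k Y : ℕ) (s : RAM) : (vertexEntry k).Ok Y s ↔ True := by
  simp [vertexEntry]

/-- Minimum and maximum of the right boundaries of the successors in row `xRow`. -/
def loHi : Cmd :=
  set xA (reg xK) ;; set xB (lit 0) ;;
  bfor xW xN (cond (edgeEntry 0)
    (set xVal (load (reg xSrc + (reg xW + reg xW + lit 1) * reg xK + reg xRow)) ;;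
      set xA (emin (reg xA) (reg xVal)) ;; set xB (emax (reg xB) (reg xVal)))
    skip)

/-- Weighted sum of the lower boundaries of the successors in column `xRow`, as a fraction. -/
def sums : Cmd :=
  set xA (lit 0) ;; set xB (lit 1) ;;
  bfor xW xN (set xVal (load (reg xSrc + (reg xW + reg xW) * reg xK + reg xRow)) ;;
    set xA (reg xA * edgeEntry 2 + reg xB * edgeEntry 1 * reg xVal) ;;
    set xB (reg xB * edgeEntry 2))

/-- The conjugate of the row at address `xFrom` is written to address `xTo`. -/
def conjugate : Cmd :=
  set xI (lit 0) ;; set xL (lit 0) ;;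
  bfor xCnt xKK (cond (lt (reg xL) (reg xK))
    (cond ((reg xK - reg xI) * (reg xL + lit 1 - load (reg xFrom + reg xI)))
      (set xI (reg xI + lit 1))
      (store (reg xTo + reg xL) (reg xI) ;; set xL (reg xL + lit 1)))
    skip)

/-- The staircase is walked along in `2K` unit moves: to the right while `f i ≤ l`, otherwise up,
and when row `l` is left the column count is its conjugate value. Hence conjugation is linear in
`K`. `A` marks the addresses that already have their intended contents `F`. -/
theorem spec_conjugate {Y K : ℕ} {f F : ℕ → ℕ} {A : ℕ → Prop} {s : RAM} (hK : s.reg xK = K)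
    (hKK : s.reg xKK = 2 * K) (hKY : K ≤ Y) (hf : ∀ i i', i ≤ i' → i' < K → f i ≤ f i')
    (hA : ∀ a, A a → s.mem a = F a) (hfr : ∀ i < K, A (s.reg xFrom + i) ∧ F (s.reg xFrom + i) = f i)
    (hto : ∀ j < K, F (s.reg xTo + j) = conj K f j) :
    Spec Y conjugate s fun s' =>
      ∀ a, (A a ∨ s.reg xTo ≤ a ∧ a < s.reg xTo + K) → s'.mem a = F a := by
  simp only [conjugate, spec_seq, spec_set, ok_lit, eval_lit, true_and]
  refine spec_bfor (fun cnt s' => s'.reg xI ≤ K ∧ s'.reg xL ≤ K ∧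
    (s'.reg xL = K ∨ s'.reg xI + s'.reg xL = cnt) ∧
    (s'.reg xL < K → s'.reg xI ≤ conj K f (s'.reg xL)) ∧
    ∀ a, (A a ∨ s.reg xTo ≤ a ∧ a < s.reg xTo + s'.reg xL) → s'.mem a = F a) (n := 2 * K)
    (by decide) (by simpa using hKK) ?_ ?_ ?_
  · refine ⟨by simp, by simp, Or.inr (by simp), by simp, fun a ha => ?_⟩
    rcases ha with ha | ha
    · exact hA a ha
    · simp at ha; omega
  · rintro cnt hcnt s' - hfix - ⟨h1, h2, h3, h4, h5⟩
    have e1 := hfix xK (by decide)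
    have e2 := hfix xFrom (by decide)
    have e3 := hfix xTo (by decide)
    simp only [RAM.setReg_reg] at e1 e2 e3
    norm_num at e1 e2 e3
    simp only [spec_cond, spec_seq, spec_set, spec_store, spec_skip, eval_lt,
      eval_lt_eq_zero, ok_lt]
    simp only [ok_reg, ok_lit, ok_mul, ok_sub, ok_add, ok_load, eval_reg, eval_lit, eval_mul,
      eval_sub, eval_add, eval_load, true_and, and_true, e1, e2, e3, hK, RAM.setReg_reg,
      RAM.setReg_mem, RAM.setMem_reg, RAM.setMem_mem]
    norm_num
    refine ⟨fun hl => ⟨by omega, fun hi hv => ?_, fun hz => ?_⟩, fun hl => ?_⟩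
    · rw [h5 _ (Or.inl (hfr _ (by omega)).1), (hfr _ (by omega)).2] at hv
      have h6 := (lt_conj hf (by omega : s'.reg xI < K)).2 (by omega : f (s'.reg xI) ≤ s'.reg xL)
      exact ⟨by omega, h2, by omega, fun _ => h6, h5⟩
    · have h6 : s'.reg xI = conj K f (s'.reg xL) := by
        refine le_antisymm (h4 hl) ?_
        by_contra hcon
        have h7 : s'.reg xI < K := (not_le.1 hcon).trans_le (conj_le _ _ _)
        have h8 := (lt_conj hf h7).1 (not_le.1 hcon)
        rw [h5 _ (Or.inl (hfr _ h7).1), (hfr _ h7).2] at hz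
        omega
      refine ⟨h1, by omega, by omega, fun _ => ?_, fun a ha => ?_⟩
      · rw [h6]
        exact Finset.card_le_card fun k hk => by
          simp only [Finset.mem_filter, Finset.mem_range] at hk ⊢
          omega
      · split_ifs with hae
        · rw [hae, hto _ hl, ← h6]
        · exact h5 a (ha.imp_right fun ha => ⟨ha.1, by omega⟩)
    · exact ⟨h1, h2, by omega, fun h => absurd h (by omega), h5⟩
  · rintro s' - - ⟨h1, h2, h3, h4, h5⟩ a ha
    exact h5 a (by rw [show s'.reg xL = K by omega]; exact ha)

end Cmd

/-! ### Memory layout and the computation of the blocks. -/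

namespace RatInstance

variable (I : RatInstance)

/-- The length of the encoding. -/
def len : ℕ := 6 + 2 * I.N + 3 * (I.N * I.N)

lemma edge_lt {u w k : ℕ} (hu : u < I.N) (hw : w < I.N) (hk : k < 3) :
    6 + 2 * I.N + 3 * (u * I.N + w) + k < I.len := by
  have : (u + 1) * I.N ≤ I.N * I.N := Nat.mul_le_mul_right _ hu
  rw [len]
  lia

lemma vertex_lt {u k : ℕ} (hu : u < I.N) (hk : k < 2) : 6 + 2 * u + k < I.len := by
  rw [len]
  omega

/-- The intended contents of the memory: the input, followed by the lower boundaries and the right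
boundaries of all abstract values, in the order of the iterations. -/
def memSpec (K a : ℕ) : ℕ :=
  if a < I.len then I.input a
  else if (a - I.len) / K % 2 = 0 then
    (I.data.iter K ((a - I.len) / K / 2 / I.N)).1 ((a - I.len) / K / 2 % I.N) ((a - I.len) % K)
  else
    (I.data.iter K ((a - I.len) / K / 2 / I.N)).2 ((a - I.len) / K / 2 % I.N) ((a - I.len) % K)

lemma memSpec_input {K a : ℕ} (h : a < I.len) : I.memSpec K a = I.input a := if_pos h

/-- Division with remainder recovers iteration, vertex, kind of boundary and position from the
address. -/
lemma memSpec_block {K t u k i : ℕ} (hu : u < I.N) (hk : k < 2) (hi : i < K) :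
    I.memSpec K (I.len + (2 * (t * I.N + u) + k) * K + i) =
      if k = 0 then (I.data.iter K t).1 u i else (I.data.iter K t).2 u i := by
  have hN : 0 < I.N := by omega
  have e1 : I.len + (2 * (t * I.N + u) + k) * K + i - I.len =
      i + K * (2 * (t * I.N + u) + k) := by rw [Nat.add_assoc, Nat.add_sub_cancel_left]; ring
  have e2 : (i + K * (2 * (t * I.N + u) + k)) / K = 2 * (t * I.N + u) + k := by
    rw [Nat.add_mul_div_left _ _ (by omega), Nat.div_eq_of_lt hi, zero_add]
  have e3 : (i + K * (2 * (t * I.N + u) + k)) % K = i := by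
    rw [Nat.add_mul_mod_self_left, Nat.mod_eq_of_lt hi]
  have e4 : (2 * (t * I.N + u) + k) / 2 = u + I.N * t := by rw [mul_comm I.N]; omega
  have e5 : (u + I.N * t) / I.N = t := by
    rw [Nat.add_mul_div_left _ _ hN, Nat.div_eq_of_lt hu, zero_add]
  have e6 : (u + I.N * t) % I.N = u := by rw [Nat.add_mul_mod_self_left, Nat.mod_eq_of_lt hu]
  have e7 : (2 * (t * I.N + u) + k) % 2 = k := by omega
  rw [memSpec, if_neg (by rw [Nat.add_assoc]; omega), e1, e2, e3, e4, e5, e6, e7]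

lemma block_lt {K t u k i : ℕ} (hu : u < I.N) (hk : k < 2) (hi : i < K) :
    I.len + (2 * (t * I.N + u) + k) * K + i < I.len + 2 * ((t + 1) * I.N) * K := by
  have h1 : (2 * (t * I.N + u) + k + 1) * K ≤ 2 * ((t + 1) * I.N) * K := by
    refine Nat.mul_le_mul_right _ ?_
    rw [add_mul]; omega
  rw [add_mul _ 1 K] at h1
  omega

/-- Bounds needed for the multiplications of a round with `K` grid cells per side. -/
structure Caps (K Y : ℕ) : Prop where
  pos : 0 < K
  eight : 8 ≤ Y
  vertices : I.N ≤ Y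
  cells : K ≤ Y
  input : ∀ a, I.input a ≤ Y

/-- The registers that are fixed in the main part of a round. -/
structure Regs (K : ℕ) (s : RAM) : Prop where
  vertices : s.reg xN = I.N
  cells : s.reg xK = K
  cells2 : s.reg xKK = 2 * K

variable {I} {K Y t u : ℕ} {s : RAM}

lemma iter_boundary (hc : I.Caps K Y) (t : ℕ) (hu : u < I.N) :
    Boundary K ((I.data.iter K t).1 u) ((I.data.iter K t).2 u) :=
  (I.absSval_isCells hc.pos t ⟨u, hu⟩).1

open Cmd BiddingMDP.Expr

theorem spec_loHi (hc : I.Caps K Y) (hr : I.Regs K s) (hu : s.reg xU = u) (huN : u < I.N)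
    (hrow : s.reg xRow < K) (hsrc : s.reg xSrc = I.len + 2 * (t * I.N) * K)
    (hmem : ∀ a < I.len + 2 * ((t + 1) * I.N) * K, s.mem a = I.memSpec K a) :
    Spec Y loHi s fun s' =>
      s'.reg xA = I.data.lo K (I.data.iter K t).2 u (s.reg xRow) I.N ∧
      s'.reg xB = I.data.hi (I.data.iter K t).2 u (s.reg xRow) I.N := by
  have h3 : 3 ≤ Y := by have := hc.eight; omega
  have h3' := hc.vertices
  have h3'' := hc.cells
  simp only [loHi, spec_seq, spec_set, ok_lit, ok_reg, eval_lit, eval_reg, true_and, hr.cells]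
  refine spec_bfor (fun w s' =>
    s'.reg xA = I.data.lo K (I.data.iter K t).2 u (s.reg xRow) w ∧
    s'.reg xB = I.data.hi (I.data.iter K t).2 u (s.reg xRow) w) (n := I.N)
    (by decide) (by simpa using hr.vertices) ?_ ?_ ?_
  · simp [GridData.lo, GridData.hi]
  · rintro w hw s' hw' hfix hm ⟨h1, h2⟩
    have hm := hm (by decide)
    have e1 := hfix xN (by decide)
    have e2 := hfix xU (by decide)
    have e3 := hfix xSrc (by decide)
    have e4 := hfix xK (by decide)
    have e5 := hfix xRow (by decide)
    simp only [RAM.setReg_reg] at e1 e2 e3 e4 e5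
    norm_num at e1 e2 e3 e4 e5
    rw [hr.vertices] at e1
    rw [hu] at e2
    rw [hsrc] at e3
    rw [hr.cells] at e4
    have hval : s'.mem (I.len + 2 * (t * I.N) * K + (w + w + 1) * K + s.reg xRow) =
        (I.data.iter K t).2 w (s.reg xRow) := by
      have h4 := I.block_lt (t := t) hw (by omega : 1 < 2) hrow
      have h5 := I.memSpec_block (t := t) hw (by omega : 1 < 2) hrow
      rw [show I.len + 2 * (t * I.N) * K + (w + w + 1) * K + s.reg xRow =
        I.len + (2 * (t * I.N + w) + 1) * K + s.reg xRow by ring, hm, RAM.setReg_mem,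
        RAM.setReg_mem, hmem _ h4, h5]
      rfl
    have hed : s'.mem (6 + 2 * I.N + 3 * (u * I.N + w)) = I.data.ed u w := by
      have h4 := I.edge_lt huN hw (by omega : 0 < 3)
      rw [hm, RAM.setReg_mem, RAM.setReg_mem, hmem _ (by omega), I.memSpec_input (by omega)]
      rfl
    simp only [spec_cond, spec_seq, spec_set, spec_skip, ok_edgeEntry, eval_edgeEntry, e1, e2, hw',
      hed, add_zero]
    simp only [ok_reg, ok_lit, ok_mul, ok_add, ok_load, ok_emin, ok_emax, eval_reg, eval_lit,
      eval_mul, eval_add, eval_load, eval_emin, eval_emax, RAM.setReg_reg, hw', e3,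
      e4, e5]
    norm_num
    simp only [hval, h1, h2, h3, h3', h3'', GridData.lo, GridData.hi]
    simp +contextual
  · rintro s' - - h
    exact h

/-- The order of the factors matters: the growing numerators and denominators always stand first,
and the second factors are small constants, input numbers or boundaries below `K`. -/
theorem spec_sums (hc : I.Caps K Y) (hr : I.Regs K s) (hu : s.reg xU = u) (huN : u < I.N)
    (hrow : s.reg xRow < K) (hsrc : s.reg xSrc = I.len + 2 * (t * I.N) * K)
    (hmem : ∀ a < I.len + 2 * ((t + 1) * I.N) * K, s.mem a = I.memSpec K a) :
    Spec Y sums s fun s' =>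
      s'.reg xA = I.data.sumNum (I.data.iter K t).1 u (s.reg xRow) I.N ∧
      s'.reg xB = I.data.sumDen u I.N := by
  have h3 : 3 ≤ Y := by have := hc.eight; omega
  have h3' := hc.vertices
  have h3'' := hc.cells
  simp only [sums, spec_seq, spec_set, ok_lit, eval_lit, true_and]
  refine spec_bfor (fun w s' =>
    s'.reg xA = I.data.sumNum (I.data.iter K t).1 u (s.reg xRow) w ∧
    s'.reg xB = I.data.sumDen u w) (n := I.N)
    (by decide) (by simpa using hr.vertices) ?_ ?_ ?_
  · simp [GridData.sumNum, GridData.sumDen]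
  · rintro w hw s' hw' hfix hm ⟨h1, h2⟩
    have hm := hm (by decide)
    have e1 := hfix xN (by decide)
    have e2 := hfix xU (by decide)
    have e3 := hfix xSrc (by decide)
    have e4 := hfix xK (by decide)
    have e5 := hfix xRow (by decide)
    simp only [RAM.setReg_reg] at e1 e2 e3 e4 e5
    norm_num at e1 e2 e3 e4 e5
    rw [hr.vertices] at e1
    rw [hu] at e2
    rw [hsrc] at e3
    rw [hr.cells] at e4
    have hval : s'.mem (I.len + 2 * (t * I.N) * K + (w + w) * K + s.reg xRow) =
        (I.data.iter K t).1 w (s.reg xRow) := by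
      have h4 := I.block_lt (t := t) hw (by omega : 0 < 2) hrow
      have h5 := I.memSpec_block (t := t) hw (by omega : 0 < 2) hrow
      rw [show I.len + 2 * (t * I.N) * K + (w + w) * K + s.reg xRow =
        I.len + (2 * (t * I.N + w) + 0) * K + s.reg xRow by ring, hm, RAM.setReg_mem,
        RAM.setReg_mem, hmem _ h4, h5]
      rfl
    have hin : ∀ k < 3, s'.mem (6 + 2 * I.N + 3 * (u * I.N + w) + k) =
        I.input (6 + 2 * I.N + 3 * (u * I.N + w) + k) := by
      intro k hk
      have h4 := I.edge_lt huN hw hk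
      rw [hm, RAM.setReg_mem, RAM.setReg_mem, hmem _ (by omega), I.memSpec_input h4]
    have hnum : s'.mem (6 + 2 * I.N + 3 * (u * I.N + w) + 1) = I.data.num u w := hin 1 (by omega)
    have hden : s'.mem (6 + 2 * I.N + 3 * (u * I.N + w) + 2) = I.data.den u w := hin 2 (by omega)
    have hnY : I.data.num u w ≤ Y := hc.input _
    have hdY : I.data.den u w ≤ Y := hc.input _
    have hmY : (I.data.iter K t).1 w (s.reg xRow) ≤ Y :=
      ((iter_boundary hc t hw).lt hrow).le.trans h3''
    simp only [spec_seq, spec_set]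
    simp only [ok_reg, ok_mul, ok_add, ok_load, eval_reg, ok_edgeEntry,
      eval_mul, eval_add, eval_load, eval_edgeEntry, RAM.setReg_reg, RAM.setReg_mem, hw', e1, e2,
      e3, e4, e5]
    norm_num
    simp only [hval, hnum, hden, h1, h2, h3, h3', h3'', hnY, hdY, hmY, GridData.sumNum,
      GridData.sumDen, and_self, true_and, and_true]
    ring
  · rintro s' - - h
    exact h

end RatInstance

namespace Cmd

open BiddingMDP.Expr

/-- The boundaries of a control vertex. -/
def ctrlBlock : Cmd :=
  bfor xJ xK (set xRow (emin (reg xJ + lit 1) (reg xK - lit 1)) ;; loHi ;;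
    store (reg xDst + reg xK + reg xJ) (emin (reg xK) ((reg xA + reg xB) / lit 2 + lit 1))) ;;
  set xFrom (reg xDst + reg xK) ;; set xTo (reg xDst) ;; conjugate

/-- The boundaries of a random vertex. -/
def randBlock : Cmd :=
  bfor xJ xK (set xRow (reg xJ - lit 1) ;; sums ;;
    store (reg xDst + reg xJ) ((reg xA - lit 1) / reg xB)) ;;
  set xFrom (reg xDst) ;; set xTo (reg xDst + reg xK) ;; conjugate

/-- The initial boundaries of a vertex. -/
def initBlock : Cmd :=
  bfor xJ xK (store (reg xDst + reg xJ)
    (emin (lit 1) (emin (vertexEntry 1) (reg xJ)) * (reg xK - lit 1))) ;;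
  set xFrom (reg xDst) ;; set xTo (reg xDst + reg xK) ;; conjugate

/-- Value iteration. -/
def iteration : Cmd :=
  set xSrc (reg xD) ;; set xDst (reg xD) ;;
  bfor xU xN (initBlock ;; set xDst (reg xDst + reg xKK)) ;;
  bfor xT xIt (
    bfor xU xN (cond (vertexEntry 0) ctrlBlock randBlock ;; set xDst (reg xDst + reg xKK)) ;;
    set xSrc (reg xSrc + (reg xN + reg xN) * reg xK))

end Cmd

namespace RatInstance

open Cmd BiddingMDP.Expr

variable {I : RatInstance} {K Y t u : ℕ} {s : RAM}

lemma memSpec_lower (hu : u < I.N) {i : ℕ} (hi : i < K) :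
    I.memSpec K (I.len + 2 * (t * I.N + u) * K + i) = (I.data.iter K t).1 u i := by
  have := I.memSpec_block (t := t) hu (by omega : 0 < 2) hi
  rwa [add_zero, if_pos rfl] at this

lemma memSpec_right (hu : u < I.N) {i : ℕ} (hi : i < K) :
    I.memSpec K (I.len + 2 * (t * I.N + u) * K + K + i) = (I.data.iter K t).2 u i := by
  have := I.memSpec_block (t := t) hu (by omega : 1 < 2) hi
  rw [if_neg (by omega)] at this
  rw [← this]
  congr 1; ring

/-- Adjointness makes the two boundaries conjugate to each other, whichever of them was computed
directly. -/
lemma iter_conj (hc : I.Caps K Y) (hu : u < I.N) {i : ℕ} (hi : i < K) :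
    (I.data.iter K t).2 u i = conj K ((I.data.iter K t).1 u) i := by
  have hb := iter_boundary hc t hu
  have h2 := hb.le hi
  have h4 := conj_le K ((I.data.iter K t).1 u) i
  refine le_antisymm ?_ ?_ <;> by_contra hcon
  · have h1 : conj K ((I.data.iter K t).1 u) i < K := by omega
    exact absurd ((lt_conj (fun _ _ => hb.mono) h1).2 ((hb.adj h1 hi).2 (not_le.1 hcon)))
      (lt_irrefl _)
  · have h1 : (I.data.iter K t).2 u i < K := by omega
    have h3 := (hb.adj h1 hi).1 ((lt_conj (fun _ _ => hb.mono) h1).1 (not_le.1 hcon))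
    omega

lemma iter_conj' (hc : I.Caps K Y) (hu : u < I.N) {i : ℕ} (hi : i < K) :
    (I.data.iter K t).1 u i = conj K ((I.data.iter K t).2 u) i := by
  have hb := iter_boundary hc t hu
  have hm : ∀ j j', j ≤ j' → j' < K → (I.data.iter K t).2 u j ≤ (I.data.iter K t).2 u j' :=
    fun _ _ => hb.c_mono
  have h2 := hb.lt hi
  have h4 := conj_le K ((I.data.iter K t).2 u) i
  refine le_antisymm ?_ ?_ <;> by_contra hcon
  · have h1 : conj K ((I.data.iter K t).2 u) i < K := by omega
    have h3 := (lt_conj hm h1 (j := i)).not.1 (lt_irrefl _)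
    have h5 := (hb.adj hi h1).2 (not_le.1 h3)
    omega
  · have h3 := (lt_conj hm h2).1 (not_le.1 hcon)
    have h5 := (hb.adj hi h2).1 le_rfl
    omega

/-- The registers and the memory when the block of vertex `u` in iteration `t` is computed. -/
structure AtBlock (I : RatInstance) (K t u : ℕ) (s : RAM) : Prop where
  regs : I.Regs K s
  vertex : s.reg xU = u
  lt : u < I.N
  dst : s.reg xDst = I.len + 2 * (t * I.N + u) * K
  mem : ∀ a < I.len + 2 * (t * I.N + u) * K, s.mem a = I.memSpec K a

lemma next_block : I.len + 2 * (t * I.N + (u + 1)) * K =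
    I.len + 2 * (t * I.N + u) * K + K + K := by ring

theorem spec_conjugate_right (hc : I.Caps K Y) (hr : I.Regs K s) (hu : u < I.N)
    (hfrom : s.reg xFrom = I.len + 2 * (t * I.N + u) * K)
    (hto : s.reg xTo = I.len + 2 * (t * I.N + u) * K + K)
    (hmem : ∀ a < I.len + 2 * (t * I.N + u) * K + K, s.mem a = I.memSpec K a) :
    Spec Y conjugate s fun s' =>
      ∀ a < I.len + 2 * (t * I.N + (u + 1)) * K, s'.mem a = I.memSpec K a := by
  refine (spec_conjugate (f := (I.data.iter K t).1 u) hr.cells hr.cells2 hc.cells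
    (fun _ _ => (iter_boundary hc t hu).mono) hmem (fun i hi => ?_) fun j hj => ?_).mono
    fun s' h _ _ a ha => h a ?_
  · rw [hfrom]
    exact ⟨by omega, memSpec_lower hu hi⟩
  · rw [hto, memSpec_right hu hj, iter_conj hc hu hj]
  · rw [next_block] at ha
    rw [hto]
    omega

theorem spec_conjugate_lower (hc : I.Caps K Y) (hr : I.Regs K s) (hu : u < I.N)
    (hfrom : s.reg xFrom = I.len + 2 * (t * I.N + u) * K + K)
    (hto : s.reg xTo = I.len + 2 * (t * I.N + u) * K)
    (hmem : ∀ a, (a < I.len + 2 * (t * I.N + u) * K ∨ I.len + 2 * (t * I.N + u) * K + K ≤ a ∧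
      a < I.len + 2 * (t * I.N + u) * K + K + K) → s.mem a = I.memSpec K a) :
    Spec Y conjugate s fun s' =>
      ∀ a < I.len + 2 * (t * I.N + (u + 1)) * K, s'.mem a = I.memSpec K a := by
  refine (spec_conjugate (f := (I.data.iter K t).2 u) hr.cells hr.cells2 hc.cells
    (fun _ _ => (iter_boundary hc t hu).c_mono) hmem (fun i hi => ?_) fun j hj => ?_).mono
    fun s' h _ _ a ha => h a ?_
  · rw [hfrom]
    exact ⟨by omega, memSpec_right hu hi⟩
  · rw [hto, memSpec_lower hu hj, iter_conj' hc hu hj]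
  · rw [next_block] at ha
    rw [hto]
    omega

theorem spec_initBlock (hc : I.Caps K Y) (h : AtBlock I K 0 u s) :
    Spec Y initBlock s fun s' =>
      ∀ a < I.len + 2 * (0 * I.N + (u + 1)) * K, s'.mem a = I.memSpec K a := by
  have hr := h.regs
  simp only [initBlock, spec_seq]
  refine spec_bfor (fun j s' => ∀ a < I.len + 2 * (0 * I.N + u) * K + j, s'.mem a = I.memSpec K a)
    (n := K) (by decide) hr.cells h.mem ?_ ?_
  · rintro j hj s' hj' hfix - hm
    have e1 := hfix xDst (by decide)
    have e2 := hfix xU (by decide)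
    have e3 := hfix xK (by decide)
    rw [h.dst] at e1
    rw [h.vertex] at e2
    rw [hr.cells] at e3
    have hval : s'.mem (6 + 2 * u + 1) = I.data.tgt u := by
      have h1 := I.vertex_lt h.lt (by omega : 1 < 2)
      rw [hm _ (by omega), I.memSpec_input h1]
      rfl
    have hw := memSpec_lower (t := 0) h.lt hj
    have hKY := hc.cells
    simp only [spec_store, ok_add, ok_mul, ok_emin, ok_sub, ok_reg, ok_lit, ok_vertexEntry,
      eval_add, eval_mul, eval_emin, eval_sub, eval_reg, eval_lit, eval_vertexEntry, true_and, e1,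
      e2, e3, hj', hval]
    refine ⟨by omega, fun a ha => ?_⟩
    simp only [RAM.setReg_mem, RAM.setMem_mem]
    split_ifs with hae
    -- The minimum of `1`, the target flag and the column is `0` or `1` and selects between `0` and
    -- `K - 1`.
    · rw [hae, hw]
      simp only [GridData.iter, GridData.initRow]
      rcases Nat.eq_zero_or_pos (I.data.tgt u) with h0 | h0
      · simp [h0]
      · rcases Nat.eq_zero_or_pos j with h2 | h2
        · simp [h2]
        · rw [if_neg (by omega), min_eq_left (by omega), one_mul]
    · exact hm a (by omega)
  · rintro s' hfix - hm
    have e1 := hfix xDst (by decide)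
    have e3 := hfix xK (by decide)
    simp only [spec_set, ok_add, ok_reg, eval_reg, eval_add, true_and]
    refine spec_conjugate_right hc ⟨?_, ?_, ?_⟩ h.lt ?_ ?_ hm
    · rw [← hr.vertices, ← hfix xN (by decide)]; simp
    · rw [← hr.cells, ← hfix xK (by decide)]; simp
    · rw [← hr.cells2, ← hfix xKK (by decide)]; simp
    · rw [← h.dst, ← e1]; simp
    · rw [← h.dst, ← hr.cells, ← e1, ← e3]; simp

theorem spec_randBlock (hc : I.Caps K Y) (h : AtBlock I K (t + 1) u s)
    (hsrc : s.reg xSrc = I.len + 2 * (t * I.N) * K) (hctl : I.data.ctl u = 0) :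
    Spec Y randBlock s fun s' =>
      ∀ a < I.len + 2 * ((t + 1) * I.N + (u + 1)) * K, s'.mem a = I.memSpec K a := by
  have hr := h.regs
  have hle : 2 * ((t + 1) * I.N) * K ≤ 2 * ((t + 1) * I.N + u) * K :=
    Nat.mul_le_mul_right _ (by omega)
  simp only [randBlock, spec_seq]
  refine spec_bfor (fun j s' => ∀ a < I.len + 2 * ((t + 1) * I.N + u) * K + j,
    s'.mem a = I.memSpec K a) (n := K) (by decide) hr.cells h.mem ?_ ?_
  · rintro j hj s' hj' hfix - hm
    have e1 := hfix xDst (by decide)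
    have e2 := hfix xU (by decide)
    have e3 := hfix xK (by decide)
    have e4 := hfix xN (by decide)
    have e5 := hfix xKK (by decide)
    have e6 := hfix xSrc (by decide)
    rw [h.dst] at e1
    rw [h.vertex] at e2
    rw [hr.cells] at e3
    rw [hr.vertices] at e4
    rw [hr.cells2] at e5
    rw [hsrc] at e6
    have hw := memSpec_lower (t := t + 1) h.lt hj
    simp only [spec_seq, spec_set, ok_sub, ok_reg, ok_lit, eval_sub, eval_reg, eval_lit, true_and, hj']
    refine (spec_sums (u := u) (t := t) hc ⟨by simpa using e4, by simpa using e3, by simpa using e5⟩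
      (by simpa using e2) h.lt (by simp; omega) (by simpa using e6) fun a ha => ?_).mono ?_
    · exact hm a (by omega)
    rintro s₁ ⟨h1, h2⟩ hfix₁ hm₁
    have f1 := hfix₁ xDst (by decide)
    have f2 := hfix₁ xJ (by decide)
    simp only [RAM.setReg_reg] at f1 f2 h1
    norm_num at f1 f2 h1
    rw [e1] at f1
    rw [hj'] at f2
    simp only [spec_store, ok_add, ok_sub, ok_div, ok_reg, ok_lit, eval_add, eval_sub, eval_div,
      eval_reg, eval_lit, true_and, f1, f2, h1, h2]
    refine fun a ha => ?_
    simp only [RAM.setReg_mem, RAM.setMem_mem, hm₁ (by decide)]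
    split_ifs with hae
    · rw [hae, hw, GridData.iter]
      simp only [hctl, if_true]
      rfl
    · exact hm a (by omega)
  · rintro s' hfix - hm
    have e1 := hfix xDst (by decide)
    have e3 := hfix xK (by decide)
    simp only [spec_set, ok_add, ok_reg, eval_reg, eval_add, true_and]
    refine spec_conjugate_right hc ⟨?_, ?_, ?_⟩ h.lt ?_ ?_ hm
    · rw [← hr.vertices, ← hfix xN (by decide)]; simp
    · rw [← hr.cells, ← hfix xK (by decide)]; simp
    · rw [← hr.cells2, ← hfix xKK (by decide)]; simp
    · rw [← h.dst, ← e1]; simp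
    · rw [← h.dst, ← hr.cells, ← e1, ← e3]; simp

theorem spec_ctrlBlock (hc : I.Caps K Y) (h : AtBlock I K (t + 1) u s)
    (hsrc : s.reg xSrc = I.len + 2 * (t * I.N) * K) (hctl : I.data.ctl u ≠ 0) :
    Spec Y ctrlBlock s fun s' =>
      ∀ a < I.len + 2 * ((t + 1) * I.N + (u + 1)) * K, s'.mem a = I.memSpec K a := by
  have hr := h.regs
  have hle : 2 * ((t + 1) * I.N) * K ≤ 2 * ((t + 1) * I.N + u) * K :=
    Nat.mul_le_mul_right _ (by omega)
  simp only [ctrlBlock, spec_seq]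
  -- The right boundary is written first, into the upper half of the block, so the invariant leaves
  -- out the lower half until the conjugation.
  refine spec_bfor (fun j s' => ∀ a, (a < I.len + 2 * ((t + 1) * I.N + u) * K ∨
    I.len + 2 * ((t + 1) * I.N + u) * K + K ≤ a ∧ a < I.len + 2 * ((t + 1) * I.N + u) * K + K + j) →
    s'.mem a = I.memSpec K a) (n := K) (by decide) hr.cells
    (fun a ha => h.mem a (by omega)) ?_ ?_
  · rintro j hj s' hj' hfix - hm
    have e1 := hfix xDst (by decide)
    have e2 := hfix xU (by decide)
    have e3 := hfix xK (by decide)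
    have e4 := hfix xN (by decide)
    have e5 := hfix xKK (by decide)
    have e6 := hfix xSrc (by decide)
    rw [h.dst] at e1
    rw [h.vertex] at e2
    rw [hr.cells] at e3
    rw [hr.vertices] at e4
    rw [hr.cells2] at e5
    rw [hsrc] at e6
    have hw := memSpec_right (t := t + 1) h.lt hj
    simp only [spec_seq, spec_set, ok_sub, ok_reg, ok_lit, ok_emin, ok_add, eval_emin, eval_add, eval_sub,
      eval_reg, eval_lit, true_and, hj', e3]
    refine (spec_loHi (u := u) (t := t) hc ⟨by simpa using e4, by simpa using e3, by simpa using e5⟩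
      (by simpa using e2) h.lt (by simp; omega) (by simpa using e6) fun a ha => ?_).mono ?_
    · exact hm a (by omega)
    rintro s₁ ⟨h1, h2⟩ hfix₁ hm₁
    have f1 := hfix₁ xDst (by decide)
    have f2 := hfix₁ xJ (by decide)
    have f3 := hfix₁ xK (by decide)
    simp only [RAM.setReg_reg] at f1 f2 f3 h1 h2
    norm_num at f1 f2 f3 h1 h2
    rw [e1] at f1
    rw [hj'] at f2
    rw [e3] at f3
    simp only [spec_store, ok_add, ok_emin, ok_div, ok_reg, ok_lit, eval_add, eval_emin, eval_div,
      eval_reg, eval_lit, true_and, f1, f2, f3]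
    refine fun a ha => ?_
    simp only [RAM.setReg_mem, RAM.setMem_mem, hm₁ (by decide)]
    split_ifs with hae
    · rw [hae, hw, GridData.iter]
      simp only [hctl, if_false, GridData.ctrlRow]
      simp only [h1, h2]
      rfl
    · exact hm a (by omega)
  · rintro s' hfix - hm
    have e1 := hfix xDst (by decide)
    have e3 := hfix xK (by decide)
    simp only [spec_set, ok_add, ok_reg, eval_reg, eval_add, true_and]
    refine spec_conjugate_lower hc ⟨?_, ?_, ?_⟩ h.lt ?_ ?_ hm
    · rw [← hr.vertices, ← hfix xN (by decide)]; simp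
    · rw [← hr.cells, ← hfix xK (by decide)]; simp
    · rw [← hr.cells2, ← hfix xKK (by decide)]; simp
    · rw [← h.dst, ← hr.cells, ← e1, ← e3]; simp
    · rw [← h.dst, ← e1]; simp

end RatInstance

/-! ### The rounds, the preliminary computations and their correctness. -/

namespace Cmd

open BiddingMDP.Expr

/-- The number of iterations and the number of cells of the next round. -/
def setup : Cmd :=
  set xH (reg xH + lit 1) ;; set xE (reg xE + reg xE) ;;
  set xIt (reg xH + reg xH + (reg xP * reg xH * lit 8 + (reg xQ - lit 1)) / reg xQ) ;;
  set xK (reg xE * reg xIt) ;; set xKK (reg xK + reg xK)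

/-- The test at the end of a round; `xFlag` is `0` if there is an answer, which is in `xOut`. -/
def answer : Cmd :=
  set xFlag (lit 0) ;; set xOut (lit 1) ;;
  set xA ((load (lit 2) * reg xK + (load (lit 3) - lit 1)) / load (lit 3)) ;;
  set xB (load (lit 4) * reg xK / load (lit 5)) ;;
  set xU (load (lit 1)) ;;
  set xFrom (reg xSrc + (reg xU + reg xU) * reg xK) ;;
  set xTmp (reg xIt + reg xIt) ;;
  cond (vertexEntry 1) skip (cond (load (lit 4)) (cond (lt (load (lit 2)) (load (lit 3)))
    (cond (lt (emin (reg xB) (reg xK - lit 1)) (load (reg xFrom + (reg xA - lit 1)))) skip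
      (set xOut (lit 0) ;;
        cond (lt (reg xK) (reg xA + reg xTmp)) (set xFlag (lit 1))
          (cond (lt (reg xB) (reg xTmp)) (set xFlag (lit 1))
            (cond (lt (reg xB - reg xTmp) (load (reg xFrom + (reg xA + reg xTmp - lit 1))))
              (set xFlag (lit 1)) skip))))
    skip) skip)

/-- One round of the algorithm. -/
def round : Cmd := setup ;; iteration ;; answer

/-- The minimum transition probability as a fraction. -/
def minimum : Cmd :=
  bfor xU xN (cond (vertexEntry 0) skip (bfor xW xN (
    set xA (edgeEntry 1) ;; set xB (edgeEntry 2) ;;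
    cond (reg xA) (cond (lt (reg xA * reg xMd) (reg xB * reg xMn))
      (set xMn (reg xA) ;; set xMd (reg xB)) skip) skip)))

/-- The powers of the minimum transition probability. -/
def powers : Cmd :=
  bfor xW xN (set xP (reg xP * reg xMd * reg xMd) ;; set xQ (reg xQ * reg xMn * reg xMn))

/-- The computations before the first round. -/
def prelude : Cmd :=
  (set xN (load (lit 0)) ;; set xD (lit 6 + (reg xN + reg xN) + reg xN * reg xN * lit 3) ;;
    set xMn (lit 1) ;; set xMd (lit 2) ;; set xP (lit 1) ;; set xQ (lit 1) ;; set xE (lit 1) ;;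
    set xFlag (lit 1)) ;;
  minimum ;; powers

end Cmd

namespace RatInstance

open Cmd BiddingMDP.Expr

variable {I : RatInstance} {K Y t u : ℕ} {s : RAM}

/-- All iterations are kept in memory: `xDst` runs through the blocks in order, while `xSrc` points
to the previous iteration and finally to the last one. -/
theorem spec_iteration {n : ℕ} (hc : I.Caps K Y) (hr : I.Regs K s) (hD : s.reg xD = I.len)
    (hn : s.reg xIt = n) (hmem : ∀ a < I.len, s.mem a = I.memSpec K a) :
    Spec Y iteration s fun s' => s'.reg xSrc = I.len + 2 * (n * I.N) * K ∧
      ∀ a < I.len + 2 * ((n + 1) * I.N) * K, s'.mem a = I.memSpec K a := by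
  simp only [iteration, spec_seq, spec_set, ok_reg, eval_reg, true_and]
  refine spec_bfor (fun u s' => s'.reg xDst = I.len + 2 * (0 * I.N + u) * K ∧
    ∀ a < I.len + 2 * (0 * I.N + u) * K, s'.mem a = I.memSpec K a) (n := I.N)
    (by decide) (by simpa using hr.vertices) ⟨by simpa using hD, by simpa using hmem⟩ ?_ ?_
  · rintro u hu s' hu' hfix - ⟨h1, h2⟩
    have e1 := hfix xN (by decide)
    have e2 := hfix xK (by decide)
    have e3 := hfix xKK (by decide)
    simp only [RAM.setReg_reg] at e1 e2 e3
    norm_num at e1 e2 e3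
    rw [hr.vertices] at e1
    rw [hr.cells] at e2
    rw [hr.cells2] at e3
    simp only [spec_seq]
    refine (spec_initBlock hc ⟨⟨e1, e2, e3⟩, hu', hu, h1, h2⟩).mono fun s₁ h hfix₁ _ => ?_
    have f1 := hfix₁ xDst (by decide)
    have f2 := hfix₁ xKK (by decide)
    rw [h1] at f1
    rw [e3] at f2
    simp only [spec_set, ok_add, ok_reg, true_and, eval_add, eval_reg, f1, f2]
    refine ⟨?_, h⟩
    simp only [RAM.setReg_reg]
    norm_num
    ring
  · rintro s₁ hfix₁ - ⟨h1, h2⟩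
    have f1 := hfix₁ xN (by decide)
    have f2 := hfix₁ xK (by decide)
    have f3 := hfix₁ xKK (by decide)
    have f4 := hfix₁ xSrc (by decide)
    have f5 := hfix₁ xIt (by decide)
    simp only [RAM.setReg_reg] at f1 f2 f3 f4 f5
    norm_num at f1 f2 f3 f4 f5
    rw [hr.vertices] at f1
    rw [hr.cells] at f2
    rw [hr.cells2] at f3
    rw [hD] at f4
    rw [hn] at f5
    refine spec_bfor (fun t s' => s'.reg xSrc = I.len + 2 * (t * I.N) * K ∧
      s'.reg xDst = I.len + 2 * ((t + 1) * I.N) * K ∧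
      ∀ a < I.len + 2 * ((t + 1) * I.N) * K, s'.mem a = I.memSpec K a) (n := n)
      (by decide) f5 ?_ ?_ ?_
    · refine ⟨by simpa using f4, ?_, ?_⟩
      · simpa using h1
      · simpa using h2
    · rintro t ht s₂ - hfix₂ - ⟨h3, h4, h5⟩
      have g1 := hfix₂ xN (by decide)
      have g2 := hfix₂ xK (by decide)
      have g3 := hfix₂ xKK (by decide)
      rw [f1] at g1
      rw [f2] at g2
      rw [f3] at g3
      simp only [spec_seq]
      refine spec_bfor (fun u s' => s'.reg xDst = I.len + 2 * ((t + 1) * I.N + u) * K ∧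
        ∀ a < I.len + 2 * ((t + 1) * I.N + u) * K, s'.mem a = I.memSpec K a) (n := I.N)
        (by decide) g1 ⟨by simpa using h4, by simpa using h5⟩ ?_ ?_
      · rintro u hu s' hu' hfix - ⟨h1, h2⟩
        have e1 := hfix xN (by decide)
        have e2 := hfix xK (by decide)
        have e3 := hfix xKK (by decide)
        have e4 := hfix xSrc (by decide)
        rw [g1] at e1
        rw [g2] at e2
        rw [g3] at e3
        rw [h3] at e4
        have hat : AtBlock I K (t + 1) u s' := ⟨⟨e1, e2, e3⟩, hu', hu, h1, h2⟩
        have hval : s'.mem (6 + 2 * u) = I.data.ctl u := by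
          have h6 := I.vertex_lt hu (by omega : 0 < 2)
          rw [h2 _ (by omega), I.memSpec_input (by omega)]
          rfl
        have key : Spec Y (cond (vertexEntry 0) ctrlBlock randBlock) s' fun s' =>
            ∀ a < I.len + 2 * ((t + 1) * I.N + (u + 1)) * K, s'.mem a = I.memSpec K a := by
          simp only [spec_cond, ok_vertexEntry, eval_vertexEntry, true_and, add_zero, hu', hval]
          exact ⟨spec_ctrlBlock hc hat e4, spec_randBlock hc hat e4⟩
        rw [spec_seq]
        refine key.mono fun s₁ h hfix₁ _ => ?_
        have f1 := hfix₁ xDst (by decide)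
        have f2 := hfix₁ xKK (by decide)
        rw [h1] at f1
        rw [e3] at f2
        simp only [spec_set, ok_add, ok_reg, true_and, eval_add, eval_reg, f1, f2]
        refine ⟨?_, h⟩
        simp only [RAM.setReg_reg]
        norm_num
        ring
      · rintro s' hfix - ⟨h1, h2⟩
        have e1 := hfix xN (by decide)
        have e2 := hfix xK (by decide)
        have e4 := hfix xSrc (by decide)
        rw [g1] at e1
        rw [g2] at e2
        rw [h3] at e4
        have hKY := hc.cells
        have e5 : (t + 1) * I.N + I.N = (t + 1 + 1) * I.N := by ring
        rw [e5] at h1 h2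
        simp only [spec_set, ok_add, ok_mul, ok_reg, true_and, eval_add, eval_mul, eval_reg, e1,
          e2, e4]
        refine ⟨hKY, ?_, ?_, h2⟩
        · simp only [RAM.setReg_reg]
          norm_num
          ring
        · simpa using h1
    · rintro s' - - ⟨h3, -, h5⟩
      exact ⟨h3, h5⟩

lemma input_num_le (I : RatInstance) : I.B.num ≤ I.B.den := by
  have h := I.B_le
  rw [← NNRat.num_div_den I.B, div_le_one (by exact_mod_cast I.B.den_pos)] at h
  exact_mod_cast h

theorem spec_answer {n : ℕ} (hc : I.Caps K Y) (hn0 : 0 < n) (hK : s.reg xK = K)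
    (hn : s.reg xIt = n) (hsrc : s.reg xSrc = I.len + 2 * (n * I.N) * K)
    (hmem : ∀ a < I.len + 2 * ((n + 1) * I.N) * K, s.mem a = I.memSpec K a) :
    Spec Y answer s fun s' =>
      (GridData.ReachTest (I.data.tgt I.v) K ((I.data.iter K n).1 I.v)
        I.B.num I.B.den I.p.num I.p.den → s'.reg xFlag = 0 ∧ s'.reg xOut = 1) ∧
      (¬ GridData.ReachTest (I.data.tgt I.v) K ((I.data.iter K n).1 I.v)
        I.B.num I.B.den I.p.num I.p.den →
        (GridData.SafeTest (2 * n) K ((I.data.iter K n).1 I.v) I.B.num I.B.den I.p.num I.p.den →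
          s'.reg xFlag = 0 ∧ s'.reg xOut = 0) ∧
        (¬ GridData.SafeTest (2 * n) K ((I.data.iter K n).1 I.v) I.B.num I.B.den I.p.num I.p.den →
          s'.reg xFlag = 1)) := by
  have hK0 := hc.pos
  have hKY := hc.cells
  have hv := I.v.2
  have hlen : 6 ≤ I.len := by rw [len]; omega
  have hin : ∀ a < I.len, s.mem a = I.input a := fun a ha => by
    rw [hmem a (by omega), I.memSpec_input ha]
  have i1 : s.mem 1 = I.v := by rw [hin 1 (by omega), I.input_header (by omega)]; rfl
  have i2 : s.mem 2 = I.B.num := by rw [hin 2 (by omega), I.input_header (by omega)]; rfl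
  have i3 : s.mem 3 = I.B.den := by rw [hin 3 (by omega), I.input_header (by omega)]; rfl
  have i4 : s.mem 4 = I.p.num := by rw [hin 4 (by omega), I.input_header (by omega)]; rfl
  have i5 : s.mem 5 = I.p.den := by rw [hin 5 (by omega), I.input_header (by omega)]; rfl
  have i6 : s.mem (6 + 2 * I.v + 1) = I.data.tgt I.v := hin _ (I.vertex_lt hv (by omega))
  have hm : ∀ i < K, s.mem (I.len + 2 * (n * I.N) * K + (I.v + I.v) * K + i) =
      (I.data.iter K n).1 I.v i := fun i hi => by
    have h1 := I.block_lt (t := n) hv (by omega : 0 < 2) hi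
    rw [add_zero] at h1
    rw [show I.len + 2 * (n * I.N) * K + (I.v + I.v) * K + i = I.len + 2 * (n * I.N + I.v) * K + i
      by ring, hmem _ h1, memSpec_lower hv hi]
  have hBle := I.input_num_le
  have hBd := I.B.den_pos
  -- The ceiling of `BK` is at most `K`, so column `a - 1` exists and its boundary is in memory.
  have haK : (I.B.num * K + (I.B.den - 1)) / I.B.den ≤ K := by
    refine Nat.le_of_lt_succ ((Nat.div_lt_iff_lt_mul hBd).2 ?_)
    have := Nat.mul_le_mul_right K hBle
    rw [Nat.succ_mul, mul_comm K]
    omega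
  -- Once the data are replaced by variables, agreement of the nested tests with the two
  -- propositions is a finite case analysis with linear arithmetic.
  generalize hm' : (I.data.iter K n).1 I.v = m at *
  generalize ha : (I.B.num * K + (I.B.den - 1)) / I.B.den = a at *
  generalize hq : I.p.num * K / I.p.den = q at *
  have hreach : GridData.ReachTest (I.data.tgt I.v) K m I.B.num I.B.den I.p.num I.p.den ↔
      I.data.tgt I.v ≠ 0 ∨ I.p.num = 0 ∨ I.B.num = I.B.den ∨ min q (K - 1) < m (a - 1) := by
    rw [GridData.ReachTest, ha, hq]
  have hsafe : GridData.SafeTest (2 * n) K m I.B.num I.B.den I.p.num I.p.den ↔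
      a + (n + n) ≤ K ∧ n + n ≤ q ∧ m (a + (n + n) - 1) ≤ q - (n + n) := by
    rw [GridData.SafeTest, ha, hq, ← two_mul]
  have m1 := hm (a - 1) (by omega)
  have m2 : a + (n + n) ≤ K → s.mem (I.len + 2 * (n * I.N) * K + (I.v + I.v) * K +
      (a + (n + n) - 1)) = m (a + (n + n) - 1) := fun h => hm _ (by omega)
  generalize GridData.ReachTest (I.data.tgt I.v) K m I.B.num I.B.den I.p.num I.p.den = R at *
  generalize GridData.SafeTest (2 * n) K m I.B.num I.B.den I.p.num I.p.den = S at *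
  generalize I.B.num = Bn at *
  generalize I.p.num = pn at *
  simp only [answer, spec_seq, spec_set, spec_cond, spec_skip, eval_lt, eval_lt_eq_zero, ok_lt,
    ok_emin, ok_load, ok_lit, ok_reg, ok_add, ok_sub, ok_mul, ok_div, ok_vertexEntry,
    eval_vertexEntry, eval_load, eval_lit, eval_reg, eval_add, eval_sub, eval_mul, eval_div,
    eval_emin, RAM.setReg_reg, RAM.setReg_mem]
  norm_num
  simp only [i1, i2, i3, i4, i5, i6, hK, hn, hsrc, ha, hq, m1]
  generalize s.mem (I.len + 2 * (n * I.N) * K + (I.v + I.v) * K + (a + (n + n) - 1)) = x at *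
  generalize m (a - 1) = y at *
  generalize m (a + (n + n) - 1) = z at *
  generalize I.data.tgt I.v = t at *
  generalize I.B.den = Bd at *
  clear hm hin hmem i1 i2 i3 i4 i5 i6 ha hq m1 hm' hsrc hlen hv
  by_cases hR : R
  · simp only [hR, true_iff] at hreach
    simp only [hR]
    by_cases hS : S
    · simp only [hS, true_iff] at hsafe
      simp only [hS]
      grind
    · simp only [hS, false_iff] at hsafe
      simp only [hS]
      grind
  · simp only [hR, false_iff] at hreach
    simp only [hR]
    by_cases hS : S
    · simp only [hS, true_iff] at hsafe
      simp only [hS]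
      grind
    · simp only [hS, false_iff] at hsafe
      simp only [hS]
      grind

end RatInstance

lemma MDP.δmin_eq {V : Type*} [Fintype V] (M : MDP V) {x : ℝ} (h1 : x ≤ 1 / 2)
    (h2 : ∀ u w, u ∉ M.ctrl → 0 < M.δ u w → x ≤ M.δ u w)
    (h3 : x = 1 / 2 ∨ ∃ u w, u ∉ M.ctrl ∧ 0 < M.δ u w ∧ x = M.δ u w) : M.δmin = x := by
  classical
  unfold MDP.δmin
  refine le_antisymm (Finset.min'_le _ _ ?_) (Finset.le_min' _ _ _ fun y hy => ?_)
  · rw [Finset.mem_insert, Finset.mem_image]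
    rcases h3 with h3 | ⟨u, w, hu, hw, h3⟩
    · exact Or.inl h3
    · exact Or.inr ⟨(u, w), Finset.mem_filter.2 ⟨Finset.mem_univ _, hu, hw⟩, h3.symm⟩
  · rw [Finset.mem_insert, Finset.mem_image] at hy
    rcases hy with rfl | ⟨⟨u, w⟩, he, rfl⟩
    · exact h1
    · obtain ⟨-, hu, hw⟩ := Finset.mem_filter.1 he
      exact h2 u w hu hw

namespace RatInstance

open Cmd BiddingMDP.Expr

variable {I : RatInstance} {K Y t u : ℕ} {s : RAM}

/-- The minimum transition probability is `a / b`, where `b` is one of the numbers of the input. -/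
structure IsMin (I : RatInstance) (a b : ℕ) : Prop where
  num_pos : 0 < a
  den_pos : 0 < b
  eq : I.toMDP.δmin = (a : ℝ) / b

/-- The summand `2k` is an integer and leaves the ceiling; the rest is a ceiling division by the
power of the numerator. -/
lemma iters_eq_nat {a b : ℕ} (h : I.IsMin a b) (k : ℕ) : I.toInstance.iters 2 8 k =
    k + k + (b ^ (2 * I.N) * k * 8 + (a ^ (2 * I.N) - 1)) / a ^ (2 * I.N) := by
  have hQ : 0 < a ^ (2 * I.N) := pow_pos h.num_pos _
  have hQ' : (0 : ℝ) < (a ^ (2 * I.N) : ℕ) := by exact_mod_cast hQ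
  have e : (1 / I.toInstance.M.δmin) ^ (2 * Fintype.card (Fin I.N)) =
      (b ^ (2 * I.N) : ℕ) / (a ^ (2 * I.N) : ℕ) := by
    change (1 / I.toMDP.δmin) ^ _ = _
    rw [h.eq, one_div_div, div_pow, Fintype.card_fin]
    push_cast
    rfl
  rw [Instance.iters_eq, e]
  generalize a ^ (2 * I.N) = Q at *
  generalize b ^ (2 * I.N) = P at *
  have e2 : (k : ℝ) * (2 + 8 * ((P : ℝ) / Q)) = (P * k * 8 : ℕ) / Q + (k + k : ℕ) := by
    push_cast; field_simp; ring
  rw [e2, Nat.ceil_add_natCast (by positivity), add_comm]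
  congr 1
  refine le_antisymm (Nat.ceil_le.2 ?_) ?_
  · rw [div_le_iff₀ hQ']
    have h1 : P * k * 8 + (Q - 1) < Q * ((P * k * 8 + (Q - 1)) / Q + 1) :=
      Nat.lt_mul_div_succ _ hQ
    have h2 : P * k * 8 ≤ (P * k * 8 + (Q - 1)) / Q * Q := by rw [mul_add, mul_comm Q] at h1; lia
    exact_mod_cast h2
  · refine Nat.le_of_lt_succ ((Nat.div_lt_iff_lt_mul hQ).2 ?_)
    have h1 := Nat.le_ceil (((P * k * 8 : ℕ) : ℝ) / Q)
    rw [div_le_iff₀ hQ'] at h1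
    have h2 : P * k * 8 ≤ ⌈((P * k * 8 : ℕ) : ℝ) / Q⌉₊ * Q := by exact_mod_cast h1
    rw [Nat.succ_mul]
    omega

/-- The state before round `h + 1`. -/
structure AtRound (I : RatInstance) (h : ℕ) (s : RAM) : Prop where
  vertices : s.reg xN = I.N
  len : s.reg xD = I.len
  powers : ∃ a b, I.IsMin a b ∧ s.reg xP = b ^ (2 * I.N) ∧ s.reg xQ = a ^ (2 * I.N)
  count : s.reg xH = h
  pow : s.reg xE = 2 ^ h
  mem : ∀ a < I.len, s.mem a = I.input a

/-- Makes the round number and the number of iterations admissible as second factors when the next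
round is set up. -/
lemma le_cells {h : ℕ} (hh : 1 ≤ h) :
    h ≤ I.toInstance.cells h ∧ I.toInstance.iters 2 8 h ≤ I.toInstance.cells h := by
  have h1 := I.toInstance.two_le_iters hh
  have h2 := Nat.lt_two_pow_self (n := h)
  have h3 := Nat.one_le_two_pow (n := h)
  unfold Instance.cells
  constructor <;> nlinarith

theorem spec_setup {h : ℕ} (hc : I.Caps (I.toInstance.cells (h + 1)) Y) (hs : I.AtRound h s) :
    Spec Y setup s fun s' => s'.reg xH = h + 1 ∧ s'.reg xE = 2 ^ (h + 1) ∧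
      s'.reg xIt = I.toInstance.iters 2 8 (h + 1) ∧ s'.reg xK = I.toInstance.cells (h + 1) ∧
      s'.reg xKK = 2 * I.toInstance.cells (h + 1) := by
  obtain ⟨a, b, hab, hP, hQ⟩ := hs.powers
  obtain ⟨h1, h2⟩ := I.le_cells (h := h + 1) (by omega)
  have h3 := hc.cells
  have h4 := hc.eight
  have e1 := iters_eq_nat hab (h + 1)
  have e2 : I.toInstance.cells (h + 1) = 2 ^ (h + 1) * I.toInstance.iters 2 8 (h + 1) := rfl
  have e3 : 2 ^ h + 2 ^ h = 2 ^ (h + 1) := by rw [pow_succ]; ring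
  simp only [setup, spec_seq, spec_set, ok_lit, ok_reg, ok_add, ok_mul, ok_div, ok_sub, eval_lit,
    eval_reg, eval_add, eval_mul, eval_div, eval_sub, RAM.setReg_reg]
  norm_num
  rw [hs.count, hs.pow, hP, hQ, e3, ← e1, ← e2, two_mul]
  exact ⟨⟨by omega, by omega⟩, by omega, rfl, rfl, rfl, rfl, rfl⟩

theorem spec_round {h : ℕ} (hc : I.Caps (I.toInstance.cells (h + 1)) Y) (hs : I.AtRound h s) :
    Spec Y Cmd.round s fun s' => I.AtRound (h + 1) s' ∧
      (∀ j, I.toInstance.round 2 8 (h + 1) = some j → s'.reg xFlag = 0 ∧ s'.reg xOut = j.code) ∧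
      (I.toInstance.round 2 8 (h + 1) = none → s'.reg xFlag ≠ 0) := by
  simp only [Cmd.round, spec_seq]
  refine (spec_setup hc hs).mono fun s₁ ⟨h1, h2, h3, h4, h5⟩ f1 m1 => ?_
  have m1 := m1 (by decide)
  refine (spec_iteration (n := I.toInstance.iters 2 8 (h + 1)) hc
    ⟨(f1 xN (by decide)).trans hs.vertices, h4, h5⟩ ((f1 xD (by decide)).trans hs.len) h3
    fun a ha => ?_).mono fun s₂ ⟨h6, h7⟩ f2 _ => ?_
  · rw [m1, hs.mem a ha, I.memSpec_input ha]
  have h8 := I.toInstance.two_le_iters (h := h + 1) (by omega)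
  refine (spec_answer hc (by omega) ((f2 xK (by decide)).trans h4) ((f2 xIt (by decide)).trans h3)
    h6 h7).mono fun s₃ ⟨h9, h10⟩ f3 m3 => ?_
  have m3 := m3 (by decide)
  refine ⟨⟨?_, ?_, ?_, ?_, ?_, ?_⟩, ?_⟩
  · rw [f3 xN (by decide), f2 xN (by decide), f1 xN (by decide), hs.vertices]
  · rw [f3 xD (by decide), f2 xD (by decide), f1 xD (by decide), hs.len]
  · rw [f3 xP (by decide), f2 xP (by decide), f1 xP (by decide), f3 xQ (by decide),
      f2 xQ (by decide), f1 xQ (by decide)]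
    exact hs.powers
  · rw [f3 xH (by decide), f2 xH (by decide), h1]
  · rw [f3 xE (by decide), f2 xE (by decide), h2]
  · intro a ha
    rw [m3, h7 a (by omega), I.memSpec_input ha]
  · rw [I.round_eq (by omega)]
    split_ifs with hR hS
    · refine ⟨fun j hj => ?_, fun hj => by cases hj⟩
      cases hj
      exact h9 hR
    · refine ⟨fun j hj => ?_, fun hj => by cases hj⟩
      cases hj
      exact (h10 hR).1 hS
    · refine ⟨fun j hj => (by cases hj), fun _ => ?_⟩
      rw [(h10 hR).2 hS]
      omega

/-- The fraction `a / b` is the minimum of `1 / 2` and the positive probabilities of the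
transitions with property `A`. -/
structure PartMin (I : RatInstance) (A : ℕ → ℕ → Prop) (a b : ℕ) : Prop where
  num_pos : 0 < a
  den_pos : 0 < b
  le_half : a * 2 ≤ b
  le : ∀ u w, A u w → I.data.ctl u = 0 → I.data.num u w ≠ 0 →
    a * I.data.den u w ≤ I.data.num u w * b
  mem : (a = 1 ∧ b = 2) ∨ ∃ u < I.N, ∃ w < I.N, I.data.ctl u = 0 ∧ I.data.num u w ≠ 0 ∧
    a = I.data.num u w ∧ b = I.data.den u w

lemma PartMin.mono {A A' : ℕ → ℕ → Prop} {a b : ℕ} (h : I.PartMin A a b)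
    (hA : ∀ u w, A' u w → I.data.ctl u = 0 → A u w) : I.PartMin A' a b :=
  { h with le := fun u w h1 h2 h3 => h.le u w (hA u w h1 h2) h2 h3 }

lemma PartMin.isMin {a b : ℕ} (h : I.PartMin (fun u w => u < I.N ∧ w < I.N) a b) :
    I.IsMin a b := by
  have hb : (0 : ℝ) < b := by exact_mod_cast h.den_pos
  have hctl : ∀ u : Fin I.N, u ∉ I.toMDP.ctrl ↔ I.data.ctl u = 0 := fun u => by
    rw [data_ctl]
    change ¬ I.ctrl u = true ↔ _
    cases I.ctrl u <;> simp
  have hδ : ∀ u w : Fin I.N, I.toMDP.δ u w = (I.data.num u w : ℝ) / I.data.den u w := fun u w => by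
    rw [data_num, data_den]
    change ((I.δ u w : ℚ≥0) : ℝ) = _
    rw [NNRat.cast_def]
  have hd : ∀ u w : Fin I.N, (0 : ℝ) < I.data.den u w := fun u w => by
    exact_mod_cast I.data_den_pos u w w.2
  have hpos : ∀ u w : Fin I.N, 0 < I.toMDP.δ u w ↔ I.data.num u w ≠ 0 := fun u w => by
    rw [hδ, div_pos_iff_of_pos_right (hd u w), Nat.cast_pos, Nat.pos_iff_ne_zero]
  refine ⟨h.num_pos, h.den_pos, I.toMDP.δmin_eq ?_ (fun u w hu hw => ?_) ?_⟩
  · rw [div_le_div_iff₀ hb (by norm_num), one_mul]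
    exact_mod_cast h.le_half
  · rw [hδ, div_le_div_iff₀ hb (hd u w)]
    exact_mod_cast h.le u w ⟨u.2, w.2⟩ ((hctl u).1 hu) ((hpos u w).1 hw)
  · rcases h.mem with ⟨rfl, rfl⟩ | ⟨u, hu, w, hw, h1, h2, rfl, rfl⟩
    · left; norm_num
    · exact Or.inr ⟨⟨u, hu⟩, ⟨w, hw⟩, (hctl ⟨u, hu⟩).2 h1, (hpos ⟨u, hu⟩ ⟨w, hw⟩).2 h2,
        (hδ ⟨u, hu⟩ ⟨w, hw⟩).symm⟩

/-- Fractions are compared by cross multiplication, starting from `1 / 2`. The current minimum is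
always `1 / 2` or a fraction of the input, which bounds the factors. -/
theorem spec_minimum (hN : I.N ≤ Y) (h8 : 8 ≤ Y) (hin : ∀ a, I.input a ≤ Y) (hs : s.reg xN = I.N)
    (hmn : s.reg xMn = 1) (hmd : s.reg xMd = 2) (hmem : ∀ a < I.len, s.mem a = I.input a) :
    Spec Y minimum s fun s' =>
      I.PartMin (fun u w => u < I.N ∧ w < I.N) (s'.reg xMn) (s'.reg xMd) := by
  refine spec_bfor (fun u s' => I.PartMin (fun u' w => u' < u ∧ w < I.N) (s'.reg xMn) (s'.reg xMd))
    (n := I.N) (by decide) hs ?_ ?_ fun _ _ _ h => h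
  · simp only [RAM.setReg_reg]
    norm_num
    rw [hmn, hmd]
    exact ⟨by omega, by omega, by omega, fun u w h => h.elim, Or.inl ⟨rfl, rfl⟩⟩
  · rintro u hu s₁ hu' f1 m1 h1
    have m1 := m1 (by decide)
    have e1 := f1 xN (by decide)
    rw [hs] at e1
    have hval : s₁.mem (6 + 2 * u) = I.data.ctl u := by
      have h6 := I.vertex_lt hu (by omega : 0 < 2)
      rw [m1, hmem _ (by omega)]
      rfl
    simp only [spec_cond, spec_skip, ok_vertexEntry, eval_vertexEntry, true_and, add_zero, hu',
      hval]
    refine ⟨fun hctl => ?_, fun hctl => ?_⟩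
    · simp only [RAM.setReg_reg]
      norm_num
      refine h1.mono fun u' w ⟨h2, h3⟩ h4 => ⟨?_, h3⟩
      rcases Nat.lt_or_eq_of_le h2 with h2 | rfl
      · exact h2
      · exact absurd h4 hctl
    · refine spec_bfor (fun w s' => I.PartMin (fun u' w' => (u' < u ∧ w' < I.N) ∨ u' = u ∧ w' < w)
        (s'.reg xMn) (s'.reg xMd)) (n := I.N) (by decide) e1 ?_ ?_ ?_
      · simp only [RAM.setReg_reg]
        norm_num
        exact h1
      · rintro w hw s₂ hw' f2 m2 h2
        have m2 := m2 (by decide)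
        have e2 := f2 xN (by decide)
        have e3 := f2 xU (by decide)
        rw [e1] at e2
        rw [hu'] at e3
        have hval : ∀ k < 3, s₂.mem (6 + 2 * I.N + 3 * (u * I.N + w) + k) =
            I.input (6 + 2 * I.N + 3 * (u * I.N + w) + k) := fun k hk => by
          rw [m2, m1, hmem _ (I.edge_lt hu hw hk)]
        have hnum : s₂.mem (6 + 2 * I.N + 3 * (u * I.N + w) + 1) = I.data.num u w :=
          hval 1 (by omega)
        have hden : s₂.mem (6 + 2 * I.N + 3 * (u * I.N + w) + 2) = I.data.den u w :=
          hval 2 (by omega)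
        have hdpos : 0 < I.data.den u w := I.data_den_pos ⟨u, hu⟩ w hw
        have hY : s₂.reg xMn ≤ Y ∧ s₂.reg xMd ≤ Y := by
          rcases h2.mem with ⟨h3, h4⟩ | ⟨u', -, w', -, -, -, h3, h4⟩
          · omega
          · rw [h3, h4]
            exact ⟨hin _, hin _⟩
        have hle := h2.le_half
        have key : ∀ (a b : ℕ), I.PartMin (fun u' w' => (u' < u ∧ w' < I.N) ∨ u' = u ∧ w' < w) a b →
            (I.data.num u w ≠ 0 → a * I.data.den u w ≤ I.data.num u w * b) →
            I.PartMin (fun u' w' => (u' < u ∧ w' < I.N) ∨ u' = u ∧ w' ≤ w) a b := by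
          intro a b hab hle
          refine { hab with le := fun u' w' h3 h4 h5 => ?_ }
          rcases h3 with h3 | ⟨rfl, h3⟩
          · exact hab.le u' w' (Or.inl h3) h4 h5
          · rcases Nat.lt_or_eq_of_le h3 with h3 | rfl
            · exact hab.le _ _ (Or.inr ⟨rfl, h3⟩) h4 h5
            · exact hle h5
        simp only [spec_cond, spec_seq, spec_set, spec_skip, ok_edgeEntry, eval_edgeEntry, eval_lt,
          eval_lt_eq_zero, ok_lt, ok_mul, ok_reg, eval_reg, eval_mul, RAM.setReg_reg,
          RAM.setReg_mem]
        norm_num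
        simp only [e2, e3, hw', hnum, hden]
        refine ⟨⟨hN, by omega⟩, fun hn => ⟨⟨hY.2, hY.1⟩, fun hlt => ?_,
          fun hge => ?_⟩, fun hn => key _ _ h2 fun h => absurd hn h⟩
        -- The new fraction is below the old minimum, which is at most one half.
        · have hlt2 : I.data.num u w * 2 ≤ I.data.den u w := by
            have h3 : I.data.num u w * 2 * s₂.reg xMd < I.data.den u w * s₂.reg xMd := by nlinarith
            exact (Nat.lt_of_mul_lt_mul_right h3).le
          refine key _ _ ⟨Nat.pos_of_ne_zero hn, hdpos, hlt2, fun u' w' h3 h4 h5 => ?_,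
            Or.inr ⟨u, hu, w, hw, hctl, hn, rfl, rfl⟩⟩ fun _ => le_rfl
          have h6 := h2.le u' w' h3 h4 h5
          refine Nat.le_of_mul_le_mul_right ?_ h2.den_pos
          -- Transitivity of comparison by cross multiplication: the old denominator is multiplied
          -- in and cancelled afterwards.
          calc I.data.num u w * I.data.den u' w' * s₂.reg xMd
              = I.data.num u w * s₂.reg xMd * I.data.den u' w' := by ring
            _ ≤ I.data.den u w * s₂.reg xMn * I.data.den u' w' :=
                Nat.mul_le_mul_right _ hlt.le
            _ = s₂.reg xMn * I.data.den u' w' * I.data.den u w := by ring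
            _ ≤ I.data.num u' w' * s₂.reg xMd * I.data.den u w := Nat.mul_le_mul_right _ h6
            _ = _ := by ring
        · exact key _ _ h2 fun _ => by rw [mul_comm]; exact hge
      · rintro s₂ - - h2
        simp only [RAM.setReg_reg]
        norm_num
        refine h2.mono fun u' w' ⟨h3, h4⟩ _ => ?_
        omega

theorem spec_powers {a b : ℕ} (ha : a ≤ Y) (hb : b ≤ Y) (hs : s.reg xN = I.N)
    (hmn : s.reg xMn = a) (hmd : s.reg xMd = b) (hP : s.reg xP = 1) (hQ : s.reg xQ = 1) :
    Spec Y powers s fun s' => s'.reg xP = b ^ (2 * I.N) ∧ s'.reg xQ = a ^ (2 * I.N) := by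
  refine spec_bfor (fun w s' => s'.reg xP = b ^ (2 * w) ∧ s'.reg xQ = a ^ (2 * w))
    (n := I.N) (by decide) hs ?_ ?_ fun _ _ _ h => h
  · simp [hP, hQ]
  · rintro w - s₁ - f1 - ⟨h1, h2⟩
    have e1 := f1 xMn (by decide)
    have e2 := f1 xMd (by decide)
    rw [hmn] at e1
    rw [hmd] at e2
    simp only [spec_seq, spec_set, ok_mul, ok_reg, eval_mul, eval_reg, RAM.setReg_reg]
    norm_num
    rw [e1, e2, h1, h2]
    exact ⟨hb, ha, by ring, by ring⟩

theorem spec_prelude (hN : I.N ≤ Y) (h8 : 8 ≤ Y) (hin : ∀ a, I.input a ≤ Y) :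
    Spec Y prelude (RAM.start I.encode) fun s' => I.AtRound 0 s' ∧ s'.reg xFlag = 1 := by
  have hmem : ∀ a, (RAM.start I.encode).mem a = I.input a := fun _ => rfl
  have h0 : I.input 0 = I.N := by rw [I.input_header (by omega)]; rfl
  have hlen : 6 + (I.N + I.N) + I.N * I.N * 3 = I.len := by rw [RatInstance.len]; ring
  have key : Spec Y (set xN (load (lit 0)) ;;
      set xD (lit 6 + (reg xN + reg xN) + reg xN * reg xN * lit 3) ;;
      set xMn (lit 1) ;; set xMd (lit 2) ;; set xP (lit 1) ;; set xQ (lit 1) ;; set xE (lit 1) ;;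
      set xFlag (lit 1)) (RAM.start I.encode) fun s' => s'.reg xN = I.N ∧ s'.reg xD = I.len ∧
        s'.reg xMn = 1 ∧ s'.reg xMd = 2 ∧ s'.reg xP = 1 ∧ s'.reg xQ = 1 ∧ s'.reg xE = 1 ∧
        s'.reg xFlag = 1 := by
    simp only [spec_seq, spec_set, ok_lit, ok_reg, ok_add, ok_mul, ok_load, eval_lit, eval_reg,
      eval_add, eval_mul, eval_load, RAM.setReg_reg]
    norm_num
    rw [hmem, h0, hlen]
    exact ⟨⟨hN, by omega⟩, rfl, rfl⟩
  rw [prelude, spec_seq]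
  refine key.mono fun s₁ ⟨h1, h2, h3, h4, h5, h6, h7, h9⟩ f1 m1 => ?_
  have m1 := m1 (by decide)
  rw [spec_seq]
  refine (spec_minimum hN h8 hin h1 h3 h4 fun a _ => by rw [m1, hmem]).mono fun s₂ hmin f2 m2 => ?_
  have m2 := m2 (by decide)
  have hY : s₂.reg xMn ≤ Y ∧ s₂.reg xMd ≤ Y := by
    rcases hmin.mem with ⟨h3, h4⟩ | ⟨u', -, w', -, -, -, h3, h4⟩
    · omega
    · rw [h3, h4]
      exact ⟨hin _, hin _⟩
  refine (spec_powers (I := I) hY.1 hY.2 ((f2 xN (by decide)).trans h1) rfl rfl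
    ((f2 xP (by decide)).trans h5) ((f2 xQ (by decide)).trans h6)).mono
    fun s₃ ⟨hP, hQ⟩ f3 m3 => ?_
  have m3 := m3 (by decide)
  refine ⟨⟨?_, ?_, ⟨_, _, hmin.isMin, hP, hQ⟩, ?_, ?_, ?_⟩, ?_⟩
  · rw [f3 xN (by decide), f2 xN (by decide), h1]
  · rw [f3 xD (by decide), f2 xD (by decide), h2]
  · rw [f3 xH (by decide), f2 xH (by decide), f1 xH (by decide)]
    rfl
  · rw [f3 xE (by decide), f2 xE (by decide), h7, pow_zero]
  · intro a _
    rw [m3, m2, m1, hmem]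
  · rw [f3 xFlag (by decide), f2 xFlag (by decide), h9]

end RatInstance

/-! ### Static cost bounds and the running time of the program. -/

namespace Expr

lemma cost_sub (a b : Expr) : (a - b).cost = a.cost + b.cost + 1 := rfl
lemma cost_div (a b : Expr) : (a / b).cost = a.cost + b.cost + 1 := rfl

end Expr

namespace Cmd

open BiddingMDP.Expr

/-- The dominant term comes from scanning the successors of every vertex for every row and
iteration. The constant `712` is the sum of the coefficients, as `N² K n` dominates every monomial.
-/
lemma bound_iteration (f : ℕ → ℕ) {N K n : ℕ} (hN : f xN = N) (hK : f xK = K)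
    (hKK : f xKK = 2 * K) (hn : f xIt = n) (hN1 : 1 ≤ N) (hK1 : 1 ≤ K) (hn1 : 1 ≤ n) :
    iteration.bound f ≤ 712 * (N ^ 2 * K * n) := by
  have e : iteration.bound f = 14 + 34 * N + 137 * (N * K) + 282 * (N * K * n) + 66 * (N * n) +
      159 * (N ^ 2 * K * n) + 20 * n := by
    simp only [iteration, initBlock, ctrlBlock, randBlock, conjugate, loHi, sums, bound, Expr.cost,
      edgeEntry, vertexEntry, emin, emax, lt, cost_sub, cost_div, hN, hK, hKK,
      hn]
    ring
  have hNN : N ≤ N ^ 2 := Nat.le_self_pow (by omega) N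
  have h0 : 1 ≤ N ^ 2 := hN1.trans hNN
  have h1 : N * K * n ≤ N ^ 2 * K * n := by gcongr
  have h2 : N * K ≤ N ^ 2 * K * n := by
    calc N * K = N * K * 1 := (mul_one _).symm
      _ ≤ _ := by gcongr
  have h3 : N * n ≤ N ^ 2 * K * n := by
    calc N * n = N * 1 * n := by rw [mul_one]
      _ ≤ _ := by gcongr
  have h4 : N ≤ N ^ 2 * K * n := (Nat.le_mul_of_pos_right N hn1).trans h3
  have h5 : n ≤ N ^ 2 * K * n := (Nat.le_mul_of_pos_left n hN1).trans h3
  omega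

lemma bound_minimum_powers (f : ℕ → ℕ) {N : ℕ} (hN : f xN = N) (hN1 : 1 ≤ N) :
    (minimum ;; powers).bound f ≤ 118 * N ^ 2 := by
  have e : (minimum ;; powers).bound f = 6 + 41 * N + 71 * N ^ 2 := by
    simp only [minimum, powers, bound, Expr.cost, edgeEntry, vertexEntry, lt, cost_sub,
      hN]
    ring
  have hNN : N ≤ N ^ 2 := Nat.le_self_pow (by omega) N
  omega

lemma bound_answer (f : ℕ → ℕ) : answer.bound f ≤ 200 := by
  simp only [answer, bound, Expr.cost, vertexEntry, emin, lt, cost_sub,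
    cost_div]
  norm_num

lemma bound_setup (f : ℕ → ℕ) : setup.bound f ≤ 80 := by
  simp only [setup, bound, Expr.cost, cost_sub, cost_div]
  norm_num

end Cmd

namespace RatInstance

open Cmd BiddingMDP.Expr

variable {I : RatInstance} {K Y t u : ℕ} {s : RAM}

/-- The order of magnitude of the cost of round `h`. -/
noncomputable def work (I : RatInstance) (h : ℕ) : ℕ :=
  I.N ^ 2 * I.toInstance.cells h * I.toInstance.iters 2 8 h

lemma one_le_N (I : RatInstance) : 1 ≤ I.N := by have := I.v.2; omega

lemma one_le_work {h : ℕ} (hh : 1 ≤ h) : 1 ≤ I.work h := by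
  have h1 := I.toInstance.two_le_iters hh
  have h2 := I.toInstance.cells_pos hh
  have h3 := I.one_le_N
  exact Nat.mul_pos (Nat.mul_pos (pow_pos h3 2) h2) (by omega)

/-- `992 = 80 + 712 + 200`, for the setup, the iteration and the answer. -/
lemma cost_round {h : ℕ} (hc : I.Caps (I.toInstance.cells (h + 1)) Y) (hs : I.AtRound h s) :
    Cmd.round.cost s ≤ 992 * I.work (h + 1) := by
  have h1 := cost_le_bound setup (by decide) s
  have h2 := cost_le_bound iteration (by decide) (setup.den s)
  have h3 := cost_le_bound answer (by decide) (iteration.den (setup.den s))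
  have h4 := bound_setup s.reg
  have h5 := bound_answer (iteration.den (setup.den s)).reg
  obtain ⟨-, -, -, e1, e2, e3⟩ := spec_setup hc hs
  have h6 := bound_iteration (setup.den s).reg ((reg_den (by decide)).trans hs.vertices) e2 e3 e1
    I.one_le_N hc.pos ((by omega : 1 ≤ 2).trans (I.toInstance.two_le_iters (by omega)))
  have h7 := I.one_le_work (h := h + 1) (by omega)
  have h8 : Cmd.round.cost s =
      setup.cost s + (iteration.cost (setup.den s) + answer.cost (iteration.den (setup.den s))) :=
    rfl
  rw [work] at h7 ⊢
  omega

lemma cost_prelude : prelude.cost (RAM.start I.encode) ≤ 218 * I.N ^ 2 := by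
  set c := set xN (load (lit 0)) ;;
    set xD (lit 6 + (reg xN + reg xN) + reg xN * reg xN * lit 3) ;;
    set xMn (lit 1) ;; set xMd (lit 2) ;; set xP (lit 1) ;; set xQ (lit 1) ;; set xE (lit 1) ;;
    set xFlag (lit 1) with hc
  have h1 := cost_le_bound c (by decide) (RAM.start I.encode)
  have h2 := cost_le_bound (minimum ;; powers) (by decide) (c.den (RAM.start I.encode))
  have h3 : c.bound (RAM.start I.encode).reg ≤ 100 := by
    simp only [hc, bound, Expr.cost]
    norm_num
  have h4 : (c.den (RAM.start I.encode)).reg xN = I.N := by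
    change I.input 0 = I.N
    rw [I.input_header (by omega)]; rfl
  have h5 := bound_minimum_powers _ h4 I.one_le_N
  have h6 : prelude.cost (RAM.start I.encode) =
      c.cost (RAM.start I.encode) + (minimum ;; powers).cost (c.den (RAM.start I.encode)) := rfl
  have h7 : 1 ≤ I.N ^ 2 := Nat.one_le_pow _ _ I.one_le_N
  omega

lemma iters_mono {h h' : ℕ} (hh : h ≤ h') :
    I.toInstance.iters 2 8 h ≤ I.toInstance.iters 2 8 h' := by
  rw [Instance.iters_eq, Instance.iters_eq]
  refine Nat.ceil_le_ceil (mul_le_mul_of_nonneg_right (by exact_mod_cast hh) ?_)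
  have := I.toInstance.M.δmin_pos
  positivity

lemma cells_mono {h h' : ℕ} (hh : h ≤ h') : I.toInstance.cells h ≤ I.toInstance.cells h' :=
  Nat.mul_le_mul (Nat.pow_le_pow_right (by norm_num) hh) (iters_mono hh)

lemma work_mono {h h' : ℕ} (hh : h ≤ h') : I.work h ≤ I.work h' :=
  Nat.mul_le_mul (Nat.mul_le_mul_left _ (cells_mono hh)) (iters_mono hh)

/-- The program of the algorithm. -/
def algorithm : Prog := .seq (prelude.comp 29) (.loop xFlag (Cmd.round.comp 29))

/-- Induction on the number of rounds that remain. Cells and work grow with the round, so the caps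
and the cost of the last round serve for all of them. -/
theorem run_rounds {H : ℕ} {w : Player} (hret : I.toInstance.AlgApproxReturns 2 8 H w)
    (hc : I.Caps (I.toInstance.cells H) Y) (k : ℕ) {h : ℕ} (hk : h + (k + 1) = H)
    (hs : I.AtRound h s) (hflag : s.reg xFlag ≠ 0) {s₀ : RAM} (hag : s.Agree 29 s₀) :
    ∃ s' t, Run Y (.loop xFlag (Cmd.round.comp 29)) s₀ s' t ∧ s'.reg xOut = w.code ∧
      s'.reg xH = H ∧ t ≤ (k + 1) * (1 + 992 * I.work H) + 1 := by
  induction k generalizing h s s₀ with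
  | zero =>
    have e : h + 1 = H := hk
    rw [← e] at hc hret ⊢
    obtain ⟨hok, h1, h2, -⟩ := spec_round hc hs
    obtain ⟨s₁, r1, hag1⟩ := Cmd.run_comp Cmd.round (by decide) hok hag
    obtain ⟨h3, h4⟩ := h2 w hret.2.1
    have h5 := cost_round hc hs
    refine ⟨s₁, _, .loopStep ?_ r1 (.loopDone ?_), ?_, ?_, by omega⟩
    · rw [hag.1 _ (by omega)]; exact hflag
    · rw [hag1.1 _ (by omega)]; exact h3
    · rw [hag1.1 _ (by omega)]; exact h4
    · rw [hag1.1 _ (by omega)]; exact h1.count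
  | succ k ih =>
    have hc' : I.Caps (I.toInstance.cells (h + 1)) Y :=
      { hc with
        pos := I.toInstance.cells_pos (by omega)
        cells := (cells_mono (by omega)).trans hc.cells }
    obtain ⟨hok, h1, -, h2⟩ := spec_round hc' hs
    obtain ⟨s₁, r1, hag1⟩ := Cmd.run_comp Cmd.round (by decide) hok hag
    have h3 := h2 (hret.2.2 (h + 1) (by omega) (by omega))
    have h5 := cost_round hc' hs
    have h6 := I.work_mono (by omega : h + 1 ≤ H)
    obtain ⟨s₂, t, r2, e1, e2, ht⟩ := ih (by omega) h1 h3 hag1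
    refine ⟨s₂, _, .loopStep ?_ r1 r2, e1, e2, ?_⟩
    · rw [hag.1 _ (by omega)]; exact hflag
    · rw [add_mul (k + 1) 1]
      omega

/-- `1212 = 218 + 992 + 1 + 1`: the prelude, the rounds, and the loop tests. -/
theorem run_algorithm {H : ℕ} {w : Player} (hret : I.toInstance.AlgApproxReturns 2 8 H w)
    (hc : I.Caps (I.toInstance.cells H) Y) :
    ∃ s t, Run Y algorithm (RAM.start I.encode) s t ∧ s.reg xOut = w.code ∧ s.reg xH = H ∧
      t ≤ 1212 * (H * I.work H) := by
  obtain ⟨hok, h1, h2⟩ := spec_prelude hc.vertices hc.eight hc.input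
  obtain ⟨s₁, r1, hag⟩ := Cmd.run_comp prelude (T := 29) (by decide) hok
    (s₀ := RAM.start I.encode) ⟨fun _ _ => rfl, rfl⟩
  have hH := hret.1
  obtain ⟨s₂, t, r2, e1, e2, ht⟩ := run_rounds hret hc (H - 1) (h := 0) (by omega) h1
    (by rw [h2]; omega) hag
  refine ⟨s₂, _, .seq r1 r2, e1, e2, ?_⟩
  have h3 := I.cost_prelude
  have h4 : I.N ^ 2 ≤ I.work H := by
    rw [work, mul_assoc]
    exact Nat.le_mul_of_pos_right _ (Nat.mul_pos hc.pos
      (by have := I.toInstance.two_le_iters hH; omega))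
  have h5 := I.one_le_work hH
  have h6 : I.work H ≤ H * I.work H := Nat.le_mul_of_pos_left _ hH
  have h7 : H ≤ H * I.work H := Nat.le_mul_of_pos_right _ h5
  rw [show H - 1 + 1 = H by omega, mul_add, mul_one,
    show H * (992 * I.work H) = 992 * (H * I.work H) by ring] at ht
  omega

/-- The program that reports whether the given player has a winning policy. -/
def decider : Player → Prog
  | .reach => algorithm
  | .safe => .seq algorithm ((set xOut (lit 1 - reg xOut)).comp 29)

theorem run_decider {H : ℕ} {w : Player} (hret : I.toInstance.AlgApproxReturns 2 8 H w)
    (hc : I.Caps (I.toInstance.cells H) Y) (j : Player) :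
    ∃ s t, Run Y (decider j) (RAM.start I.encode) s t ∧
      s.reg xOut = (if w = j then 1 else 0) ∧ t ≤ 1220 * (H * I.work H) := by
  obtain ⟨s, t, r, e, -, ht⟩ := run_algorithm hret hc
  have h1 : 1 ≤ H * I.work H := Nat.mul_pos hret.1 (I.one_le_work hret.1)
  cases j with
  | reach =>
    refine ⟨s, t, r, ?_, by omega⟩
    rw [e]
    cases w <;> rfl
  | safe =>
    obtain ⟨s₁, r1, hag⟩ := Cmd.run_comp (Y := Y) (T := 29) (set xOut (lit 1 - reg xOut)) (s := s)
      (by decide) (by simp [Cmd.Ok]) (s₀ := s) ⟨fun _ _ => rfl, rfl⟩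
    refine ⟨s₁, _, .seq r r1, ?_, ?_⟩
    · rw [hag.1 _ (by omega)]
      simp only [Cmd.den, RAM.setReg_reg, eval_sub, eval_lit, eval_reg, e]
      cases w <;> rfl
    · simp only [Cmd.cost, cost_sub, Expr.cost]
      omega

end RatInstance

/-! ### Bounds in terms of the length of the input. -/

lemma size_getD_le (l : List ℕ) (a : ℕ) : (l.getD a 0).size ≤ bitLength l := by
  induction l generalizing a with
  | nil => simp
  | cons x l ih =>
    have e : bitLength (x :: l) = x.size + 1 + bitLength l := by simp [bitLength]
    rw [e]
    cases a with
    | zero => rw [List.getD_cons_zero]; omega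
    | succ a => rw [List.getD_cons_succ]; have := ih a; omega

lemma length_le_bitLength (l : List ℕ) : l.length ≤ bitLength l := by
  induction l with
  | nil => simp
  | cons x l ih =>
    have e : bitLength (x :: l) = x.size + 1 + bitLength l := by simp [bitLength]
    rw [e, List.length_cons]; omega

namespace RatInstance

variable (I : RatInstance)

lemma size_input_le (a : ℕ) : (I.input a).size ≤ bitLength I.encode := size_getD_le _ _

lemma input_lt (a : ℕ) : I.input a < 2 ^ bitLength I.encode := Nat.size_le.1 (I.size_input_le a)

lemma N_le_bitLength : I.N ≤ bitLength I.encode := by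
  have := length_le_bitLength I.encode
  rw [length_encode] at this
  omega

lemma small_start : (RAM.start I.encode).Small (bitLength I.encode + 4) :=
  ⟨fun _ => by simp [RAM.start], fun a => (I.size_input_le a).trans (by omega)⟩

/-- A positive probability of the input has numerator at least `1` and a denominator that occurs in
the encoding. -/
lemma inv_δmin_le : 1 / I.toMDP.δmin ≤ 2 ^ bitLength I.encode := by
  classical
  have h1 : 1 ≤ bitLength I.encode := I.one_le_N.trans I.N_le_bitLength
  have hmem : I.toMDP.δmin ∈ insert (1 / 2 : ℝ)
    ((Finset.univ.filter fun e : Fin I.N × Fin I.N => e.1 ∉ I.toMDP.ctrl ∧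
      0 < I.toMDP.δ e.1 e.2).image fun e => I.toMDP.δ e.1 e.2) := by
    unfold MDP.δmin
    convert Finset.min'_mem _ _
  rw [Finset.mem_insert, Finset.mem_image] at hmem
  rcases hmem with h | ⟨⟨u, w⟩, he, h⟩
  · rw [h, one_div_one_div]
    calc (2 : ℝ) = 2 ^ 1 := (pow_one _).symm
      _ ≤ _ := pow_le_pow_right₀ (by norm_num) h1
  · obtain ⟨-, -, hpos⟩ := Finset.mem_filter.1 he
    rw [← h]
    have hδ : I.toMDP.δ u w = (I.data.num u w : ℝ) / I.data.den u w := by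
      rw [data_num, data_den]
      change ((I.δ u w : ℚ≥0) : ℝ) = _
      rw [NNRat.cast_def]
    have hd : (0 : ℝ) < I.data.den u w := by exact_mod_cast I.data_den_pos u w w.2
    dsimp only at hpos ⊢
    rw [hδ] at hpos ⊢
    rw [div_pos_iff_of_pos_right hd] at hpos
    have hn : (1 : ℝ) ≤ I.data.num u w := by exact_mod_cast (by exact_mod_cast hpos : 0 < I.data.num u w)
    rw [one_div_div, div_le_iff₀ (by linarith)]
    have hlt : (I.data.den u w : ℝ) ≤ 2 ^ bitLength I.encode := by
      exact_mod_cast (I.input_lt _).le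
    calc (I.data.den u w : ℝ) ≤ 2 ^ bitLength I.encode * 1 := by rwa [mul_one]
      _ ≤ _ := by gcongr

/-- The three summands of the cap cover the grid indices, the numbers of the input and the
constants. -/
lemma caps (h : ℕ) (hh : 1 ≤ h) :
    I.Caps (I.toInstance.cells h) (I.toInstance.cells h + 2 ^ bitLength I.encode + 8) where
  pos := I.toInstance.cells_pos hh
  eight := by have := Nat.two_pow_pos (bitLength I.encode); omega
  vertices := by
    have := I.N_le_bitLength
    have := Nat.lt_two_pow_self (n := bitLength I.encode)
    omega
  cells := by have := Nat.two_pow_pos (bitLength I.encode); omega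
  input a := by have := I.input_lt a; omega

end RatInstance

/-! ### Rounds and iterations in terms of the distance. -/

namespace Instance

variable {V : Type*} [Fintype V] (I : Instance V)

/-- The factor by which the minimum transition probability slows down the convergence. -/
noncomputable def slow : ℝ := (1 / I.M.δmin) ^ (2 * Fintype.card V)

lemma one_le_slow : 1 ≤ I.slow := by
  refine one_le_pow₀ ?_
  rw [le_div_iff₀ I.M.δmin_pos, one_mul]
  exact I.M.δmin_le_half.trans (by norm_num)


variable {I}

lemma one_le_inv_dist (hd : 0 < I.dist) : 1 ≤ 1 / I.dist := by
  rw [le_div_iff₀ hd, one_mul]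
  exact thresholdDist_le_one I.mem_square

lemma logb_inv_dist_nonneg (hd : 0 < I.dist) : 0 ≤ Real.logb 2 (1 / I.dist) :=
  Real.logb_nonneg (by norm_num) (one_le_inv_dist hd)

/-- From `log x ≤ x - 1` and `log 2 > 1 / 2`; it lets powers of the inverse distance absorb the
logarithms. -/
lemma max_logb_le (hd : 0 < I.dist) :
    max 1 (Real.logb 2 (1 / I.dist)) ≤ 2 * (1 / I.dist) := by
  have h1 := one_le_inv_dist hd
  refine max_le (by linarith) ?_
  have h2 := Real.log_two_gt_d9
  rw [Real.logb, div_le_iff₀ (by linarith)]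
  have h3 := Real.log_le_sub_one_of_pos (lt_of_lt_of_le one_pos h1)
  nlinarith

variable {H : ℕ} (hd : 0 < I.dist) (hH : H ≤ ⌈Real.logb 2 (1 / I.dist)⌉₊ + 1)

include hd hH

lemma round_le_logb : (H : ℝ) ≤ Real.logb 2 (1 / I.dist) + 2 := by
  have h1 := Nat.ceil_lt_add_one (logb_inv_dist_nonneg hd)
  have h2 : (H : ℝ) ≤ (⌈Real.logb 2 (1 / I.dist)⌉₊ : ℝ) + 1 := by exact_mod_cast hH
  linarith

lemma two_pow_round_le : (2 : ℝ) ^ H ≤ 4 * (1 / I.dist) := by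
  have h1 := one_le_inv_dist hd
  rw [← Real.rpow_natCast]
  calc (2 : ℝ) ^ (H : ℝ) ≤ 2 ^ (Real.logb 2 (1 / I.dist) + 2) :=
        Real.rpow_le_rpow_of_exponent_le (by norm_num) (round_le_logb hd hH)
    _ = 4 * (1 / I.dist) := by
        rw [Real.rpow_add (by norm_num), Real.rpow_logb (by norm_num) (by norm_num) (by linarith)]
        norm_num
        ring

lemma round_le_max : (H : ℝ) ≤ 3 * max 1 (Real.logb 2 (1 / I.dist)) := by
  have h1 := round_le_logb hd hH
  have h2 := le_max_left 1 (Real.logb 2 (1 / I.dist))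
  have h3 := le_max_right 1 (Real.logb 2 (1 / I.dist))
  linarith

lemma iters_le (h1 : 1 ≤ H) :
    (I.iters 2 8 H : ℝ) ≤ 33 * max 1 (Real.logb 2 (1 / I.dist)) * I.slow := by
  have hx := I.one_le_slow
  have h1' : (1 : ℝ) ≤ H := by exact_mod_cast h1
  have h2 := round_le_max hd hH
  have h3 : (I.iters 2 8 H : ℝ) ≤ H * (2 + 8 * I.slow) + 1 := by
    rw [iters_eq]
    exact (Nat.ceil_lt_add_one (by rw [← slow]; positivity)).le
  have h4 : (H : ℝ) * (2 + 8 * I.slow) + 1 ≤ 11 * H * I.slow := by nlinarith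
  calc _ ≤ 11 * H * I.slow := h3.trans h4
    _ ≤ 11 * (3 * max 1 (Real.logb 2 (1 / I.dist))) * I.slow := by gcongr
    _ = _ := by ring

end Instance

namespace RatInstance

variable {I : RatInstance} {H : ℕ} (hd : 0 < I.toInstance.dist) (h1 : 1 ≤ H)
  (hH : H ≤ ⌈Real.logb 2 (1 / I.toInstance.dist)⌉₊ + 1)

include hd h1 hH

/-- The uniform cost is of the claimed order. -/
lemma steps_le : (1220 * (H * I.work H) : ℕ) ≤ (2 : ℝ) ^ 24 * ((I.N : ℝ) ^ 2 / I.toInstance.dist *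
    max 1 (Real.logb 2 (1 / I.toInstance.dist)) ^ 3 *
    (1 / I.toInstance.M.δmin) ^ (4 * I.N)) := by
  have hx : (1 / I.toInstance.M.δmin) ^ (4 * I.N) = I.toInstance.slow ^ 2 := by
    rw [Instance.slow, ← pow_mul, Fintype.card_fin]
    congr 1
    ring
  have a1 := Instance.round_le_max hd hH
  have a2 := Instance.two_pow_round_le hd hH
  have a3 := Instance.iters_le hd hH h1
  have hx1 := I.toInstance.one_le_slow
  rw [hx, work, Instance.cells]
  set x := I.toInstance.slow
  set M := max 1 (Real.logb 2 (1 / I.toInstance.dist))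
  have hM : 1 ≤ M := le_max_left _ _
  have he : 0 < 1 / I.toInstance.dist := one_div_pos.2 hd
  push_cast
  calc (1220 : ℝ) * (H * ((I.N : ℝ) ^ 2 * (2 ^ H * I.toInstance.iters 2 8 H) *
        I.toInstance.iters 2 8 H))
      ≤ 1220 * ((3 * M) * ((I.N : ℝ) ^ 2 * ((4 * (1 / I.toInstance.dist)) * (33 * M * x)) *
        (33 * M * x))) := by gcongr
    -- `13068 = 3 · 4 · 33²` collects the bounds for the rounds, for `2 ^ H` and for the two factors
    -- of iterations; times `1220` it is below `2 ^ 24`.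
    _ = (1220 * 13068) * ((I.N : ℝ) ^ 2 / I.toInstance.dist * M ^ 3 * x ^ 2) := by ring
    _ ≤ _ := by
      gcongr
      norm_num

/-- The uniform cost is polynomial in the inverse distance. -/
lemma steps_le_pow : (1220 * (H * I.work H) : ℕ) ≤
    (2 : ℝ) ^ (4 * bitLength I.encode ^ 2 + 2 * bitLength I.encode + 27) *
      (1 / I.toInstance.dist) ^ 4 := by
  refine (steps_le hd h1 hH).trans ?_
  have hN : (I.N : ℝ) ≤ 2 ^ bitLength I.encode := by
    exact_mod_cast I.N_le_bitLength.trans Nat.lt_two_pow_self.le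
  have hM := Instance.max_logb_le hd
  have hM1 : 1 ≤ max 1 (Real.logb 2 (1 / I.toInstance.dist)) := le_max_left _ _
  have he : 0 < 1 / I.toInstance.dist := one_div_pos.2 hd
  have hx : (1 / I.toInstance.M.δmin) ^ (4 * I.N) ≤ 2 ^ (4 * bitLength I.encode ^ 2) := by
    have hδ : 0 < 1 / I.toInstance.M.δmin := one_div_pos.2 I.toInstance.M.δmin_pos
    calc (1 / I.toInstance.M.δmin) ^ (4 * I.N) ≤ ((2 : ℝ) ^ bitLength I.encode) ^ (4 * I.N) := by
          gcongr
          exact I.inv_δmin_le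
      _ = 2 ^ (bitLength I.encode * (4 * I.N)) := (pow_mul _ _ _).symm
      _ ≤ _ := by
          refine pow_le_pow_right₀ (by norm_num) ?_
          nlinarith [I.N_le_bitLength]
  have h0 : 0 ≤ (1 / I.toInstance.M.δmin) ^ (4 * I.N) :=
    pow_nonneg (one_div_pos.2 I.toInstance.M.δmin_pos).le _
  rw [div_eq_mul_one_div, pow_add, pow_add, pow_mul' (2 : ℝ) 2 (bitLength I.encode)]
  generalize (1 / I.toInstance.M.δmin) ^ (4 * I.N) = y at *
  generalize (2 : ℝ) ^ (4 * bitLength I.encode ^ 2) = z at *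
  generalize (2 : ℝ) ^ bitLength I.encode = n at *
  generalize max 1 (Real.logb 2 (1 / I.toInstance.dist)) = M at *
  generalize 1 / I.toInstance.dist = e at *
  calc (2 : ℝ) ^ 24 * ((I.N : ℝ) ^ 2 * e * M ^ 3 * y) ≤
      (2 : ℝ) ^ 24 * (n ^ 2 * e * (2 * e) ^ 3 * z) := by gcongr
    _ = _ := by ring

/-- A run that is short enough has a logarithmic cost of the claimed order. -/
lemma exec_of_run {P : Prog} {s : RAM} {t : ℕ}
    (hr : Run (I.toInstance.cells H + 2 ^ bitLength I.encode + 8) P (RAM.start I.encode) s t)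
    (ht : t ≤ 1220 * (H * I.work H)) :
    ∃ b, Exec P (RAM.start I.encode) s t b ∧
      (b : ℝ) ≤ 2 ^ (12 * bitLength I.encode ^ 2 + 6 * bitLength I.encode + 85) *
        (1 / I.toInstance.dist) ^ 12 := by
  obtain ⟨-, b, hb, hle⟩ := hr.exec (by omega) I.small_start le_rfl
  refine ⟨b, hb, ?_⟩
  have hW := steps_le_pow hd h1 hH
  have he := Instance.one_le_inv_dist hd
  have hcells : I.toInstance.cells H ≤ 1220 * (H * I.work H) := by
    have a1 : 1 ≤ I.N ^ 2 := Nat.one_le_pow _ _ I.one_le_N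
    have a2 : 1 ≤ I.toInstance.iters 2 8 H := by
      have := I.toInstance.two_le_iters h1
      omega
    calc I.toInstance.cells H = 1 * (1 * (1 * I.toInstance.cells H * 1)) := by ring
      _ ≤ 1220 * (H * I.work H) := by
        rw [work]
        gcongr
        norm_num
  set ℓ := bitLength I.encode
  set e := 1 / I.toInstance.dist
  -- A single quantity dominating the time, the number of cells and all input sizes, so that the bit
  -- cost becomes cubic in it.
  set W : ℝ := 2 ^ (4 * ℓ ^ 2 + 2 * ℓ + 27) * e ^ 4 with hWdef
  have he4 : 1 ≤ e ^ 4 := one_le_pow₀ he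
  have hpow : ∀ k : ℕ, k ≤ 4 * ℓ ^ 2 + 2 * ℓ + 27 → (2 : ℝ) ^ k ≤ W := fun k hk =>
    (pow_le_pow_right₀ (by norm_num) hk).trans (le_mul_of_one_le_right (by positivity) he4)
  have hW1 : 1 ≤ W := by simpa using hpow 0 (by omega)
  have w1 : (t : ℝ) ≤ W := le_trans (by exact_mod_cast ht) hW
  have w2 : (I.toInstance.cells H : ℝ) ≤ W := le_trans (by exact_mod_cast hcells) hW
  have w3 : (2 : ℝ) ^ ℓ ≤ W := hpow _ (by omega)
  have w4 : (8 : ℝ) ≤ W := by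
    have := hpow 3 (by omega)
    norm_num at this
    exact this
  have w5 : ((ℓ + 4 : ℕ) : ℝ) ≤ W := le_trans (by exact_mod_cast Nat.lt_two_pow_self.le)
    (hpow _ (by omega))
  have w6 : ((I.toInstance.cells H + 2 ^ ℓ + 8).size : ℝ) ≤ 3 * W := by
    have : (I.toInstance.cells H + 2 ^ ℓ + 8).size ≤ I.toInstance.cells H + 2 ^ ℓ + 8 :=
      Nat.size_le.2 Nat.lt_two_pow_self
    have : ((I.toInstance.cells H + 2 ^ ℓ + 8).size : ℝ) ≤
        I.toInstance.cells H + 2 ^ ℓ + 8 := by exact_mod_cast this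
    linarith
  have w7 : W ≤ W ^ 2 := by nlinarith
  have hle' : (b : ℝ) ≤ t * (1 + 3 * ((ℓ + 4 : ℕ) + t *
      ((I.toInstance.cells H + 2 ^ ℓ + 8).size + 1))) := by exact_mod_cast hle
  calc (b : ℝ) ≤ _ := hle'
    _ ≤ W * (1 + 3 * (W + W * (3 * W + 1))) := by gcongr
    _ ≤ 16 * W ^ 3 := by nlinarith
    _ = _ := by
      rw [hWdef]
      ring

end RatInstance

/-- For each player, existence of a winning policy is decidable off the threshold in time
polynomial in the inverse distance and exponential in the input length. -/
theorem RatInstance.decidable_wins (j : Player) :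
    DecidableInTime RatInstance.encode {I | I.toInstance.OffThreshold} {I | I.toInstance.Wins j}
      fun I => 2 ^ (12 * bitLength I.encode ^ 2 + 6 * bitLength I.encode + 85) *
        (1 / I.toInstance.dist) ^ 12 := by
  refine ⟨decider j, fun I hI => ?_⟩
  obtain ⟨hd, h, w, hret, hw, -, -, hh⟩ := Instance.algApprox_correct _ hI
  obtain ⟨s, t, hr, e, ht⟩ := run_decider hret (I.caps h hret.1) j
  obtain ⟨b, hb, hle⟩ := exec_of_run hd hret.1 hh hr ht
  refine ⟨s, t, b, hb, e.trans ?_, hle⟩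
  simp only [mem_ofPred_eq, ← hw j]

end BiddingMDP

/-! ### Assembly of the theorem. -/

open BiddingMDP in
theorem mainTheorem6 :
    -- the quantitative reachability problem, restricted to instances off the threshold
    (∀ j : Player,
      (∃ (q : Polynomial ℕ) (k : ℕ),
        DecidableInTime RatInstance.encode {I | I.toInstance.OffThreshold}
          {I | I.toInstance.Wins j}
          fun I => 2 ^ q.eval (bitLength I.encode) * (1 / I.toInstance.dist) ^ k) ∧
      (∀ r : Polynomial ℕ,
        InEXPTIME RatInstance.encode
          {I | I.toInstance.OffThreshold ∧
            1 / 2 ^ r.eval (bitLength I.encode) ≤ I.toInstance.dist}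
          {I | I.toInstance.Wins j})) ∧
    -- the algorithm, for suitable universal constants
    ∃ c d : ℝ, 0 < c ∧ 0 < d ∧
      -- soundness, completeness and number of rounds
      (∀ (V : Type*) [Fintype V] [MeasurableSpace V] [DiscreteMeasurableSpace V]
        (I : Instance V), I.OffThreshold →
        0 < I.dist ∧
        ∃ (h : ℕ) (w : Player), I.AlgApproxReturns c d h w ∧
          (∀ j, w = j ↔ I.Wins j) ∧
          (w = .reach → rvalStar I.M I.T I.v ∈ 𝓝[unitSquare] (I.B, I.p)) ∧
          (w = .safe → svalStar I.M I.T I.v ∈ 𝓝[unitSquare] (I.B, I.p)) ∧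
          h ≤ ⌈Real.logb 2 (1 / I.dist)⌉₊ + 1) ∧
      -- running time
      ∃ (P : Prog) (C : ℝ) (q : Polynomial ℕ) (k : ℕ), ∀ I : RatInstance,
        I.toInstance.OffThreshold →
        ∃ (s : RAM) (t b h : ℕ) (w : Player), Exec P (RAM.start I.encode) s t b ∧
          I.toInstance.AlgApproxReturns c d h w ∧ s.reg 0 = w.code ∧ s.reg 1 = h ∧
          (t : ℝ) ≤ C * ((I.N : ℝ) ^ 2 / I.toInstance.dist *
            max 1 (Real.logb 2 (1 / I.toInstance.dist)) ^ 3 *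
            (1 / I.toInstance.M.δmin) ^ (4 * I.N)) ∧
          (b : ℝ) ≤ 2 ^ q.eval (bitLength I.encode) * (1 / I.toInstance.dist) ^ k := by
  refine ⟨fun j => ⟨⟨12 * Polynomial.X ^ 2 + 6 * Polynomial.X + 85, 12, ?_⟩, fun r =>
    ⟨12 * Polynomial.X ^ 2 + 6 * Polynomial.X + 85 + 12 * r, ?_⟩⟩, 2, 8, by norm_num, by norm_num,
    fun V _ _ _ I hI => Instance.algApprox_correct _ hI, RatInstance.algorithm, 2 ^ 24,
    12 * Polynomial.X ^ 2 + 6 * Polynomial.X + 85, 12, fun I hI => ?_⟩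
  · simpa using RatInstance.decidable_wins j
  · obtain ⟨P, hP⟩ := RatInstance.decidable_wins j
    refine ⟨P, fun I hI => ?_⟩
    obtain ⟨s, t, b, hb, e, hle⟩ := hP I hI.1
    refine ⟨s, t, b, hb, e, hle.trans ?_⟩
    have hd : 0 < I.toInstance.dist := lt_of_lt_of_le (by positivity) hI.2
    have h1 : 1 / I.toInstance.dist ≤ 2 ^ r.eval (bitLength I.encode) := by
      rw [one_div_le hd (by positivity)]
      exact hI.2
    -- With distance at least `2 ^ (-r)` the factor of twelfth power is at most `2 ^ (12 r)`, which
    -- accounts for the summand `12 * r` in the exponent.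
    have h2 := pow_le_pow_left₀ (one_div_pos.2 hd).le h1 12
    rw [← pow_mul, mul_comm] at h2
    simp only [Polynomial.eval_add, Polynomial.eval_mul, Polynomial.eval_pow, Polynomial.eval_X,
      Polynomial.eval_ofNat]
    rw [pow_add (2 : ℝ) _ (12 * _)]
    gcongr
  · obtain ⟨hd, h, w, hret, -, -, -, hh⟩ := Instance.algApprox_correct _ hI
    obtain ⟨s, t, hr, e1, e2, ht⟩ := RatInstance.run_algorithm hret (I.caps h hret.1)
    have ht' : t ≤ 1220 * (h * I.work h) := by omega
    obtain ⟨b, hb, hle⟩ := RatInstance.exec_of_run hd hret.1 hh hr ht'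
    refine ⟨s, t, b, h, w, hb, hret, e1, e2,
      le_trans (by exact_mod_cast ht') (RatInstance.steps_le hd hret.1 hh), ?_⟩
    simpa using hle
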